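/- Let $m \ge n \ge 2$, let $M$ be a closed (compact, without boundary), connected, oriented $C^\infty$-smooth Riemannian $m$-manifold, and let $\Omega \subset \mathbb{R}^n$ be open. Let $\omega \in C^\infty(\wedge^n T^*M)$ be a closed $n$-form with $\omega_x \neq 0$ for every $x \in M$, whose de Rham class lies in the $n$-th layer $K^n(M)$ of the Künneth ideal of $M$, i.e. $[\omega]$ is a finite sum of products $c_i \wedge c_i'$ with $c_i \in H^{k_i}_{\mathrm{dR}}(M)$, $c_i' \in H^{n-k_i}_{\mathrm{dR}}(M)$ and $1 \le k_i \le n-1$. Let $K \ge 0$, let $\varepsilon > 0$, and let $\Sigma \in L^{1+\varepsilon}_{\mathrm{loc}}(\Omega)$. Let $F \in W^{1,n}_{\mathrm{loc}}(\Omega, M)$ (in particular, $F$ may be any map in $W^{1,n}(\Omega, M)$) with weak derivative $DF$. Here $F \in W^{1,p}_{\mathrm{loc}}(\Omega, M)$ means that $\iota \circ F \in W^{1,p}_{\mathrm{loc}}(\Omega, \mathbb{R}^l)$ for a smooth isometric embedding $\iota \colon M \to \mathbb{R}^l$, and $DF(x) \colon \mathbb{R}^n \to T_{F(x)}M$ is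 determined for a.e. $x$ by $D(\iota \circ F)(x) = D\iota(F(x)) \circ DF(x)$. Suppose that either $$|\omega_{F(x)}|_{\mathbf{M}}\, |DF(x)|^n \le K \star (F^*\omega)_x + \Sigma(x) \qquad \text{for a.e. } x \in \Omega,$$ or, for some $y_0 \in M$, $$|\omega_{F(x)}|_{\mathbf{M}}\, |DF(x)|^n \le K \star (F^*\omega)_x + \operatorname{dist}^n(F(x), y_0)\, \Sigma(x) \qquad \text{for a.e. } x \in \Omega,$$ where $|\cdot|_{\mathbf{M}}$ is the comass norm, $|DF(x)|$ is the operator norm, $\operatorname{dist}$ is the Riemannian distance of $M$, and $\star (F^*\omega)_x = \omega_{F(x)}(DF(x)e_1, \dots, DF(x)e_n)$ for the standard basis $e_1, \dots, e_n$ of $\mathbb{R}^n$. Then there is an $\varepsilon' > 0$ such that $F \in W^{1,n+\varepsilon'}_{\mathrm{loc}}(\Omega, M)$, and $F$ has a continuous representative, i.e. there is a continuous map $G \colon \Omega \to M$ with $G = F$ a.e. in $\Omega$. -/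

import Mathlib

open MeasureTheory Set Topology Bundle
open scoped Manifold ContDiff ENNReal

noncomputable section

namespace QRCurve

/-! ### Exterior product of alternating forms -/

section Wedge

variable {E : Type*} [AddCommGroup E] [Module ℝ E] [TopologicalSpace E]

/-- The exterior product of a `k`-covector and an `l`-covector, with the (redundant) target degree
`n = k + l` as a parameter:
`(α ∧ β)(v₁, …, vₙ) = ∑ sign(σ) α(v_σ(1), …, v_σ(k)) β(v_σ(k+1), …, v_σ(n))`, where the sum is over
`(k, l)`-shuffles `σ`. -/
def wedge {k l n : ℕ} (h : k + l = n) (α : E [⋀^Fin k]→L[ℝ] ℝ) (β : E [⋀^Fin l]→L[ℝ] ℝ) :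
    E [⋀^Fin n]→L[ℝ] ℝ :=
  { ((LinearMap.mul' ℝ ℝ).compAlternatingMap
      (α.toAlternatingMap.domCoprod β.toAlternatingMap)).domDomCongr
        (finSumFinEquiv.trans (finCongr h)) with
    cont := by
      change Continuous fun v : Fin n → E => LinearMap.mul' ℝ ℝ
        ((∑ σ : Equiv.Perm.ModSumCongr (Fin k) (Fin l),
          AlternatingMap.domCoprod.summand α.toAlternatingMap β.toAlternatingMap σ)
            fun i => v ((finSumFinEquiv.trans (finCongr h)) i))
      simp only [sum_apply, map_sum]
      refine continuous_finsetSum _ fun σ _ => ?_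
      induction σ using Quotient.inductionOn' with
      | _ σ =>
        simp only [AlternatingMap.domCoprod.summand_mk'', smul_apply,
          MultilinearMap.domDomCongr_apply, MultilinearMap.domCoprod_apply]
        simp only [Units.smul_def, map_zsmul, LinearMap.mul'_apply]
        refine Continuous.zsmul (Continuous.mul ?_ ?_) _
        · exact α.cont.comp (continuous_pi fun i => continuous_apply _)
        · exact β.cont.comp (continuous_pi fun i => continuous_apply _) }

end Wedge

/-! ### Differential forms on a manifold without boundary -/

section Forms

variable (m : ℕ) (M : Type*) [TopologicalSpace M] [ChartedSpace (EuclideanSpace ℝ (Fin m)) M]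

/-- A (not necessarily smooth) differential `k`-form on the `m`-manifold `M`. -/
abbrev DForm (k : ℕ) : Type _ := ∀ x : M, TangentSpace (𝓡 m) x [⋀^Fin k]→L[ℝ] ℝ

variable {m M} {k n : ℕ}

/-- The pull-back of a form to `ℝᵐ` by the inverse of the chart of `M` at `x₀`. It is meaningful on
the target of that chart. -/
def chartForm (θ : DForm m M k) (x₀ : M) (y : EuclideanSpace ℝ (Fin m)) :
    EuclideanSpace ℝ (Fin m) [⋀^Fin k]→L[ℝ] ℝ :=
  (θ ((extChartAt (𝓡 m) x₀).symm y)).compContinuousLinearMap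
    (mfderiv 𝓘(ℝ, EuclideanSpace ℝ (Fin m)) (𝓡 m) (extChartAt (𝓡 m) x₀).symm y)

/-- `C^∞`-smoothness of a form: its coefficients in the charts of `M` are smooth. -/
def IsSmoothForm (θ : DForm m M k) : Prop :=
  ∀ x₀ : M, ContDiffOn ℝ ∞ (chartForm θ x₀) (extChartAt (𝓡 m) x₀).target

/-- The exterior derivative of a form: at `x` it is computed in the chart at `x`. -/
def dForm (θ : DForm m M k) : DForm m M (k + 1) := fun x =>
  (extDeriv (chartForm θ x) (extChartAt (𝓡 m) x x)).compContinuousLinearMap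
    (mfderiv (𝓡 m) 𝓘(ℝ, EuclideanSpace ℝ (Fin m)) (extChartAt (𝓡 m) x) x)

/-- Smooth closed forms, i.e. the representatives of de Rham cohomology classes. -/
def IsClosedForm (θ : DForm m M k) : Prop := IsSmoothForm θ ∧ ∀ x, dForm θ x = 0

/-- Two `n`-forms are cohomologous if they differ by `dτ` for a smooth `(n-1)`-form `τ`; closed
forms are cohomologous iff they represent the same class in `H^n_dR(M)`. -/
def Cohomologous (θ θ' : DForm m M n) : Prop :=
  ∃ (p : ℕ) (hp : p + 1 = n) (τ : DForm m M p), IsSmoothForm τ ∧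
    ∀ x v, θ x v - θ' x v = dForm τ x (v ∘ Fin.cast hp)

/-- The class `[θ]` of the closed `n`-form `θ` lies in the `n`-th layer of the Künneth ideal:
`[θ] = ∑ i, [α i] ∧ [β i]` is a finite sum of products of de Rham classes of degrees
`k i` and `n - k i`, where `1 ≤ k i ≤ n - 1`. The product `[α] ∧ [β]` is the class of `α ∧ β`. -/
def InKunnethIdeal (θ : DForm m M n) : Prop :=
  ∃ (N : ℕ) (k l : Fin N → ℕ) (hkl : ∀ i, k i + l i = n)
    (α : ∀ i, DForm m M (k i)) (β : ∀ i, DForm m M (l i)),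
    (∀ i, 1 ≤ k i ∧ 1 ≤ l i ∧ IsClosedForm (α i) ∧ IsClosedForm (β i)) ∧
    Cohomologous θ (fun x => ∑ i, wedge (hkl i) (α i x) (β i x))

variable (m M) in
/-- Orientability of the `m`-manifold `M`: there is a smooth nowhere vanishing `m`-form. -/
def Orientable : Prop := ∃ o : DForm m M m, IsSmoothForm o ∧ ∀ x, o x ≠ 0

end Forms

/-! ### Sobolev functions and Sobolev maps -/

section Sobolev

variable {n : ℕ}

/-- `f ∈ L^p_loc(Ω)`. -/
def MemLpLoc {V : Type*} [NormedAddCommGroup V] (f : EuclideanSpace ℝ (Fin n) → V) (p : ℝ≥0∞)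
    (Ω : Set (EuclideanSpace ℝ (Fin n))) : Prop :=
  ∀ C ⊆ Ω, IsCompact C → MemLp f p (volume.restrict C)

/-- `g` is the weak derivative of `f` in `Ω`, tested against `C^∞_0(Ω)`
(for locally integrable `f` and `g`). -/
def HasWeakDeriv {V : Type*} [NormedAddCommGroup V] [NormedSpace ℝ V]
    (Ω : Set (EuclideanSpace ℝ (Fin n))) (f : EuclideanSpace ℝ (Fin n) → V)
    (g : EuclideanSpace ℝ (Fin n) → EuclideanSpace ℝ (Fin n) →L[ℝ] V) : Prop :=
  ∀ φ : EuclideanSpace ℝ (Fin n) → ℝ, ContDiff ℝ ∞ φ → HasCompactSupport φ → tsupport φ ⊆ Ω →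
    ∀ v, ∫ x, fderiv ℝ φ x v • f x = -∫ x, φ x • g x v

variable {m : ℕ} {M : Type*} [TopologicalSpace M] [ChartedSpace (EuclideanSpace ℝ (Fin m)) M]
  [RiemannianBundle (fun x : M => TangentSpace (𝓡 m) x)]

variable (m) in
/-- The derivative `T_x M → ℝ^l` at `x` of a map `ι : M → ℝ^l`. -/
def tangentMapAt {l : ℕ} (ι : M → EuclideanSpace ℝ (Fin l)) (x : M) :
    TangentSpace (𝓡 m) x →L[ℝ] EuclideanSpace ℝ (Fin l) :=
  mfderiv (𝓡 m) 𝓘(ℝ, EuclideanSpace ℝ (Fin l)) ι x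

variable (m) in
/-- A smooth embedding of `M` into `ℝ^l` that is isometric in the sense of preserving the
Riemannian metric. -/
structure IsNashEmbedding {l : ℕ} (ι : M → EuclideanSpace ℝ (Fin l)) : Prop where
  contMDiff : ContMDiff (𝓡 m) 𝓘(ℝ, EuclideanSpace ℝ (Fin l)) ∞ ι
  isEmbedding : IsEmbedding ι
  norm_mfderiv : ∀ (x : M) (v : TangentSpace (𝓡 m) x),
    ‖tangentMapAt m ι x v‖ = ‖v‖

/-- `F ∈ W^{1,p}_loc(Ω, M)` and `DF` is its weak derivative: for an isometric embedding
`ι : M → ℝ^l`, the map `ι ∘ F` belongs to `W^{1,p}_loc(Ω, ℝ^l)`, and its weak derivative at `x` is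
the composition of `DF x : T_x Ω → T_{F x} M` with the derivative of `ι` at `F x`. -/
def IsSobolevMap (p : ℝ≥0∞) (Ω : Set (EuclideanSpace ℝ (Fin n)))
    (F : EuclideanSpace ℝ (Fin n) → M)
    (DF : ∀ x, EuclideanSpace ℝ (Fin n) →L[ℝ] TangentSpace (𝓡 m) (F x)) : Prop :=
  ∃ (l : ℕ) (ι : M → EuclideanSpace ℝ (Fin l))
    (g : EuclideanSpace ℝ (Fin n) → EuclideanSpace ℝ (Fin n) →L[ℝ] EuclideanSpace ℝ (Fin l)),
    IsNashEmbedding m ι ∧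
    MemLpLoc (ι ∘ F) p Ω ∧ MemLpLoc g p Ω ∧ HasWeakDeriv Ω (ι ∘ F) g ∧
    ∀ᵐ x ∂volume.restrict Ω, g x = (tangentMapAt m ι (F x)).comp (DF x)

/-- The comass norm `sup {θ(v₁, …, v_k) : |v₁|, …, |v_k| ≤ 1}` of the form `θ` at `x`. -/
def comass {k : ℕ} (θ : DForm m M k) (x : M) : ℝ :=
  sSup {r : ℝ | ∃ v : Fin k → TangentSpace (𝓡 m) x, (∀ i, ‖v i‖ ≤ 1) ∧ r = θ x v}

/-- The function `⋆(F^*θ)` on `Ω ⊆ ℝⁿ`: the value of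
`(F^*θ)_x(v₁, …, vₙ) = θ_{F(x)}(DF(x)v₁, …, DF(x)vₙ)` on the standard basis of `ℝⁿ`. -/
def starPullback (θ : DForm m M n) (F : EuclideanSpace ℝ (Fin n) → M)
    (DF : ∀ x, EuclideanSpace ℝ (Fin n) →L[ℝ] TangentSpace (𝓡 m) (F x))
    (x : EuclideanSpace ℝ (Fin n)) : ℝ :=
  θ (F x) fun i => DF x (EuclideanSpace.single i 1)

end Sobolev

end QRCurve

end

open MeasureTheory Set Topology Bundle
open scoped Manifold ContDiff ENNReal

set_option linter.unusedSectionVars false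

/-! Embed `M` isometrically into `ℝ^l` by `ι`. Since `M` is compact, `f = ι ∘ F` is bounded, its
weak derivative `g` satisfies `|g| = |DF|`, distances in `M` are bounded by the diameter, and the
comass of the nowhere vanishing form is bounded below by some `c₀ > 0` (`exists_pos_le_comass`).
Both distortion inequalities therefore become `c₀ |g|^n ≤ K J + S'` with `J = ⋆F^*w` and `S'` in
`L^{1+ε}_loc`. The task is to bound integrals of `J` against cut-off functions by an integral of
`|g|^p` with some `p < n`, although pointwise `J` is only `O(|g|^n)`.

This gain is compensated compactness. By the Künneth hypothesis `w` is a finite sum of products `α ∧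
β` of closed forms of positive degree, plus an exact form `dτ`. All these forms extend to `C^1`
forms on `ℝ^l` (`exists_form_extension`). The extensions of `α` and `β` need not be closed, but
their pull-backs by `f` are weakly closed (`isWeaklyClosed_pullback`).

For closed forms `A`, `B` on `ℝⁿ`, translate `A` by a vector `y`. Its derivative along `y` is the
exact form `d(i_y A)`, so `∫ φ A ∧ B` changes only by a term in which the derivative falls on `φ`
(`abs_integral_mul_altPairing_fderiv_le`, `enorm_integral_mul_altPairing_le`). Averaging over `y` in
a ball of the size of `supp φ` and applying Hölder's inequality with three factors
(`lintegral_lintegral_mul_le`) gains an exponent `θ`, without potentials of `A` or Sobolev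
embeddings. The dilation `x + t y` costs `t^{-nθ}`; with `nθ = 1/2` this is integrable in `t`. For
`f^*dτ` one subtracts the constant form `τ(f z)`, integrates by parts and averages over `z`; the
difference `τ(f x) - τ(f z)` is again an integral over a segment. Both estimates are proved for
smooth data and passed to the limit along dominated mollifications (`exists_mollify_dominated`).

With `p = n / (1 + θ)`, a pulled-back form of degree `k` is measured in `L^{p/k}`, and the degrees
add up to `n = p (1 + θ)`. This gives `HasCompensatedBound`: up to a constant, `|∫ φ J|` is at most
the power `-θ` of the volume of the ball times `(∫ |g|^p)^{1+θ}`. Inserted in the distortion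
inequality, it is a reverse Hölder inequality for `|g|^p` with exponent `1 + θ` and error `S'`.

Gehring's lemma (`exists_lintegral_rpow_ne_top`) then yields `g ∈ L^{n+ε'}_loc`. It is proved by a
stopping time and Vitali covering (`lintegral_levelSet_le`) followed by integration over levels
(`lintegral_rpow_ne_top_of_levelSet_le`). As `n + ε' > n`, Morrey's inequality (`exists_morrey`)
gives local Hölder representatives of `ι ∘ F`. They take values in the compact set `ι(M)` and glue
to a continuous map (`exists_continuousOn_of_isEmbedding`). -/

namespace QRCurve

/-! ### Alternating sums over permutations. -/

section Alternation

variable {ι E : Type*} [Fintype ι] [DecidableEq ι]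

theorem sum_sign_mul_comp_perm (Φ : (ι → E) → ℝ) (v : ι → E) (ρ : Equiv.Perm ι) :
    ∑ σ : Equiv.Perm ι, ((Equiv.Perm.sign σ : ℤ) : ℝ) * Φ ((v ∘ σ) ∘ ρ) =
      ((Equiv.Perm.sign ρ : ℤ) : ℝ) * ∑ σ : Equiv.Perm ι, ((Equiv.Perm.sign σ : ℤ) : ℝ) * Φ (v ∘ σ) := by
  rw [← Equiv.sum_comp (Equiv.mulRight ρ) (fun σ => ((Equiv.Perm.sign σ : ℤ) : ℝ) * Φ (v ∘ σ)),
    Finset.mul_sum]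
  refine Finset.sum_congr rfl fun σ _ => ?_
  have h : ((Equiv.Perm.sign ρ : ℤ) : ℝ) * ((Equiv.Perm.sign ρ : ℤ) : ℝ) = 1 := by
    rcases Int.units_eq_one_or (Equiv.Perm.sign ρ) with h | h <;> simp [h]
  simp only [Equiv.coe_mulRight, Equiv.Perm.sign_mul, Units.val_mul, Int.cast_mul,
    Equiv.Perm.coe_mul, Function.comp_assoc]
  linear_combination (-((Equiv.Perm.sign σ : ℤ) : ℝ) * Φ (v ∘ (σ ∘ ρ))) * h

/-- In a fully antisymmetrized sum, all the terms of an alternating sum over the slots singled out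
by `e` contribute equally. -/
theorem sum_sign_mul_sum_removeNth {l : ℕ} (e : Fin (l + 1) ↪ ι)
    (Ψ : E → (Fin l → E) → (ι → E) → ℝ)
    (hΨ : ∀ a b u u', (∀ i ∉ range e, u i = u' i) → Ψ a b u = Ψ a b u') (v : ι → E) :
    ∑ σ : Equiv.Perm ι, ((Equiv.Perm.sign σ : ℤ) : ℝ) *
        ∑ j : Fin (l + 1), (-1) ^ (j : ℕ) * Ψ (v (σ (e j))) (j.removeNth (v ∘ σ ∘ e)) (v ∘ σ) =
      (l + 1) * ∑ σ : Equiv.Perm ι, ((Equiv.Perm.sign σ : ℤ) : ℝ) *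
        Ψ (v (σ (e 0))) (fun i => v (σ (e i.succ))) (v ∘ σ) := by
  set Φ : (ι → E) → ℝ := fun u => Ψ (u (e 0)) (fun i => u (e i.succ)) u with hΦ
  have key : ∀ j : Fin (l + 1), ∑ σ : Equiv.Perm ι, ((Equiv.Perm.sign σ : ℤ) : ℝ) *
      ((-1) ^ (j : ℕ) * Ψ (v (σ (e j))) (j.removeNth (v ∘ σ ∘ e)) (v ∘ σ)) =
      ∑ σ : Equiv.Perm ι, ((Equiv.Perm.sign σ : ℤ) : ℝ) * Φ (v ∘ σ) := by
    intro j
    -- The inverse of the cycle on `{0, …, j}`, acting on the slots of `e`, brings slot `j` to the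
    -- front and keeps the order of the others. Its sign `(-1)^j` cancels the explicit one, so all
    -- `j` give the same sum.
    have h := sum_sign_mul_comp_perm Φ v (Equiv.Perm.viaFintypeEmbedding j.cycleRange.symm e)
    have hs : ((Equiv.Perm.sign (Equiv.Perm.viaFintypeEmbedding j.cycleRange.symm e) : ℤ) : ℝ) =
        (-1) ^ (j : ℕ) := by
      rw [Equiv.Perm.viaFintypeEmbedding_sign, Equiv.Perm.sign_symm, Fin.sign_cycleRange]
      simp
    have h1 : ((-1 : ℝ) ^ (j : ℕ)) * (-1) ^ (j : ℕ) = 1 := by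
      rw [← mul_pow]; simp
    have h2 : ∀ σ : Equiv.Perm ι, Ψ (v (σ (e j))) (j.removeNth (v ∘ σ ∘ e)) (v ∘ σ) =
        Φ ((v ∘ σ) ∘ (Equiv.Perm.viaFintypeEmbedding j.cycleRange.symm e)) := by
      intro σ
      simp only [hΦ, Function.comp_apply, Equiv.Perm.viaFintypeEmbedding_apply_image,
        Fin.cycleRange_symm_zero, Fin.cycleRange_symm_succ]
      -- The last argument of `Ψ` changes only in the slots of `e`, which `Ψ` does not see.
      refine hΨ _ _ _ _ fun i hi => ?_
      simp [Equiv.Perm.viaFintypeEmbedding_apply_notMem_range _ _ hi]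
    simp_rw [h2, mul_left_comm _ ((-1 : ℝ) ^ (j : ℕ)), ← Finset.mul_sum]
    rw [h, hs, ← mul_assoc, h1, one_mul]
  simp_rw [Finset.mul_sum (s := (Finset.univ : Finset (Fin (l + 1))))]
  rw [Finset.sum_comm, Finset.sum_congr rfl fun j _ => key j]
  simp [hΦ]

end Alternation

/-! ### The antisymmetrized product and the pointwise algebra of closed forms. -/

section Pairing

variable {E : Type*} [NormedAddCommGroup E] [NormedSpace ℝ E] {k l n : ℕ}

/-- The antisymmetrization of the product of a `k`-covector and an `l`-covector, a multiple of their
exterior product. -/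
noncomputable def altPairing (v : Fin k ⊕ Fin l → E) (α : E [⋀^Fin k]→L[ℝ] ℝ)
    (β : E [⋀^Fin l]→L[ℝ] ℝ) : ℝ :=
  ∑ σ : Equiv.Perm (Fin k ⊕ Fin l), ((Equiv.Perm.sign σ : ℤ) : ℝ) *
    (α (fun i => v (σ (Sum.inl i))) * β (fun i => v (σ (Sum.inr i))))

/-- Each `(k, l)`-shuffle represents a coset of `k! l!` permutations on which the summand is
constant. The unnormalized sum over all permutations involves no quotient and can be reindexed
freely, so the estimates are carried out for it. -/
theorem factorial_mul_wedge_apply {E : Type*} [AddCommGroup E] [Module ℝ E] [TopologicalSpace E]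
    (h : k + l = n) (α : E [⋀^Fin k]→L[ℝ] ℝ) (β : E [⋀^Fin l]→L[ℝ] ℝ) (v : Fin n → E) :
    ((k.factorial * l.factorial : ℕ) : ℝ) * wedge h α β v =
      ∑ σ : Equiv.Perm (Fin k ⊕ Fin l), ((Equiv.Perm.sign σ : ℤ) : ℝ) *
        (α (fun i => v (finCongr h (finSumFinEquiv (σ (Sum.inl i))))) *
          β (fun i => v (finCongr h (finSumFinEquiv (σ (Sum.inr i)))))) := by
  have h1 := congrArg (fun f => LinearMap.mul' ℝ ℝ (f fun i => v (finCongr h (finSumFinEquiv i))))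
    (MultilinearMap.domCoprod_alternization_eq α.toAlternatingMap β.toAlternatingMap)
  simp only [Fintype.card_fin] at h1
  have h2 : wedge h α β v = LinearMap.mul' ℝ ℝ ((α.toAlternatingMap.domCoprod β.toAlternatingMap)
    fun i => v (finCongr h (finSumFinEquiv i))) := rfl
  rw [h2, ← nsmul_eq_mul, ← map_nsmul]
  refine h1.symm.trans ?_
  rw [MultilinearMap.alternatization_apply, map_sum]
  refine Finset.sum_congr rfl fun σ _ => ?_
  rw [Units.smul_def, map_zsmul]
  simp [MultilinearMap.domDomCongr_apply, MultilinearMap.domCoprod_apply]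

theorem altPairing_eq_wedge (h : k + l = n) (α : E [⋀^Fin k]→L[ℝ] ℝ) (β : E [⋀^Fin l]→L[ℝ] ℝ)
    (v : Fin n → E) :
    altPairing (fun i => v (finCongr h (finSumFinEquiv i))) α β =
      ((k.factorial * l.factorial : ℕ) : ℝ) * wedge h α β v :=
  (factorial_mul_wedge_apply h α β v).symm

theorem wedge_compContinuousLinearMap {F : Type*} [AddCommGroup F] [Module ℝ F] [TopologicalSpace F]
    (h : k + l = n) (α : F [⋀^Fin k]→L[ℝ] ℝ) (β : F [⋀^Fin l]→L[ℝ] ℝ) (L : E →L[ℝ] F)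
    (v : Fin n → E) :
    wedge h α β (fun i => L (v i)) =
      wedge h (α.compContinuousLinearMap L) (β.compContinuousLinearMap L) v := by
  have h0 : ((k.factorial * l.factorial : ℕ) : ℝ) ≠ 0 := by positivity
  refine mul_left_cancel₀ h0 ?_
  rw [factorial_mul_wedge_apply, factorial_mul_wedge_apply]
  rfl

theorem abs_altPairing_le (v : Fin k ⊕ Fin l → E) (hv : ∀ i, ‖v i‖ ≤ 1) (α : E [⋀^Fin k]→L[ℝ] ℝ)
    (β : E [⋀^Fin l]→L[ℝ] ℝ) :
    |altPairing v α β| ≤ (k + l).factorial * (‖α‖ * ‖β‖) := by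
  have hb : ∀ {j : ℕ} (γ : E [⋀^Fin j]→L[ℝ] ℝ) (u : Fin j → E), (∀ i, ‖u i‖ ≤ 1) → |γ u| ≤ ‖γ‖ := by
    intro j γ u hu
    refine (γ.le_opNorm u).trans (mul_le_of_le_one_right (norm_nonneg _) ?_)
    exact Finset.prod_le_one (fun _ _ => norm_nonneg _) fun i _ => hu i
  calc |altPairing v α β| ≤ ∑ σ : Equiv.Perm (Fin k ⊕ Fin l), (‖α‖ * ‖β‖) := by
        refine (Finset.abs_sum_le_sum_abs _ _).trans (Finset.sum_le_sum fun σ _ => ?_)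
        rw [abs_mul, abs_mul]
        have : |((Equiv.Perm.sign σ : ℤ) : ℝ)| = 1 := by
          rcases Int.units_eq_one_or (Equiv.Perm.sign σ) with h | h <;> simp [h]
        rw [this, one_mul]
        exact mul_le_mul (hb α _ fun i => hv _) (hb β _ fun i => hv _) (abs_nonneg _)
          (norm_nonneg _)
    _ = _ := by simp [Fintype.card_perm]

/-- The identity `dA(y, w) = 0` trades the derivative of `A` along `y` for derivatives along the
entries of `w`, with `y` moved into the first argument. After antisymmetrization the `k + 1`
resulting terms coincide. This is Cartan's formula `L_y A = d(i_y A)` for closed `A`, wedged with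
`β`. -/
theorem altPairing_fderiv_eq {A : E → E [⋀^Fin (k + 1)]→L[ℝ] ℝ} {x : E} (hA : extDeriv A x = 0)
    (v : Fin (k + 1) ⊕ Fin l → E) (y : E) (β : E [⋀^Fin l]→L[ℝ] ℝ) :
    altPairing v (fderiv ℝ A x y) β =
      (k + 1) * ∑ σ : Equiv.Perm (Fin (k + 1) ⊕ Fin l), ((Equiv.Perm.sign σ : ℤ) : ℝ) *
        (fderiv ℝ A x (v (σ (Sum.inl 0))) (Fin.cons y fun i => v (σ (Sum.inl i.succ))) *
          β (fun i => v (σ (Sum.inr i)))) := by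
  have h1 : ∀ w : Fin (k + 1) → E, fderiv ℝ A x y w =
      ∑ j : Fin (k + 1), (-1) ^ (j : ℕ) * fderiv ℝ A x (w j) (Fin.cons y (j.removeNth w)) := by
    intro w
    have h := congrArg (fun f => f (Fin.cons y w : Fin (k + 2) → E)) hA
    simp only [extDeriv, ContinuousAlternatingMap.alternatizeUncurryFin_apply] at h
    rw [Fin.sum_univ_succ] at h
    simp only [Fin.cons_zero, Fin.cons_succ, Fin.val_zero, pow_zero, one_smul, Fin.val_succ,
      ContinuousAlternatingMap.coe_zero, Pi.zero_apply] at h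
    have h0 : (Fin.removeNth 0 (Fin.cons y w : Fin (k + 2) → E)) = w := by
      ext i; simp [Fin.removeNth]
    have h3 : ∀ j : Fin (k + 1), (Fin.removeNth j.succ (Fin.cons y w : Fin (k + 2) → E)) =
        (Fin.cons y (j.removeNth w) : Fin (k + 1) → E) := by
      intro j; ext i
      refine Fin.cases ?_ (fun i => ?_) i <;> simp [Fin.removeNth]
    simp only [h0, h3] at h
    rw [eq_neg_of_add_eq_zero_left h, ← Finset.sum_neg_distrib]
    refine Finset.sum_congr rfl fun j _ => ?_
    rw [pow_succ]; simp
  refine Eq.trans ?_ (sum_sign_mul_sum_removeNth (⟨Sum.inl, Sum.inl_injective⟩ : Fin (k + 1) ↪ Fin (k + 1) ⊕ Fin l)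
    (fun a b u => fderiv ℝ A x a (Fin.cons y b) * β (fun i => u (Sum.inr i))) ?_ v)
  · refine Finset.sum_congr rfl fun σ _ => ?_
    rw [h1, Finset.sum_mul]
    congr 1
    refine Finset.sum_congr rfl fun j _ => ?_
    rw [mul_assoc]
    rfl
  · intro a b u u' h
    congr 2
    ext i
    exact h _ (by simp)

/-- Antisymmetrizing over the direction of differentiation together with the arguments of `B`
produces `dB`. This is the term of `d(i_y A ∧ B)` in which the derivative falls on `B`. -/
theorem sum_sign_mul_fderiv_eq_zero {B : E → E [⋀^Fin l]→L[ℝ] ℝ} {x : E} (hB : extDeriv B x = 0)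
    (v : Fin (k + 1) ⊕ Fin l → E) (y : E) (α : E [⋀^Fin (k + 1)]→L[ℝ] ℝ) :
    ∑ σ : Equiv.Perm (Fin (k + 1) ⊕ Fin l), ((Equiv.Perm.sign σ : ℤ) : ℝ) *
        (α (Fin.cons y fun i => v (σ (Sum.inl i.succ))) *
          fderiv ℝ B x (v (σ (Sum.inl 0))) (fun i => v (σ (Sum.inr i)))) = 0 := by
  -- The slots to be alternated: the first slot of the left block, which holds the direction of
  -- differentiation, followed by the arguments of `B`.
  let e : Fin (l + 1) ↪ Fin (k + 1) ⊕ Fin l :=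
    ⟨Fin.cons (Sum.inl 0) Sum.inr, by
      rw [Fin.cons_injective_iff]
      exact ⟨by simp, Sum.inr_injective⟩⟩
  have h := sum_sign_mul_sum_removeNth e
    (fun a b u => α (Fin.cons y fun i => u (Sum.inl i.succ)) * fderiv ℝ B x a b) (by
      intro a b u u' h
      congr 3
      ext i
      refine h _ ?_
      rintro ⟨j, hj⟩
      revert hj
      refine Fin.cases ?_ (fun j => ?_) j <;> simp [e]
      exact fun h => absurd h.symm (Fin.succ_ne_zero i)) v
  have h1 : ∀ σ : Equiv.Perm (Fin (k + 1) ⊕ Fin l),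
      ∑ j : Fin (l + 1), (-1 : ℝ) ^ (j : ℕ) * (α (Fin.cons y fun i => v (σ (Sum.inl i.succ))) *
        fderiv ℝ B x (v (σ (e j))) (j.removeNth (v ∘ σ ∘ e))) = 0 := by
    intro σ
    have h := congrArg (fun f => f (v ∘ σ ∘ e)) hB
    simp only [extDeriv, ContinuousAlternatingMap.alternatizeUncurryFin_apply,
      ContinuousAlternatingMap.coe_zero, Pi.zero_apply] at h
    simp only [mul_left_comm ((-1 : ℝ) ^ _), ← Finset.mul_sum]
    refine mul_eq_zero_of_right _ (Eq.trans ?_ h)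
    exact Finset.sum_congr rfl fun j _ => by simp
  simp only [Function.comp_apply, h1, mul_zero, Finset.sum_const_zero] at h
  have hl : ((l : ℝ) + 1) ≠ 0 := by positivity
  exact ((mul_eq_zero.1 h.symm).resolve_left hl)

end Pairing

/-! ### The effect of translating a closed form. -/

section ClosedForms

variable {E : Type*} [NormedAddCommGroup E] [NormedSpace ℝ E] [FiniteDimensional ℝ E]
  [MeasurableSpace E] [BorelSpace E] {μ : Measure E} [μ.IsAddHaarMeasure] {k l : ℕ}

theorem integral_fderiv_apply_eq_zero {u : E → ℝ} (hu : ContDiff ℝ 1 u) (hc : HasCompactSupport u)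
    (w : E) : ∫ x, fderiv ℝ u x w ∂μ = 0 := by
  have hd : Continuous fun x => fderiv ℝ u x w :=
    (hu.continuous_fderiv one_ne_zero).clm_apply continuous_const
  have hi : Integrable (fun x => fderiv ℝ u x w) μ :=
    hd.integrable_of_hasCompactSupport (hc.fderiv_apply (𝕜 := ℝ) w)
  have h := integral_mul_fderiv_eq_neg_fderiv_mul_of_integrable (μ := μ) (f := fun _ : E => (1 : ℝ))
    (g := u) (v := w) (by simp) (by simpa using hi)
    (by simpa using hu.continuous.integrable_of_hasCompactSupport hc)
    (fun _ _ => differentiableAt_const _) (fun x _ => hu.differentiable one_ne_zero x)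
  simpa using h

theorem contDiff_alternating_apply {r : WithTop ℕ∞} {A : E → E [⋀^Fin k]→L[ℝ] ℝ}
    (hA : ContDiff ℝ r A) (w : Fin k → E) : ContDiff ℝ r fun x => A x w :=
  (ContinuousAlternatingMap.apply ℝ E ℝ w).contDiff.comp hA

theorem fderiv_alternating_apply {A : E → E [⋀^Fin k]→L[ℝ] ℝ} {x : E} (hA : DifferentiableAt ℝ A x)
    (w : Fin k → E) (y : E) : fderiv ℝ (fun x => A x w) x y = fderiv ℝ A x y w := by
  have := ((ContinuousAlternatingMap.apply ℝ E ℝ w).hasFDerivAt.comp x hA.hasFDerivAt).fderiv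
  exact congrArg (fun L => L y) this

theorem abs_alternating_apply_le {γ : E [⋀^Fin k]→L[ℝ] ℝ} {u : Fin k → E} (hu : ∀ i, ‖u i‖ ≤ 1) :
    |γ u| ≤ ‖γ‖ := by
  refine (γ.le_opNorm u).trans (mul_le_of_le_one_right (norm_nonneg _) ?_)
  exact Finset.prod_le_one (fun _ _ => norm_nonneg _) fun i _ => hu i

theorem contDiff_altPairing {r : WithTop ℕ∞} {A : E → E [⋀^Fin k]→L[ℝ] ℝ}
    {B : E → E [⋀^Fin l]→L[ℝ] ℝ} (hA : ContDiff ℝ r A) (hB : ContDiff ℝ r B)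
    (v : Fin k ⊕ Fin l → E) : ContDiff ℝ r fun x => altPairing v (A x) (B x) := by
  unfold altPairing
  refine ContDiff.sum fun σ _ => contDiff_const.mul ?_
  exact (contDiff_alternating_apply hA _).mul (contDiff_alternating_apply hB _)

/-- For closed `A` and `B`, `φ L_y A ∧ B = d(φ i_y A ∧ B) - dφ ∧ i_y A ∧ B`, and the exact term
integrates to zero. Hence no derivative of `A` or `B` is left on the right-hand side. -/
theorem abs_integral_mul_altPairing_fderiv_le {A : E → E [⋀^Fin (k + 1)]→L[ℝ] ℝ}
    {B : E → E [⋀^Fin l]→L[ℝ] ℝ} {φ : E → ℝ} (hA : ContDiff ℝ 1 A) (hB : ContDiff ℝ 1 B)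
    (hφ : ContDiff ℝ 1 φ) (hc : HasCompactSupport φ)
    (hdA : ∀ x ∈ tsupport φ, extDeriv A x = 0) (hdB : ∀ x ∈ tsupport φ, extDeriv B x = 0)
    (v : Fin (k + 1) ⊕ Fin l → E) (hv : ∀ i, ‖v i‖ ≤ 1) (y : E) :
    |∫ x, φ x * altPairing v (fderiv ℝ A x y) (B x) ∂μ| ≤
      (k + 1) * (k + 1 + l).factorial * ‖y‖ * ∫ x, ‖fderiv ℝ φ x‖ * (‖A x‖ * ‖B x‖) ∂μ := by
  set s : Equiv.Perm (Fin (k + 1) ⊕ Fin l) → ℝ := fun σ => ((Equiv.Perm.sign σ : ℤ) : ℝ) with hs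
  have hs1 : ∀ σ, |s σ| = 1 := fun σ => by
    rcases Int.units_eq_one_or (Equiv.Perm.sign σ) with h | h <;> simp [hs, h]
  set a : Equiv.Perm (Fin (k + 1) ⊕ Fin l) → E → ℝ :=
    fun σ x => A x (Fin.cons y fun i => v (σ (Sum.inl i.succ))) with ha
  set b : Equiv.Perm (Fin (k + 1) ⊕ Fin l) → E → ℝ := fun σ x => B x fun i => v (σ (Sum.inr i)) with hb
  have haC : ∀ σ, ContDiff ℝ 1 (a σ) := fun σ => contDiff_alternating_apply hA _
  have hbC : ∀ σ, ContDiff ℝ 1 (b σ) := fun σ => contDiff_alternating_apply hB _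
  -- `D` is a total derivative and so integrates to zero; `R` is its part in which `φ` is
  -- differentiated.
  set D : Equiv.Perm (Fin (k + 1) ⊕ Fin l) → E → ℝ :=
    fun σ x => fderiv ℝ (fun z => φ z * (a σ z * b σ z)) x (v (σ (Sum.inl 0))) with hD
  set R : Equiv.Perm (Fin (k + 1) ⊕ Fin l) → E → ℝ :=
    fun σ x => fderiv ℝ φ x (v (σ (Sum.inl 0))) * (a σ x * b σ x) with hR
  have hDi : ∀ σ, Integrable (D σ) μ := fun σ =>
    (((hφ.mul ((haC σ).mul (hbC σ))).continuous_fderiv one_ne_zero).clm_apply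
      continuous_const).integrable_of_hasCompactSupport ((hc.mul_right).fderiv_apply (𝕜 := ℝ) _)
  have hRi : ∀ σ, Integrable (R σ) μ := fun σ =>
    (((hφ.continuous_fderiv one_ne_zero).clm_apply continuous_const).mul
      ((haC σ).continuous.mul (hbC σ).continuous)).integrable_of_hasCompactSupport
        ((hc.fderiv_apply (𝕜 := ℝ) _).mul_right)
  -- On the support of `φ`, `D - R` has a part with `A` differentiated, which sums to the integrand,
  -- and a part with `B` differentiated, which sums to zero. Off the support everything vanishes, so
  -- closedness is needed only there.
  have key : ∀ x, φ x * altPairing v (fderiv ℝ A x y) (B x) =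
      (k + 1) * ∑ σ, s σ * (D σ x - R σ x) := by
    intro x
    by_cases hx : x ∈ tsupport φ
    · have h1 := altPairing_fderiv_eq (hdA x hx) v y (B x)
      have h2 := sum_sign_mul_fderiv_eq_zero (hdB x hx) v y (A x)
      have h3 : ∀ σ, D σ x - R σ x =
          φ x * (fderiv ℝ A x (v (σ (Sum.inl 0))) (Fin.cons y fun i => v (σ (Sum.inl i.succ))) *
            B x (fun i => v (σ (Sum.inr i)))) +
          φ x * (A x (Fin.cons y fun i => v (σ (Sum.inl i.succ))) *
            fderiv ℝ B x (v (σ (Sum.inl 0))) (fun i => v (σ (Sum.inr i)))) := by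
        intro σ
        have e1 := fderiv_alternating_apply (hA.differentiable one_ne_zero x)
          (Fin.cons y fun i => v (σ (Sum.inl i.succ))) (v (σ (Sum.inl 0)))
        have e2 := fderiv_alternating_apply (hB.differentiable one_ne_zero x)
          (fun i => v (σ (Sum.inr i))) (v (σ (Sum.inl 0)))
        rw [← e1, ← e2]
        have e3 : HasFDerivAt (fun z => φ z * (a σ z * b σ z)) _ x :=
          ((hφ.differentiable one_ne_zero x).hasFDerivAt.mul
            (((haC σ).differentiable one_ne_zero x).hasFDerivAt.mul
              ((hbC σ).differentiable one_ne_zero x).hasFDerivAt))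
        simp only [hD, hR, e3.fderiv]
        simp only [add_apply, smul_apply, smul_eq_mul,
          ha, hb]
        ring
      rw [h1]
      simp_rw [h3, mul_add, Finset.sum_add_distrib]
      have h4 : ∀ (c : Equiv.Perm (Fin (k + 1) ⊕ Fin l) → ℝ), ∑ σ, s σ * (φ x * c σ) =
          φ x * ∑ σ, s σ * c σ := fun c => by
        rw [Finset.mul_sum]; exact Finset.sum_congr rfl fun _ _ => by ring
      rw [h4, h4, h2]
      ring
    · have h0 : φ x = 0 := image_eq_zero_of_notMem_tsupport hx
      have h1 : ∀ σ, D σ x = 0 := fun σ => by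
        have : x ∉ tsupport fun z => φ z * (a σ z * b σ z) :=
          fun h => hx (closure_mono (Function.support_mul_subset_left _ _) h)
        have := image_eq_zero_of_notMem_tsupport
          (fun h => this (tsupport_fderiv_subset ℝ h))
        simp [hD, this]
      have h2 : ∀ σ, R σ x = 0 := fun σ => by
        have := image_eq_zero_of_notMem_tsupport
          (fun h => hx (tsupport_fderiv_subset ℝ h))
        simp [hR, this]
      simp [h0, h1, h2]
  have hint : ∫ x, φ x * altPairing v (fderiv ℝ A x y) (B x) ∂μ =
      -((k + 1) * ∑ σ, s σ * ∫ x, R σ x ∂μ) := by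
    simp_rw [key]
    rw [integral_const_mul, integral_finsetSum (f := fun σ x => s σ * (D σ x - R σ x)) _
      fun σ _ => ((hDi σ).sub (hRi σ)).const_mul _,
      ← mul_neg, ← Finset.sum_neg_distrib]
    congr 1
    refine Finset.sum_congr rfl fun σ _ => ?_
    rw [integral_const_mul, integral_sub (hDi σ) (hRi σ),
      integral_fderiv_apply_eq_zero (hφ.mul ((haC σ).mul (hbC σ))) hc.mul_right]
    ring
  have hbound : ∀ σ, |∫ x, R σ x ∂μ| ≤ ‖y‖ * ∫ x, ‖fderiv ℝ φ x‖ * (‖A x‖ * ‖B x‖) ∂μ := by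
    intro σ
    rw [← integral_const_mul]
    refine (norm_integral_le_integral_norm _).trans (integral_mono (hRi σ).norm ?_ fun x => ?_)
    · refine Integrable.const_mul (Continuous.integrable_of_hasCompactSupport ?_ ?_) _
      · exact (hφ.continuous_fderiv one_ne_zero).norm.mul (hA.continuous.norm.mul hB.continuous.norm)
      · exact ((hc.fderiv (𝕜 := ℝ)).norm).mul_right
    · simp only [hR, norm_mul, Real.norm_eq_abs]
      have e1 : |fderiv ℝ φ x (v (σ (Sum.inl 0)))| ≤ ‖fderiv ℝ φ x‖ :=
        ((fderiv ℝ φ x).le_opNorm _).trans (mul_le_of_le_one_right (norm_nonneg _) (hv _))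
      have e2 : |a σ x| ≤ ‖A x‖ * ‖y‖ := by
        refine ((A x).le_opNorm _).trans (mul_le_mul_of_nonneg_left ?_ (norm_nonneg _))
        rw [Fin.prod_univ_succ]
        simp only [Fin.cons_zero, Fin.cons_succ]
        exact mul_le_of_le_one_right (norm_nonneg _)
          (Finset.prod_le_one (fun _ _ => norm_nonneg _) fun i _ => hv _)
      have e3 : |b σ x| ≤ ‖B x‖ := abs_alternating_apply_le fun i => hv _
      calc |fderiv ℝ φ x (v (σ (Sum.inl 0)))| * (|a σ x| * |b σ x|)
          ≤ ‖fderiv ℝ φ x‖ * ((‖A x‖ * ‖y‖) * ‖B x‖) := by gcongr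
        _ = _ := by ring
  rw [hint, abs_neg, abs_mul, abs_of_nonneg (by positivity : (0 : ℝ) ≤ k + 1), mul_assoc, mul_assoc]
  refine mul_le_mul_of_nonneg_left ?_ (by positivity)
  calc |∑ σ, s σ * ∫ x, R σ x ∂μ| ≤ ∑ σ : Equiv.Perm (Fin (k + 1) ⊕ Fin l),
        (‖y‖ * ∫ x, ‖fderiv ℝ φ x‖ * (‖A x‖ * ‖B x‖) ∂μ) := by
        refine (Finset.abs_sum_le_sum_abs _ _).trans (Finset.sum_le_sum fun σ _ => ?_)
        rw [abs_mul, hs1, one_mul]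
        exact hbound σ
    _ = _ := by simp [Fintype.card_perm]

/-- Homotopy along a translation: the integral of `φ A ∧ B` changes in a controlled way when the closed
form `A` is translated by `y`. -/
theorem enorm_integral_mul_altPairing_le {A : E → E [⋀^Fin (k + 1)]→L[ℝ] ℝ}
    {B : E → E [⋀^Fin l]→L[ℝ] ℝ} {φ : E → ℝ} (hA : ContDiff ℝ 1 A) (hB : ContDiff ℝ 1 B)
    (hφ : ContDiff ℝ 1 φ) (hc : HasCompactSupport φ) (y : E)
    (hdA : ∀ x ∈ tsupport φ, ∀ t ∈ Icc (0 : ℝ) 1, extDeriv A (x + t • y) = 0)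
    (hdB : ∀ x ∈ tsupport φ, extDeriv B x = 0)
    (v : Fin (k + 1) ⊕ Fin l → E) (hv : ∀ i, ‖v i‖ ≤ 1) :
    ‖∫ x, φ x * altPairing v (A x) (B x) ∂μ‖ₑ ≤
      ((k + 1) * (k + 1 + l).factorial : ℕ) * (
        ∫⁻ x, ‖φ x‖ₑ * (‖A (x + y)‖ₑ * ‖B x‖ₑ) ∂μ +
        ‖y‖ₑ * ∫⁻ t in Ioc (0 : ℝ) 1, ∫⁻ x, ‖fderiv ℝ φ x‖ₑ * (‖A (x + t • y)‖ₑ * ‖B x‖ₑ) ∂μ) := by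
  -- The derivative in `t` of the integrand `s x t` built from the translate `A (x + t • y)`.
  set G : E → ℝ → ℝ := fun x t => φ x * altPairing v (fderiv ℝ A (x + t • y) y) (B x) with hG
  have hxt : Continuous fun p : E × ℝ => p.1 + p.2 • y := by fun_prop
  have hGc : Continuous (Function.uncurry G) := by
    refine (hφ.continuous.comp continuous_fst).mul ?_
    unfold altPairing
    refine continuous_finsetSum _ fun σ _ => continuous_const.mul (Continuous.mul ?_ ?_)
    · refine (ContinuousAlternatingMap.apply ℝ E ℝ _).continuous.comp ?_
      exact ((hA.continuous_fderiv one_ne_zero).comp hxt).clm_apply continuous_const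
    · exact ((ContinuousAlternatingMap.apply ℝ E ℝ _).continuous.comp hB.continuous).comp
        continuous_fst
  have hAt : ∀ t : ℝ, ContDiff ℝ 1 fun x => A (x + t • y) := fun t =>
    hA.comp (contDiff_id.add contDiff_const)
  set s : E → ℝ → ℝ := fun x t => φ x * altPairing v (A (x + t • y)) (B x) with hs
  have hsi : ∀ t, Integrable (fun x => s x t) μ := fun t =>
    (hφ.continuous.mul (contDiff_altPairing (hAt t) hB v).continuous).integrable_of_hasCompactSupport
      hc.mul_right
  have hder : ∀ x t, HasDerivAt (s x) (G x t) t := by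
    intro x t
    have h1 : HasDerivAt (fun t : ℝ => A (x + t • y)) (fderiv ℝ A (x + t • y) y) t := by
      have h2 : HasDerivAt (fun t : ℝ => x + t • y) y t := by
        simpa using ((hasDerivAt_id t).smul_const y).const_add x
      exact (hA.differentiable one_ne_zero _).hasFDerivAt.comp_hasDerivAt t h2
    simp only [hs, hG, altPairing]
    refine HasDerivAt.const_mul _ (HasDerivAt.fun_sum fun σ _ => HasDerivAt.const_mul _ ?_)
    exact ((ContinuousAlternatingMap.apply ℝ E ℝ _).hasFDerivAt.comp_hasDerivAt t h1).mul_const _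
  have hFTC : ∀ x, ∫ t in Ioc (0 : ℝ) 1, G x t = s x 1 - s x 0 := by
    intro x
    rw [← intervalIntegral.integral_of_le zero_le_one]
    refine intervalIntegral.integral_eq_sub_of_hasDerivAt (fun t _ => hder x t) ?_
    exact (hGc.comp (Continuous.prodMk_right x)).intervalIntegrable _ _
  have hGi : Integrable (Function.uncurry G) (μ.prod (volume.restrict (Ioc (0 : ℝ) 1))) := by
    have h1 : IntegrableOn (Function.uncurry G) (tsupport φ ×ˢ Icc (0 : ℝ) 1)
        (μ.prod (volume : Measure ℝ)) :=
      hGc.continuousOn.integrableOn_compact (hc.isCompact.prod isCompact_Icc)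
    have h2 : IntegrableOn (Function.uncurry G) ((univ : Set E) ×ˢ Ioc (0 : ℝ) 1)
        (μ.prod (volume : Measure ℝ)) := by
      refine (h1.mono_set (prod_mono_right Ioc_subset_Icc_self)).of_forall_sdiff_eq_zero
        (MeasurableSet.univ.prod measurableSet_Ioc) ?_
      rintro ⟨x, t⟩ ⟨h3, h4⟩
      have : x ∉ tsupport φ := fun h => h4 ⟨h, h3.2⟩
      simp [Function.uncurry, hG, image_eq_zero_of_notMem_tsupport this]
    rwa [IntegrableOn, ← Measure.prod_restrict, Measure.restrict_univ] at h2
  -- Fundamental theorem of calculus in `t`, then Fubini: the integral at time `0` is the one at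
  -- time `1` minus the accumulated change.
  have hswap : ∫ x, s x 0 ∂μ = ∫ x, s x 1 ∂μ - ∫ t in Ioc (0 : ℝ) 1, ∫ x, G x t ∂μ := by
    rw [← integral_integral_swap hGi]
    simp_rw [hFTC]
    rw [integral_sub (hsi 1) (hsi 0)]
    ring
  have h0 : ∫ x, φ x * altPairing v (A x) (B x) ∂μ = ∫ x, s x 0 ∂μ := by simp [hs]
  have hfac : (((k + 1) * (k + 1 + l).factorial : ℕ) : ℝ≥0∞) =
      ‖((k : ℝ) + 1) * (k + 1 + l).factorial‖ₑ := by
    rw [Real.enorm_eq_ofReal (by positivity), ← ENNReal.ofReal_natCast]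
    push_cast; rfl
  rw [h0, hswap, mul_add]
  refine (enorm_sub_le).trans (add_le_add ?_ ?_)
  · refine (enorm_integral_le_lintegral_enorm _).trans ?_
    rw [← lintegral_const_mul' _ _ (ENNReal.natCast_ne_top _)]
    refine lintegral_mono fun x => ?_
    simp only [hs, one_smul, enorm_mul]
    rw [mul_left_comm]
    refine mul_le_mul_right (?_) _
    have h1 : ‖altPairing v (A (x + y)) (B x)‖ ≤
        ‖((k : ℝ) + 1) * (k + 1 + l).factorial * (‖A (x + y)‖ * ‖B x‖)‖ := by
      rw [Real.norm_eq_abs, Real.norm_of_nonneg (by positivity)]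
      refine (abs_altPairing_le v hv _ _).trans ?_
      refine mul_le_mul_of_nonneg_right ?_ (by positivity)
      -- The boundary term does not need the factor `k + 1`; it is inserted to have one constant for
      -- both terms.
      exact le_mul_of_one_le_left (by positivity) (by linarith [(Nat.cast_nonneg k : (0 : ℝ) ≤ k)])
    refine (enorm_le_iff_norm_le.2 h1).trans ?_
    rw [hfac, enorm_mul, enorm_mul (‖A (x + y)‖)]
    simp
  · refine (enorm_integral_le_lintegral_enorm _).trans ?_
    rw [← mul_assoc, ← lintegral_const_mul' _ _
      (ENNReal.mul_ne_top (ENNReal.natCast_ne_top _) enorm_ne_top)]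
    refine setLIntegral_mono' measurableSet_Ioc fun t ht => ?_
    have h1 := abs_integral_mul_altPairing_fderiv_le (μ := μ) (hAt t) hB hφ hc (fun x hx => ?_) hdB v hv y
    · have h2 : ∀ x, fderiv ℝ (fun x => A (x + t • y)) x = fderiv ℝ A (x + t • y) := fun x => by
        rw [fderiv_comp_add_right]
      simp_rw [h2] at h1
      have h3 : ‖∫ x, G x t ∂μ‖ ≤ ‖((k : ℝ) + 1) * (k + 1 + l).factorial * ‖y‖ *
          ∫ x, ‖fderiv ℝ φ x‖ * (‖A (x + t • y)‖ * ‖B x‖) ∂μ‖ := h1.trans (le_abs_self _)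
      refine (enorm_le_iff_norm_le.2 h3).trans ?_
      rw [enorm_mul, enorm_mul, hfac, enorm_norm]
      refine mul_le_mul_right ((enorm_integral_le_lintegral_enorm _).trans (le_of_eq ?_)) _
      simp [enorm_mul]
    · have h4 : extDeriv (fun x => A (x + t • y)) x = extDeriv A (x + t • y) := by
        simp only [extDeriv, fderiv_comp_add_right]
      rw [h4]
      exact hdA x hx t (Ioc_subset_Icc_self ht)

end ClosedForms

/-! ### Averaging over translations: fractional integration by Hölder's inequality. -/

section Potential

open Module Metric

variable {E : Type*} [NormedAddCommGroup E] [NormedSpace ℝ E] [FiniteDimensional ℝ E]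
  [MeasurableSpace E] [BorelSpace E] {μ : Measure E} [μ.IsAddHaarMeasure] {k l : ℕ}

theorem lintegral_comp_add_smul {u : E → ℝ≥0∞} (hu : Measurable u) (x : E) {t : ℝ} (ht : 0 < t) :
    ∫⁻ y, u (x + t • y) ∂μ = ENNReal.ofReal t ^ (-(finrank ℝ E : ℝ)) * ∫⁻ y, u y ∂μ := by
  have h1 : ∫⁻ y, u (x + t • y) ∂μ = ∫⁻ z, u (x + z) ∂(Measure.map (t • ·) μ) := by
    rw [lintegral_map (by fun_prop) (by fun_prop)]
  rw [h1, Measure.map_addHaar_smul μ ht.ne', lintegral_smul_measure, lintegral_add_left_eq_self,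
    smul_eq_mul]
  congr 1
  rw [abs_of_pos (by positivity), ENNReal.ofReal_rpow_of_pos ht, Real.rpow_neg ht.le,
    Real.rpow_natCast]

/-- A three-function Hölder inequality, from which one reads off the mapping properties of fractional
integrals. -/
theorem lintegral_lintegral_mul_le {u v : E → ℝ≥0∞} (hu : Measurable u) (hv : Measurable v)
    {θ s₁ s₂ : ℝ} (hθ : 0 ≤ θ) (hs₁ : s₁ ≤ 1) (hs₂ : s₂ ≤ 1) (hs : s₁ + s₂ = 1 + θ) (ρ : ℝ) {t : ℝ}
    (ht : 0 < t) :
    ∫⁻ y in ball 0 ρ, ∫⁻ x, u (x + t • y) ^ s₁ * v x ^ s₂ ∂μ ∂μ ≤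
      ENNReal.ofReal t ^ (-(finrank ℝ E * θ)) *
        (μ (ball 0 ρ) ^ (1 - θ) * ((∫⁻ x, u x ∂μ) ^ s₁ * (∫⁻ x, v x ∂μ) ^ s₂)) := by
  set ν : Measure (E × E) := (μ.restrict (ball 0 ρ)).prod μ with hν
  have hmu : Measurable fun p : E × E => u (p.2 + t • p.1) := hu.comp (by fun_prop)
  have hmv : Measurable fun p : E × E => v p.2 := hv.comp measurable_snd
  -- The splitting is `u^{s₁} v^{s₂} = (u v)^θ u^{1-s₂} v^{1-s₁}`, whose weights add up to `1`
  -- because `s₁ + s₂ = 1 + θ`. Only the integral of `u v` feels the dilation by `t`, which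
  -- therefore enters to the power `θ`.
  set g : Fin 3 → E × E → ℝ≥0∞ :=
    ![fun p => u (p.2 + t • p.1) * v p.2, fun p => u (p.2 + t • p.1), fun p => v p.2] with hg
  set w : Fin 3 → ℝ := ![θ, 1 - s₂, 1 - s₁] with hw
  have hH := ENNReal.lintegral_prod_norm_pow_le (μ := ν) Finset.univ (f := g) (p := w)
    (by intro i _; fin_cases i
        · exact (hmu.mul hmv).aemeasurable
        · exact hmu.aemeasurable
        · exact hmv.aemeasurable)
    (by simp [hw, Fin.sum_univ_three]; linarith)
    (by intro i _; fin_cases i <;> simp [hw] <;> linarith)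
  simp only [Fin.prod_univ_three, hg, hw, Matrix.cons_val_zero, Matrix.cons_val_one,
    Matrix.cons_val] at hH
  have hL : ∫⁻ y in ball 0 ρ, ∫⁻ x, u (x + t • y) ^ s₁ * v x ^ s₂ ∂μ ∂μ =
      ∫⁻ p, u (p.2 + t • p.1) ^ s₁ * v p.2 ^ s₂ ∂ν := by
    have hm : Measurable fun p : E × E => u (p.2 + t • p.1) ^ s₁ * v p.2 ^ s₂ :=
      (hmu.pow_const _).mul (hmv.pow_const _)
    rw [hν, lintegral_prod _ hm.aemeasurable]
  have hpt : ∀ p : E × E, u (p.2 + t • p.1) ^ s₁ * v p.2 ^ s₂ =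
      (u (p.2 + t • p.1) * v p.2) ^ θ * u (p.2 + t • p.1) ^ (1 - s₂) * v p.2 ^ (1 - s₁) := by
    intro p
    have e1 : s₁ = θ + (1 - s₂) := by linarith
    have e2 : s₂ = θ + (1 - s₁) := by linarith
    conv_lhs => rw [e1, ENNReal.rpow_add_of_nonneg _ _ hθ (by linarith)]
    conv_lhs => rw [e2, ENNReal.rpow_add_of_nonneg _ _ hθ (by linarith), ← e2]
    rw [ENNReal.mul_rpow_of_nonneg _ _ hθ]
    ring
  set U := ∫⁻ x, u x ∂μ
  set V := ∫⁻ x, v x ∂μ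
  set T := ENNReal.ofReal t ^ (-(finrank ℝ E : ℝ)) with hT
  have i1 : ∫⁻ p, u (p.2 + t • p.1) * v p.2 ∂ν ≤ T * (U * V) := by
    have hm : Measurable fun p : E × E => u (p.2 + t • p.1) * v p.2 := hmu.mul hmv
    rw [hν, lintegral_prod_symm _ hm.aemeasurable]
    calc ∫⁻ x, ∫⁻ y in ball 0 ρ, u (x + t • y) * v x ∂μ ∂μ
        ≤ ∫⁻ x, (T * U) * v x ∂μ := by
          refine lintegral_mono fun x => ?_
          have : Measurable fun y => u (x + t • y) := hu.comp (by fun_prop)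
          rw [lintegral_mul_const _ this]
          refine mul_le_mul_left ?_ _
          refine (setLIntegral_le_lintegral _ _).trans (le_of_eq ?_)
          exact lintegral_comp_add_smul hu x ht
      _ = T * (U * V) := by rw [lintegral_const_mul _ hv, mul_assoc]
  have i2 : ∫⁻ p, u (p.2 + t • p.1) ∂ν = μ (ball 0 ρ) * U := by
    rw [hν, lintegral_prod _ hmu.aemeasurable]
    have : ∀ y : E, ∫⁻ x, u (x + t • y) ∂μ = U := fun y => lintegral_add_right_eq_self u _
    simp_rw [this]
    simp [mul_comm]
  have i3 : ∫⁻ p, v p.2 ∂ν = μ (ball 0 ρ) * V := by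
    rw [hν, lintegral_prod _ hmv.aemeasurable]
    simp [mul_comm, V]
  rw [hL]
  simp_rw [hpt]
  refine hH.trans ?_
  rw [i2, i3]
  calc _ ≤ (T * (U * V)) ^ θ * (μ (ball 0 ρ) * U) ^ (1 - s₂) * (μ (ball 0 ρ) * V) ^ (1 - s₁) := by
        gcongr
    _ = T ^ θ * ((μ (ball 0 ρ) ^ (1 - s₂) * μ (ball 0 ρ) ^ (1 - s₁)) *
          ((U ^ θ * U ^ (1 - s₂)) * (V ^ θ * V ^ (1 - s₁)))) := by
        rw [ENNReal.mul_rpow_of_nonneg _ _ hθ, ENNReal.mul_rpow_of_nonneg _ _ hθ,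
          ENNReal.mul_rpow_of_nonneg _ _ (by linarith), ENNReal.mul_rpow_of_nonneg _ _ (by linarith)]
        ring
    _ = _ := by
        rw [← ENNReal.rpow_add_of_nonneg _ _ (by linarith) (by linarith),
          ← ENNReal.rpow_add_of_nonneg _ _ (by linarith) (by linarith),
          ← ENNReal.rpow_add_of_nonneg _ _ (by linarith) (by linarith), hT, ← ENNReal.rpow_mul]
        rw [show -(finrank ℝ E : ℝ) * θ = -(finrank ℝ E * θ) by ring,
          show 1 - s₂ + (1 - s₁) = 1 - θ by linarith, show θ + (1 - s₂) = s₁ by linarith,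
          show θ + (1 - s₁) = s₂ by linarith]

theorem lintegral_ofReal_rpow_neg_half :
    ∫⁻ t in Ioc (0 : ℝ) 1, ENNReal.ofReal t ^ (-(1 / 2) : ℝ) = 2 := by
  have h1 : ∫⁻ t in Ioc (0 : ℝ) 1, ENNReal.ofReal t ^ (-(1 / 2) : ℝ) =
      ∫⁻ t in Ioc (0 : ℝ) 1, ENNReal.ofReal (t ^ (-(1 / 2) : ℝ)) :=
    setLIntegral_congr_fun measurableSet_Ioc fun t ht => ENNReal.ofReal_rpow_of_pos ht.1
  have h2 : IntervalIntegrable (fun t : ℝ => t ^ (-(1 / 2) : ℝ)) volume 0 1 :=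
    intervalIntegral.intervalIntegrable_rpow' (by norm_num)
  rw [h1, ← ofReal_integral_eq_lintegral_ofReal, ← intervalIntegral.integral_of_le zero_le_one,
    integral_rpow (Or.inl (by norm_num))]
  · norm_num
  · exact (intervalIntegrable_iff_integrableOn_Ioc_of_le zero_le_one).1 h2
  · exact (ae_restrict_iff' measurableSet_Ioc).2 (Filter.Eventually.of_forall fun t ht =>
      Real.rpow_nonneg ht.1.le _)

/-- For fixed `t` the preceding inequality costs `t^{-Nθ}`, where `N` is the dimension. The
normalization `Nθ = 1/2` makes this `t^{-1/2}`, whose integral over `(0, 1]` is `2`; any value of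
`Nθ` strictly between `0` and `1` would serve. -/
theorem lintegral_lintegral_segment_le {a b : E → ℝ≥0∞} (ha : Measurable a) (hb : Measurable b)
    {θ s₁ s₂ : ℝ} (hθ : finrank ℝ E * θ = 1 / 2) (hθ0 : 0 ≤ θ) (hs₁ : 0 < s₁) (hs₂ : 0 < s₂)
    (hs₁' : s₁ ≤ 1) (hs₂' : s₂ ≤ 1) (hs : s₁ + s₂ = 1 + θ) (ρ : ℝ) :
    ∫⁻ y in ball 0 ρ, (∫⁻ t in Ioc (0 : ℝ) 1, ∫⁻ x, a (x + t • y) * b x ∂μ) ∂μ ≤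
      2 * (μ (ball 0 ρ) ^ (1 - θ) *
        ((∫⁻ x, a x ^ (1 / s₁) ∂μ) ^ s₁ * (∫⁻ x, b x ^ (1 / s₂) ∂μ) ^ s₂)) := by
  have hm : Measurable fun q : (E × ℝ) × E => a (q.2 + q.1.2 • q.1.1) * b q.2 :=
    (ha.comp (by fun_prop)).mul (hb.comp measurable_snd)
  rw [lintegral_lintegral_swap (hm.lintegral_prod_right').aemeasurable]
  set Q := μ (ball 0 ρ) ^ (1 - θ) *
        ((∫⁻ x, a x ^ (1 / s₁) ∂μ) ^ s₁ * (∫⁻ x, b x ^ (1 / s₂) ∂μ) ^ s₂) with hQ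
  have hroot : ∀ {s : ℝ}, 0 < s → ∀ c : ℝ≥0∞, (c ^ (1 / s)) ^ s = c := fun hs c => by
    rw [← ENNReal.rpow_mul, one_div_mul_cancel hs.ne', ENNReal.rpow_one]
  calc _ ≤ ∫⁻ t in Ioc (0 : ℝ) 1, ENNReal.ofReal t ^ (-(1 / 2) : ℝ) * Q := by
        refine setLIntegral_mono' measurableSet_Ioc fun t ht => ?_
        have := lintegral_lintegral_mul_le (μ := μ) (ha.pow_const (1 / s₁)) (hb.pow_const (1 / s₂))
          hθ0 hs₁' hs₂' hs ρ ht.1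
        simp only [hroot hs₁, hroot hs₂, hθ] at this
        exact this
    _ = 2 * Q := by
        rw [lintegral_mul_const _ (by fun_prop), lintegral_ofReal_rpow_neg_half]

/-- The basic estimate for the integral of the exterior product of two closed forms. -/
theorem enorm_integral_mul_altPairing_le_of_closed {A : E → E [⋀^Fin (k + 1)]→L[ℝ] ℝ}
    {B : E → E [⋀^Fin l]→L[ℝ] ℝ} {φ : E → ℝ} (hA : ContDiff ℝ 1 A) (hB : ContDiff ℝ 1 B)
    (hφ : ContDiff ℝ 1 φ) {x₀ : E} {r : ℝ} (hr : 0 < r) (hφs : tsupport φ ⊆ ball x₀ (2 * r))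
    (hφ1 : ∀ x, |φ x| ≤ 1) {m : ℝ} (hm : 0 ≤ m) (hdφ : ∀ x, ‖fderiv ℝ φ x‖ ≤ m / r)
    (hdA : ∀ x ∈ ball x₀ (4 * r), extDeriv A x = 0) (hdB : ∀ x ∈ ball x₀ (4 * r), extDeriv B x = 0)
    (v : Fin (k + 1) ⊕ Fin l → E) (hv : ∀ i, ‖v i‖ ≤ 1)
    {θ s₁ s₂ : ℝ} (hθ : finrank ℝ E * θ = 1 / 2) (hθ0 : 0 ≤ θ) (hs₁ : 0 < s₁) (hs₂ : 0 < s₂)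
    (hs₁' : s₁ ≤ 1) (hs₂' : s₂ ≤ 1) (hs : s₁ + s₂ = 1 + θ) :
    μ (ball 0 (2 * r)) * ‖∫ x, φ x * altPairing v (A x) (B x) ∂μ‖ₑ ≤
      ((k + 1) * (k + 1 + l).factorial : ℕ) * (1 + 4 * ENNReal.ofReal m) *
        (μ (ball 0 (2 * r)) ^ (1 - θ) *
          ((∫⁻ x in ball x₀ (4 * r), ‖A x‖ₑ ^ (1 / s₁) ∂μ) ^ s₁ *
            (∫⁻ x in ball x₀ (4 * r), ‖B x‖ₑ ^ (1 / s₂) ∂μ) ^ s₂)) := by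
  -- Cutting off to the ball of radius `4r` loses nothing: for `x` in the support of `φ` and `|y| <
  -- 2r`, the whole segment from `x` to `x + y` lies in it.
  set a : E → ℝ≥0∞ := (ball x₀ (4 * r)).indicator fun x => ‖A x‖ₑ with ha
  set b : E → ℝ≥0∞ := (ball x₀ (4 * r)).indicator fun x => ‖B x‖ₑ with hb
  have ham : Measurable a := hA.continuous.enorm.measurable.indicator measurableSet_ball
  have hbm : Measurable b := hB.continuous.enorm.measurable.indicator measurableSet_ball
  have hind : ∀ {j : ℕ} (X : E → E [⋀^Fin j]→L[ℝ] ℝ) {s : ℝ}, 0 < s →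
      ∫⁻ x, (ball x₀ (4 * r)).indicator (fun x => ‖X x‖ₑ) x ^ (1 / s) ∂μ =
        ∫⁻ x in ball x₀ (4 * r), ‖X x‖ₑ ^ (1 / s) ∂μ := by
    intro j X s hs
    rw [← lintegral_indicator measurableSet_ball]
    refine lintegral_congr fun x => ?_
    by_cases hx : x ∈ ball x₀ (4 * r) <;> simp [hx, hs]
  have hc : HasCompactSupport φ :=
    HasCompactSupport.of_support_subset_isCompact (isCompact_closedBall x₀ (2 * r))
      ((subset_tsupport _).trans (hφs.trans ball_subset_closedBall))
  set Q := μ (ball 0 (2 * r)) ^ (1 - θ) *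
        ((∫⁻ x, a x ^ (1 / s₁) ∂μ) ^ s₁ * (∫⁻ x, b x ^ (1 / s₂) ∂μ) ^ s₂) with hQ
  have hmem : ∀ x ∈ ball x₀ (2 * r), ∀ y ∈ ball (0 : E) (2 * r), ∀ t ∈ Icc (0 : ℝ) 1,
      x + t • y ∈ ball x₀ (4 * r) := by
    intro x hx y hy t ht
    rw [mem_ball, dist_eq_norm] at *
    rw [sub_zero] at hy
    calc ‖x + t • y - x₀‖ = ‖(x - x₀) + t • y‖ := by congr 1; abel
      _ ≤ ‖x - x₀‖ + ‖t • y‖ := norm_add_le _ _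
      _ < 4 * r := by
        rw [norm_smul, Real.norm_of_nonneg ht.1]
        nlinarith [ht.2, ht.1, norm_nonneg y]
  have hsub : ball x₀ (2 * r) ⊆ ball x₀ (4 * r) := ball_subset_ball (by linarith)
  have hJ1 : ∫⁻ y in ball 0 (2 * r), ∫⁻ x, a (x + y) * b x ∂μ ∂μ ≤ Q := by
    have := lintegral_lintegral_mul_le (μ := μ) (ham.pow_const (1 / s₁)) (hbm.pow_const (1 / s₂))
      hθ0 hs₁' hs₂' hs (2 * r) one_pos
    have hroot : ∀ {s : ℝ}, 0 < s → ∀ c : ℝ≥0∞, (c ^ (1 / s)) ^ s = c := fun hs c => by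
      rw [← ENNReal.rpow_mul, one_div_mul_cancel hs.ne', ENNReal.rpow_one]
    simpa only [hroot hs₁, hroot hs₂, one_smul, ENNReal.ofReal_one, ENNReal.one_rpow, one_mul]
      using this
  have hJ2 := lintegral_lintegral_segment_le (μ := μ) ham hbm hθ hθ0 hs₁ hs₂ hs₁' hs₂' hs (2 * r)
  have hm1 : ∀ y, Measurable fun x => a (x + y) * b x := fun y =>
    (ham.comp (by fun_prop)).mul hbm
  set N : ℝ≥0∞ := (((k + 1) * (k + 1 + l).factorial : ℕ) : ℝ≥0∞) with hN
  have hy : ∀ y ∈ ball (0 : E) (2 * r), ‖∫ x, φ x * altPairing v (A x) (B x) ∂μ‖ₑ ≤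
      N * (∫⁻ x, a (x + y) * b x ∂μ +
        2 * ENNReal.ofReal m * ∫⁻ t in Ioc (0 : ℝ) 1, ∫⁻ x, a (x + t • y) * b x ∂μ) := by
    intro y hy
    refine (enorm_integral_mul_altPairing_le hA hB hφ hc y
      (fun x hx t ht => hdA _ (hmem x (hφs hx) y hy t ht))
      (fun x hx => hdB x (hsub (hφs hx))) v hv).trans ?_
    refine mul_le_mul_right (add_le_add ?_ ?_) _
    · refine lintegral_mono fun x => ?_
      by_cases hx : x ∈ tsupport φ
      · have h1 := hmem x (hφs hx) y hy 1 (by simp)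
        rw [one_smul] at h1
        simp only [ha, hb, indicator_of_mem h1, indicator_of_mem (hsub (hφs hx))]
        refine mul_le_of_le_one_left' ?_
        rw [← enorm_one (G := ℝ)]
        exact enorm_le_iff_norm_le.2 (by simpa using hφ1 x)
      · simp [image_eq_zero_of_notMem_tsupport hx]
    -- The length `|y| < 2r` of the translation cancels the `1/r` in the gradient of the cut-off, so
    -- the constant does not depend on the scale.
    · have h2 : ‖y‖ₑ * (ENNReal.ofReal (m / r)) ≤ 2 * ENNReal.ofReal m := by
        rw [← ofReal_norm, ← ENNReal.ofReal_mul (norm_nonneg _), ← ENNReal.ofReal_ofNat 2,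
          ← ENNReal.ofReal_mul (by norm_num)]
        refine ENNReal.ofReal_le_ofReal ?_
        have : ‖y‖ ≤ 2 * r := by simpa using (mem_ball.1 hy).le
        calc ‖y‖ * (m / r) ≤ 2 * r * (m / r) := by gcongr
          _ = 2 * m := by field_simp
      refine le_trans ?_ (mul_le_mul_left h2 _)
      rw [mul_assoc]
      refine mul_le_mul_right ?_ _
      rw [← lintegral_const_mul' _ _ ENNReal.ofReal_ne_top]
      refine setLIntegral_mono' measurableSet_Ioc fun t ht => ?_
      rw [← lintegral_const_mul' _ _ ENNReal.ofReal_ne_top]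
      refine lintegral_mono fun x => ?_
      by_cases hx : x ∈ tsupport φ
      · have h1 := hmem x (hφs hx) y hy t (Ioc_subset_Icc_self ht)
        simp only [ha, hb, indicator_of_mem h1, indicator_of_mem (hsub (hφs hx))]
        refine mul_le_mul_left ?_ _
        rw [← ofReal_norm]
        exact ENNReal.ofReal_le_ofReal (hdφ x)
      · have h0 : fderiv ℝ φ x = 0 :=
          image_eq_zero_of_notMem_tsupport fun h => hx (tsupport_fderiv_subset ℝ h)
        have h1 : ‖fderiv ℝ φ x‖ₑ = 0 := by rw [← ofReal_norm, h0, norm_zero, ENNReal.ofReal_zero]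
        rw [h1, zero_mul]
        exact zero_le
  rw [← hind A hs₁, ← hind B hs₂, ← ha, ← hb, ← hQ]
  -- The left-hand side of `hy` is independent of `y`; integrating over the ball of translations
  -- brings in its volume.
  calc μ (ball 0 (2 * r)) * ‖∫ x, φ x * altPairing v (A x) (B x) ∂μ‖ₑ
      = ∫⁻ y in ball 0 (2 * r), ‖∫ x, φ x * altPairing v (A x) (B x) ∂μ‖ₑ ∂μ := by
        rw [setLIntegral_const, mul_comm]
    _ ≤ ∫⁻ y in ball 0 (2 * r), N * (∫⁻ x, a (x + y) * b x ∂μ +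
        2 * ENNReal.ofReal m * ∫⁻ t in Ioc (0 : ℝ) 1, ∫⁻ x, a (x + t • y) * b x ∂μ) ∂μ :=
        setLIntegral_mono' measurableSet_ball hy
    _ ≤ N * (Q + 2 * ENNReal.ofReal m * (2 * Q)) := by
        have hmm : Measurable fun y => ∫⁻ x, a (x + y) * b x ∂μ := by
          have : Measurable fun q : E × E => a (q.2 + q.1) * b q.2 :=
            (ham.comp (by fun_prop)).mul (hbm.comp measurable_snd)
          exact this.lintegral_prod_right'
        rw [lintegral_const_mul' _ _ (ENNReal.natCast_ne_top _), lintegral_add_left hmm,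
          lintegral_const_mul' _ _ (ENNReal.mul_ne_top (by simp) ENNReal.ofReal_ne_top)]
        gcongr
    _ = _ := by ring

end Potential

/-! ### Regularity of pulled-back forms. -/

section Pullback

variable {E F X : Type*} [NormedAddCommGroup E] [NormedSpace ℝ E] [NormedAddCommGroup F]
  [NormedSpace ℝ F] [NormedAddCommGroup X] [NormedSpace ℝ X] {k : ℕ}

variable (E k) in
/-- Alternatization of multilinear maps as a continuous linear map. -/
noncomputable def alternatizationCLM :
    ContinuousMultilinearMap ℝ (fun _ : Fin k => E) ℝ →L[ℝ] E [⋀^Fin k]→L[ℝ] ℝ :=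
  LinearMap.mkContinuous
    { toFun := fun m => ContinuousMultilinearMap.alternatization m
      map_add' := map_add _
      map_smul' := fun c m => by
        ext v
        simp only [ContinuousMultilinearMap.alternatization_apply_apply, RingHom.id_apply,
          smul_apply, ContinuousAlternatingMap.smul_apply, Finset.smul_sum]
        exact Finset.sum_congr rfl fun σ _ => smul_comm _ _ _ }
    (k.factorial : ℝ) fun m => by
      refine ContinuousAlternatingMap.opNorm_le_bound _ (by positivity) fun v => ?_
      simp only [LinearMap.coe_mk, AddHom.coe_mk,
        ContinuousMultilinearMap.alternatization_apply_apply]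
      calc ‖∑ σ : Equiv.Perm (Fin k), Equiv.Perm.sign σ • m (v ∘ σ)‖
          ≤ ∑ σ : Equiv.Perm (Fin k), ‖m‖ * ∏ i, ‖v i‖ := by
            refine (norm_sum_le _ _).trans (Finset.sum_le_sum fun σ _ => ?_)
            have h1 : ‖Equiv.Perm.sign σ • m (v ∘ σ)‖ = ‖m (v ∘ σ)‖ := by
              rcases Int.units_eq_one_or (Equiv.Perm.sign σ) with h | h <;> simp [h]
            rw [h1]
            refine (m.le_opNorm _).trans (le_of_eq ?_)
            congr 1
            exact Equiv.prod_comp σ fun i => ‖v i‖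
        _ = _ := by simp [Fintype.card_perm]; ring

theorem alternatizationCLM_apply_coe (α : E [⋀^Fin k]→L[ℝ] ℝ) :
    alternatizationCLM E k α.toContinuousMultilinearMap = (k.factorial : ℝ) • α := by
  ext v
  have : ∀ σ : Equiv.Perm (Fin k), Equiv.Perm.sign σ • α (v ∘ σ) = α v := fun σ => by
    have := α.toAlternatingMap.map_perm v σ
    have h2 : α (v ∘ σ) = Equiv.Perm.sign σ • α v := this
    rw [h2, smul_smul, Int.units_mul_self, one_smul]
  change ContinuousMultilinearMap.alternatization α.toContinuousMultilinearMap v = _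
  rw [ContinuousMultilinearMap.alternatization_apply_apply]
  simp only [ContinuousAlternatingMap.coe_toContinuousMultilinearMap, this]
  simp [Fintype.card_perm]

/-- Composition with a linear map is smooth on multilinear maps. Alternating maps embed there
linearly, and `(k!)⁻¹` times alternatization is a continuous linear left inverse of this embedding,
which carries the smoothness back. -/
theorem contDiffWithinAt_alternating_comp {r : WithTop ℕ∞} {s : Set X} {x : X}
    {α : X → F [⋀^Fin k]→L[ℝ] ℝ} {g : X → E →L[ℝ] F} (hα : ContDiffWithinAt ℝ r α s x)
    (hg : ContDiffWithinAt ℝ r g s x) :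
    ContDiffWithinAt ℝ r (fun x => (α x).compContinuousLinearMap (g x)) s x := by
  have h1 : ContDiffWithinAt ℝ r (fun x =>
      ContinuousMultilinearMap.compContinuousLinearMapContinuousMultilinear ℝ
        (fun _ : Fin k => E) (fun _ => F) ℝ (fun _ => g x) (α x).toContinuousMultilinearMap) s x := by
    refine ContDiffWithinAt.clm_apply ?_ ?_
    · exact (ContinuousMultilinearMap.contDiff _).contDiffAt.comp_contDiffWithinAt _
        (contDiffWithinAt_pi.2 fun _ => hg)
    · exact (ContinuousAlternatingMap.toContinuousMultilinearMapCLM ℝ :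
        (F [⋀^Fin k]→L[ℝ] ℝ) →L[ℝ] _).contDiff.contDiffAt.comp_contDiffWithinAt _ hα
  have h2 := ((alternatizationCLM E k).contDiff.contDiffAt.comp_contDiffWithinAt _ h1).const_smul
    ((k.factorial : ℝ)⁻¹)
  refine h2.congr (fun z _ => ?_) ?_ <;>
  · simp only [Function.comp_apply]
    rw [eq_inv_smul_iff₀ (by positivity), ← alternatizationCLM_apply_coe]
    rfl

theorem contDiff_alternating_comp {r : WithTop ℕ∞} {α : X → F [⋀^Fin k]→L[ℝ] ℝ} {g : X → E →L[ℝ] F}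
    (hα : ContDiff ℝ r α) (hg : ContDiff ℝ r g) :
    ContDiff ℝ r (fun x => (α x).compContinuousLinearMap (g x)) :=
  contDiff_iff_contDiffAt.2 fun _ =>
    contDiffWithinAt_alternating_comp hα.contDiffAt.contDiffWithinAt hg.contDiffAt.contDiffWithinAt

theorem continuous_alternating_comp :
    Continuous fun p : (F [⋀^Fin k]→L[ℝ] ℝ) × (E →L[ℝ] F) => p.1.compContinuousLinearMap p.2 :=
  (contDiff_alternating_comp (r := 0) contDiff_fst contDiff_snd).continuous

end Pullback

/-! ### Exact forms: integration by parts with frozen coefficients. -/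

section Exact

open Module Metric

variable {E F : Type*} [NormedAddCommGroup E] [NormedSpace ℝ E] [FiniteDimensional ℝ E]
  [MeasurableSpace E] [BorelSpace E] {μ : Measure E} [μ.IsAddHaarMeasure]
  [NormedAddCommGroup F] [NormedSpace ℝ F] {k : ℕ}

/-- Integration by parts in each slot; the integrand on the right is `dφ ∧ P` written out. In this
form the identity makes sense for non-differentiable `P` and is the model for weak closedness. -/
theorem integral_mul_extDeriv_apply {P : E → E [⋀^Fin k]→L[ℝ] ℝ} (hP : ContDiff ℝ 1 P) {φ : E → ℝ}
    (hφ : ContDiff ℝ 1 φ) (hc : HasCompactSupport φ) (v : Fin (k + 1) → E) :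
    ∫ x, φ x * extDeriv P x v ∂μ =
      -∫ x, ∑ i : Fin (k + 1), (-1) ^ (i : ℕ) * (fderiv ℝ φ x (v i) * P x (i.removeNth v)) ∂μ := by
  have hp : ∀ w, ContDiff ℝ 1 fun x => P x w := fun w => contDiff_alternating_apply hP w
  have i1 : ∀ (w : E) (u : Fin k → E), Integrable (fun x => fderiv ℝ φ x w * P x u) μ := fun w u =>
    (((hφ.continuous_fderiv one_ne_zero).clm_apply continuous_const).mul
      (hp u).continuous).integrable_of_hasCompactSupport (hc.fderiv_apply (𝕜 := ℝ) w).mul_right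
  have i2 : ∀ (w : E) (u : Fin k → E),
      Integrable (fun x => φ x * fderiv ℝ (fun z => P z u) x w) μ := fun w u =>
    (hφ.continuous.mul (((hp u).continuous_fderiv one_ne_zero).clm_apply
      continuous_const)).integrable_of_hasCompactSupport hc.mul_right
  have h1 : ∀ x, φ x * extDeriv P x v = ∑ i : Fin (k + 1), (-1) ^ (i : ℕ) *
      (φ x * fderiv ℝ (fun z => P z (i.removeNth v)) x (v i)) := by
    intro x
    rw [extDeriv_apply (hP.differentiable one_ne_zero x), Finset.mul_sum]
    refine Finset.sum_congr rfl fun i _ => ?_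
    simp
    ring
  simp_rw [h1]
  rw [integral_finsetSum _ fun i _ => (i2 _ _).const_mul _,
    integral_finsetSum _ fun i _ => (i1 _ _).const_mul _, ← Finset.sum_neg_distrib]
  refine Finset.sum_congr rfl fun i _ => ?_
  rw [integral_const_mul, integral_const_mul, integral_mul_fderiv_eq_neg_fderiv_mul_of_integrable
    (i1 _ _) (i2 _ _) ((hφ.continuous.mul (hp _).continuous).integrable_of_hasCompactSupport
      hc.mul_right) (fun x _ => hφ.differentiable one_ne_zero x)
    (fun x _ => (hp _).differentiable one_ne_zero x)]
  ring

theorem contDiff_pullback {f : E → F} (hf : ContDiff ℝ 2 f) {τ : F → F [⋀^Fin k]→L[ℝ] ℝ}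
    (hτ : ContDiff ℝ 1 τ) :
    ContDiff ℝ 1 fun x => (τ (f x)).compContinuousLinearMap (fderiv ℝ f x) :=
  contDiff_alternating_comp (hτ.comp (hf.of_le one_le_two)) (hf.fderiv_right (by norm_num))

theorem extDeriv_pullback_of_contDiff {f : E → F} (hf : ContDiff ℝ 2 f)
    {τ : F → F [⋀^Fin k]→L[ℝ] ℝ} (hτ : ContDiff ℝ 1 τ) (x : E) :
    extDeriv (fun x => (τ (f x)).compContinuousLinearMap (fderiv ℝ f x)) x =
      (extDeriv τ (f x)).compContinuousLinearMap (fderiv ℝ f x) :=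
  extDeriv_pullback (hτ.differentiable one_ne_zero _) hf.contDiffAt (by simp)

/-- For an exact form `dτ`, the coefficients of `τ` may be frozen at an arbitrary point. -/
theorem enorm_integral_mul_pullback_extDeriv_le {f : E → F} (hf : ContDiff ℝ 2 f)
    {τ : F → F [⋀^Fin k]→L[ℝ] ℝ} (hτ : ContDiff ℝ 1 τ) {φ : E → ℝ}
    (hφ : ContDiff ℝ 1 φ) (hc : HasCompactSupport φ) (v : Fin (k + 1) → E) (hv : ∀ i, ‖v i‖ ≤ 1)
    (c : F) :
    ‖∫ x, φ x * (extDeriv τ (f x)).compContinuousLinearMap (fderiv ℝ f x) v ∂μ‖ₑ ≤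
      (k + 1) * ∫⁻ x, ‖fderiv ℝ φ x‖ₑ * (‖τ (f x) - τ c‖ₑ * ‖fderiv ℝ f x‖ₑ ^ k) ∂μ := by
  -- Subtracting the constant form `τ c` does not change the exterior derivative, but it makes the
  -- form small where `f` is close to `c`.
  set σ : F → F [⋀^Fin k]→L[ℝ] ℝ := fun y => τ y - τ c with hσ
  have hσC : ContDiff ℝ 1 σ := hτ.sub contDiff_const
  have hd : ∀ y, extDeriv τ y = extDeriv σ y := fun y => by
    simp only [extDeriv, hσ, fderiv_sub_const]
  simp_rw [hd, ← extDeriv_pullback_of_contDiff hf hσC]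
  rw [integral_mul_extDeriv_apply (contDiff_pullback hf hσC) hφ hc, enorm_neg]
  refine (enorm_integral_le_lintegral_enorm _).trans ?_
  rw [← lintegral_const_mul' _ _ (by finiteness)]
  refine lintegral_mono fun x => ?_
  calc _ ≤ ∑ i : Fin (k + 1), ‖fderiv ℝ φ x‖ₑ * (‖τ (f x) - τ c‖ₑ * ‖fderiv ℝ f x‖ₑ ^ k) := by
        refine (enorm_sum_le _ _).trans (Finset.sum_le_sum fun i _ => ?_)
        rw [enorm_mul, enorm_mul]
        have h0 : ‖((-1 : ℝ) ^ (i : ℕ))‖ₑ = 1 := by simp [enorm_pow]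
        rw [h0, one_mul]
        gcongr
        · exact enorm_le_iff_norm_le.2 (((fderiv ℝ φ x).le_opNorm _).trans
            (mul_le_of_le_one_right (norm_nonneg _) (hv _)))
        · rw [← ofReal_norm, ← ofReal_norm, ← ofReal_norm, ← ENNReal.ofReal_pow (norm_nonneg _),
            ← ENNReal.ofReal_mul (norm_nonneg _)]
          refine ENNReal.ofReal_le_ofReal ?_
          rw [Real.norm_eq_abs]
          refine (abs_alternating_apply_le fun j => hv _).trans ?_
          refine (ContinuousAlternatingMap.norm_compContinuousLinearMap_le _ _).trans ?_
          simp [hσ]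
    _ = _ := by simp

end Exact

/-! ### Exact forms: averaging over the point where the coefficients are frozen. -/

section Segment

open Module Metric

variable {E F : Type*} [NormedAddCommGroup E] [NormedSpace ℝ E] [FiniteDimensional ℝ E]
  [MeasurableSpace E] [BorelSpace E] {μ : Measure E} [μ.IsAddHaarMeasure]
  [NormedAddCommGroup F] [NormedSpace ℝ F] [CompleteSpace F] {k : ℕ}

theorem enorm_add_sub_le_lintegral {f : E → F} (hf : ContDiff ℝ 1 f) (x y : E) :
    ‖f (x + y) - f x‖ₑ ≤ ‖y‖ₑ * ∫⁻ t in Ioc (0 : ℝ) 1, ‖fderiv ℝ f (x + t • y)‖ₑ := by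
  have hder : ∀ t : ℝ, HasDerivAt (fun t : ℝ => f (x + t • y)) (fderiv ℝ f (x + t • y) y) t := by
    intro t
    have h2 : HasDerivAt (fun t : ℝ => x + t • y) y t := by
      simpa using ((hasDerivAt_id t).smul_const y).const_add x
    exact (hf.differentiable one_ne_zero _).hasFDerivAt.comp_hasDerivAt t h2
  have hcont : Continuous fun t : ℝ => fderiv ℝ f (x + t • y) y :=
    ((hf.continuous_fderiv one_ne_zero).comp (by fun_prop)).clm_apply continuous_const
  have h := intervalIntegral.integral_eq_sub_of_hasDerivAt (a := 0) (b := 1)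
    (fun t _ => hder t) (hcont.intervalIntegrable _ _)
  simp only [one_smul, zero_smul, add_zero] at h
  rw [← h, intervalIntegral.integral_of_le zero_le_one]
  refine (enorm_integral_le_lintegral_enorm _).trans ?_
  rw [← lintegral_const_mul' _ _ enorm_ne_top]
  refine lintegral_mono fun t => ?_
  rw [← ofReal_norm, ← ofReal_norm, ← ofReal_norm, ← ENNReal.ofReal_mul (norm_nonneg _), mul_comm]
  exact ENNReal.ofReal_le_ofReal ((fderiv ℝ f (x + t • y)).le_opNorm y)

/-- The basic estimate for the integral of an exact form `f^*dτ`. -/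
theorem enorm_integral_mul_pullback_extDeriv_le_of_lipschitz {f : E → F} (hf : ContDiff ℝ 2 f)
    {τ : F → F [⋀^Fin k]→L[ℝ] ℝ} (hτ : ContDiff ℝ 1 τ) {φ : E → ℝ} (hφ : ContDiff ℝ 1 φ) {x₀ : E}
    {r : ℝ} (hr : 0 < r) (hφs : tsupport φ ⊆ ball x₀ (2 * r)) {m L : ℝ} (hm : 0 ≤ m) (hL : 0 ≤ L)
    (hdφ : ∀ x, ‖fderiv ℝ φ x‖ ≤ m / r)
    (hLip : ∀ x z, ‖τ (f x) - τ (f z)‖ ≤ L * ‖f x - f z‖)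
    (v : Fin (k + 1) → E) (hv : ∀ i, ‖v i‖ ≤ 1)
    {θ s₁ s₂ : ℝ} (hθ : finrank ℝ E * θ = 1 / 2) (hθ0 : 0 ≤ θ) (hs₁ : 0 < s₁) (hs₂ : 0 < s₂)
    (hs₁' : s₁ ≤ 1) (hs₂' : s₂ ≤ 1) (hs : s₁ + s₂ = 1 + θ) :
    μ (ball x₀ (2 * r)) *
        ‖∫ x, φ x * (extDeriv τ (f x)).compContinuousLinearMap (fderiv ℝ f x) v ∂μ‖ₑ ≤
      (k + 1) * (8 * ENNReal.ofReal (m * L)) * (μ (ball 0 (4 * r)) ^ (1 - θ) *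
          ((∫⁻ x in ball x₀ (2 * r), ‖fderiv ℝ f x‖ₑ ^ (1 / s₁) ∂μ) ^ s₁ *
            (∫⁻ x in ball x₀ (2 * r), (‖fderiv ℝ f x‖ₑ ^ k) ^ (1 / s₂) ∂μ) ^ s₂)) := by
  set B := ball x₀ (2 * r) with hB
  have hfd : Measurable fun x => ‖fderiv ℝ f x‖ₑ :=
    (hf.continuous_fderiv two_ne_zero).enorm.measurable
  set a : E → ℝ≥0∞ := B.indicator fun x => ‖fderiv ℝ f x‖ₑ with ha
  set b : E → ℝ≥0∞ := B.indicator fun x => ‖fderiv ℝ f x‖ₑ ^ k with hb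
  have ham : Measurable a := hfd.indicator measurableSet_ball
  have hbm : Measurable b := (hfd.pow_const k).indicator measurableSet_ball
  have hind : ∀ (X : E → ℝ≥0∞) {s : ℝ}, 0 < s →
      ∫⁻ x, B.indicator X x ^ (1 / s) ∂μ = ∫⁻ x in B, X x ^ (1 / s) ∂μ := by
    intro X s hs
    rw [hB, ← lintegral_indicator measurableSet_ball, ← hB]
    refine lintegral_congr fun x => ?_
    by_cases hx : x ∈ B <;> simp [hx, hs]
  have hc : HasCompactSupport φ :=
    HasCompactSupport.of_support_subset_isCompact (isCompact_closedBall x₀ (2 * r))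
      ((subset_tsupport _).trans (hφs.trans ball_subset_closedBall))
  set N : ℝ≥0∞ := 4 * ENNReal.ofReal (m * L) with hN
  set I : E → E → ℝ≥0∞ := fun x y => ∫⁻ t in Ioc (0 : ℝ) 1, a (x + t • y) * b x with hI
  have hIm : Measurable (Function.uncurry I) := by
    have : Measurable fun q : (E × E) × ℝ => a (q.1.1 + q.2 • q.1.2) * b q.1.1 :=
      (ham.comp (by fun_prop)).mul (hbm.comp (by fun_prop))
    exact this.lintegral_prod_right'
  -- With the coefficients frozen at `f z`, `|τ(f x) - τ(f z)| ≤ L |f x - f z|`, and the difference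
  -- of `f` is bounded by `|z - x|` times the integral of `|Df|` along the segment, which stays in
  -- the convex set `B`.
  have hz : ∀ z ∈ B,
      ‖∫ x, φ x * (extDeriv τ (f x)).compContinuousLinearMap (fderiv ℝ f x) v ∂μ‖ₑ ≤
      (k + 1) * ∫⁻ x in B, N * I x (z - x) ∂μ := by
    intro z hz
    refine (enorm_integral_mul_pullback_extDeriv_le hf hτ hφ hc v hv (f z)).trans ?_
    refine mul_le_mul_right ?_ _
    rw [← lintegral_indicator measurableSet_ball]
    refine lintegral_mono fun x => ?_
    by_cases hx : x ∈ tsupport φ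
    · have hxB := hφs hx
      rw [indicator_of_mem hxB]
      have h1 : ‖τ (f x) - τ (f z)‖ₑ ≤ ENNReal.ofReal L * ‖f z - f x‖ₑ := by
        rw [← ofReal_norm, ← ofReal_norm, ← ENNReal.ofReal_mul hL, norm_sub_rev (f z)]
        exact ENNReal.ofReal_le_ofReal (hLip x z)
      have h2 := enorm_add_sub_le_lintegral (hf.of_le one_le_two) x (z - x)
      rw [add_sub_cancel] at h2
      have h3 : ‖fderiv ℝ φ x‖ₑ ≤ ENNReal.ofReal (m / r) := by
        rw [← ofReal_norm]; exact ENNReal.ofReal_le_ofReal (hdφ x)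
      have h4 : ‖z - x‖ ≤ 4 * r := by
        have e1 := mem_ball.1 hz
        have e2 := mem_ball.1 hxB
        rw [← dist_eq_norm]
        linarith [dist_triangle_right z x x₀]
      have h5 : ∫⁻ t in Ioc (0 : ℝ) 1, ‖fderiv ℝ f (x + t • (z - x))‖ₑ =
          ∫⁻ t in Ioc (0 : ℝ) 1, a (x + t • (z - x)) := by
        refine setLIntegral_congr_fun measurableSet_Ioc fun t ht => ?_
        have : x + t • (z - x) ∈ B :=
          (convex_ball x₀ (2 * r)).add_smul_sub_mem hxB hz (Ioc_subset_Icc_self ht)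
        simp only [ha, indicator_of_mem this]
      have h6 : ‖fderiv ℝ f x‖ₑ ^ k = b x := by simp only [hb, indicator_of_mem hxB]
      have h7 : I x (z - x) = (∫⁻ t in Ioc (0 : ℝ) 1, a (x + t • (z - x))) * b x := by
        have : Measurable fun t : ℝ => a (x + t • (z - x)) := ham.comp (by fun_prop)
        simp only [hI]
        rw [lintegral_mul_const _ this]
      -- As `|z - x| ≤ 4r`, the `1/r` of the cut-off is absorbed again.
      have h8 : ENNReal.ofReal (m / r) * ENNReal.ofReal L * ‖z - x‖ₑ ≤ N := by
        rw [hN, ← ofReal_norm, ← ENNReal.ofReal_mul (by positivity),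
          ← ENNReal.ofReal_mul (by positivity), ← ENNReal.ofReal_ofNat 4,
          ← ENNReal.ofReal_mul (by norm_num)]
        refine ENNReal.ofReal_le_ofReal ?_
        calc m / r * L * ‖z - x‖ ≤ m / r * L * (4 * r) := by gcongr
          _ = 4 * (m * L) := by field_simp
      calc ‖fderiv ℝ φ x‖ₑ * (‖τ (f x) - τ (f z)‖ₑ * ‖fderiv ℝ f x‖ₑ ^ k)
          ≤ ENNReal.ofReal (m / r) * (ENNReal.ofReal L * (‖z - x‖ₑ *
              ∫⁻ t in Ioc (0 : ℝ) 1, a (x + t • (z - x))) * b x) := by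
            rw [h6, ← h5]
            gcongr
            exact h1.trans (by gcongr)
        _ = (ENNReal.ofReal (m / r) * ENNReal.ofReal L * ‖z - x‖ₑ) * I x (z - x) := by
            rw [h7]; ring
        _ ≤ N * I x (z - x) := by gcongr
    · have h0 : fderiv ℝ φ x = 0 :=
        image_eq_zero_of_notMem_tsupport fun h => hx (tsupport_fderiv_subset ℝ h)
      have h1 : ‖fderiv ℝ φ x‖ₑ = 0 := by rw [← ofReal_norm, h0, norm_zero, ENNReal.ofReal_zero]
      rw [h1, zero_mul]
      exact zero_le
  have hsub : Measurable fun q : E × E => I q.2 (q.1 - q.2) := by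
    have : Measurable fun q : E × E => (q.2, q.1 - q.2) := by fun_prop
    exact hIm.comp this
  -- The substitution `y = z - x` and Tonelli's theorem reduce the double integral to the one
  -- already estimated for translations.
  have hfin : ∫⁻ z in B, (∫⁻ x in B, I x (z - x) ∂μ) ∂μ ≤
      ∫⁻ y in ball 0 (4 * r), (∫⁻ t in Ioc (0 : ℝ) 1, ∫⁻ x, a (x + t • y) * b x ∂μ) ∂μ := by
    rw [lintegral_lintegral_swap hsub.aemeasurable]
    calc ∫⁻ x in B, (∫⁻ z in B, I x (z - x) ∂μ) ∂μ
        ≤ ∫⁻ x in B, (∫⁻ y in ball 0 (4 * r), I x y ∂μ) ∂μ := by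
          refine setLIntegral_mono' measurableSet_ball fun x hx => ?_
          rw [← lintegral_indicator measurableSet_ball, ← lintegral_indicator measurableSet_ball,
            ← lintegral_sub_right_eq_self ((ball (0 : E) (4 * r)).indicator fun y => I x y) x]
          refine lintegral_mono fun z => ?_
          by_cases hz : z ∈ B
          · have : z - x ∈ ball (0 : E) (4 * r) := by
              have e1 := mem_ball.1 hz
              have e2 := mem_ball.1 hx
              rw [mem_ball_zero_iff, ← dist_eq_norm]
              linarith [dist_triangle_right z x x₀]
            rw [indicator_of_mem hz, indicator_of_mem this]
          · rw [indicator_of_notMem hz]; exact zero_le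
      _ ≤ ∫⁻ x, (∫⁻ y in ball 0 (4 * r), I x y ∂μ) ∂μ := setLIntegral_le_lintegral _ _
      _ = ∫⁻ y in ball 0 (4 * r), (∫⁻ x, I x y ∂μ) ∂μ :=
          lintegral_lintegral_swap hIm.aemeasurable
      _ = _ := by
          refine lintegral_congr fun y => ?_
          refine lintegral_lintegral_swap ?_
          have : Measurable fun q : E × ℝ => a (q.1 + q.2 • y) * b q.1 :=
            (ham.comp (by fun_prop)).mul (hbm.comp (by fun_prop))
          exact this.aemeasurable
  have hJ := lintegral_lintegral_segment_le (μ := μ) ham hbm hθ hθ0 hs₁ hs₂ hs₁' hs₂' hs (4 * r)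
  rw [ha, hb, hind _ hs₁, hind _ hs₂, ← ha, ← hb] at hJ
  set J := ‖∫ x, φ x * (extDeriv τ (f x)).compContinuousLinearMap (fderiv ℝ f x) v ∂μ‖ₑ
  have hN' : N ≠ ⊤ := ENNReal.mul_ne_top (by simp) ENNReal.ofReal_ne_top
  -- `J` does not depend on `z`, so the bound may be integrated over `z ∈ B`.
  calc μ B * J = ∫⁻ z in B, J ∂μ := by rw [setLIntegral_const, mul_comm]
    _ ≤ ∫⁻ z in B, (k + 1) * ∫⁻ x in B, N * I x (z - x) ∂μ ∂μ :=
        setLIntegral_mono' measurableSet_ball hz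
    _ = (k + 1) * (N * ∫⁻ z in B, (∫⁻ x in B, I x (z - x) ∂μ) ∂μ) := by
        rw [lintegral_const_mul' _ _ (by finiteness)]
        simp_rw [lintegral_const_mul' _ _ hN']
    _ ≤ (k + 1) * (N * (2 * (μ (ball 0 (4 * r)) ^ (1 - θ) *
          ((∫⁻ x in B, ‖fderiv ℝ f x‖ₑ ^ (1 / s₁) ∂μ) ^ s₁ *
            (∫⁻ x in B, (‖fderiv ℝ f x‖ₑ ^ k) ^ (1 / s₂) ∂μ) ^ s₂)))) :=
        mul_le_mul_right (mul_le_mul_right (hfin.trans hJ) _) _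
    _ = _ := by rw [hN]; ring

end Segment

/-! ### Mollification: almost everywhere convergence with domination. -/

section Mollify

open Module Metric Filter
open scoped Convolution

variable {E V : Type*} [NormedAddCommGroup E] [NormedSpace ℝ E] [FiniteDimensional ℝ E]
  [MeasurableSpace E] [BorelSpace E] {μ : Measure E} [μ.IsAddHaarMeasure]
  [NormedAddCommGroup V] [NormedSpace ℝ V] [CompleteSpace V]

variable (μ) in
/-- The mollification of a function by a normalized bump function. -/
noncomputable def mollify (ρ : ContDiffBump (0 : E)) (f : E → V) : E → V :=
  ρ.normed μ ⋆[ContinuousLinearMap.lsmul ℝ ℝ, μ] f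

variable (μ) in
/-- The kernel of the mollification at `x`. -/
noncomputable def mollifier (ρ : ContDiffBump (0 : E)) (x y : E) : ℝ := ρ.normed μ (x - y)

theorem contDiff_mollifier (ρ : ContDiffBump (0 : E)) (x : E) : ContDiff ℝ ∞ (mollifier μ ρ x) :=
  ρ.contDiff_normed.comp (contDiff_const.sub contDiff_id)

theorem tsupport_mollifier_subset (ρ : ContDiffBump (0 : E)) (x : E) :
    tsupport (mollifier μ ρ x) ⊆ closedBall x ρ.rOut := by
  refine closure_minimal (fun y hy => ?_) isClosed_closedBall
  have h : x - y ∈ Function.support (ρ.normed μ) := hy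
  rw [ρ.support_normed_eq, mem_ball_zero_iff, ← dist_eq_norm, dist_comm] at h
  exact h.le

theorem hasCompactSupport_mollifier (ρ : ContDiffBump (0 : E)) (x : E) :
    HasCompactSupport (mollifier μ ρ x) :=
  HasCompactSupport.of_support_subset_isCompact (isCompact_closedBall x ρ.rOut)
    ((subset_tsupport _).trans (tsupport_mollifier_subset ρ x))

theorem mollify_apply (ρ : ContDiffBump (0 : E)) (f : E → V) (x : E) :
    mollify μ ρ f x = ∫ y, mollifier μ ρ x y • f y ∂μ := by
  rw [mollify, convolution_eq_swap]
  rfl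

theorem contDiff_mollify (ρ : ContDiffBump (0 : E)) {f : E → V} (hf : LocallyIntegrable f μ)
    (r : ℕ∞) : ContDiff ℝ r (mollify μ ρ f) :=
  ρ.hasCompactSupport_normed.contDiff_convolution_left _ ρ.contDiff_normed hf

/-- The derivative falls on the kernel, which depends on `x - y`; passing from `x` to the variable
of integration `y` produces the sign. This is the expression to which weak identities apply, the
kernel at `x` being the test function. -/
theorem fderiv_mollify_apply (ρ : ContDiffBump (0 : E)) {f : E → V} (hf : LocallyIntegrable f μ)
    (x v : E) : fderiv ℝ (mollify μ ρ f) x v = -∫ y, fderiv ℝ (mollifier μ ρ x) y v • f y ∂μ := by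
  have h := (ρ.hasCompactSupport_normed (μ := μ)).hasFDerivAt_convolution_left
    (ContinuousLinearMap.lsmul ℝ ℝ) (μ := μ) ρ.contDiff_normed hf x
  have hint : ConvolutionExistsAt (fderiv ℝ (ρ.normed μ)) f x
      ((ContinuousLinearMap.lsmul ℝ ℝ : ℝ →L[ℝ] V →L[ℝ] V).precompL E) μ :=
    ((ρ.hasCompactSupport_normed (μ := μ)).fderiv ℝ).convolutionExists_left _
      (ρ.contDiff_normed.continuous_fderiv (n := 1) one_ne_zero) hf x
  have h1 : fderiv ℝ (mollify μ ρ f) x v = ∫ t, fderiv ℝ (ρ.normed μ) t v • f (x - t) ∂μ := by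
    unfold mollify
    rw [h.fderiv, convolution, ContinuousLinearMap.integral_apply hint]
    rfl
  have h2 : ∀ y, fderiv ℝ (mollifier μ ρ x) y v = -fderiv ℝ (ρ.normed μ) (x - y) v := by
    intro y
    have h3 : HasFDerivAt (fun y : E => x - y) (-ContinuousLinearMap.id ℝ E) y :=
      (hasFDerivAt_id y).const_sub x
    have h4 := ((ρ.contDiff_normed (μ := μ) (n := 1)).differentiable
      one_ne_zero (x - y)).hasFDerivAt.comp y h3
    have h5 : fderiv ℝ (mollifier μ ρ x) y = _ := h4.fderiv
    rw [h5]
    simp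
  rw [h1, ← integral_sub_left_eq_self _ μ x, ← integral_neg]
  simp_rw [h2, neg_smul, neg_neg, sub_sub_cancel]

/-- A mollification is an average of values of `f`. It keeps the approximations in the ball on which
the coefficients of the ambient forms are controlled. -/
theorem norm_mollify_le (ρ : ContDiffBump (0 : E)) {f : E → V} {R : ℝ} (hf : ∀ x, ‖f x‖ ≤ R) (x : E) :
    ‖mollify μ ρ f x‖ ≤ R := by
  have h : ∫ t, ρ.normed μ t * R ∂μ = R := by
    rw [integral_mul_const, ρ.integral_normed, one_mul]
  rw [← h]
  refine norm_integral_le_of_norm_le (ρ.integrable_normed.mul_const R) (Eventually.of_forall fun t => ?_)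
  simp only [ContinuousLinearMap.lsmul_apply, norm_smul, Real.norm_of_nonneg (ρ.nonneg_normed t)]
  exact mul_le_mul_of_nonneg_left (hf _) (ρ.nonneg_normed t)

/-- Translations act continuously on `L^P` for finite `P`; this is continuity of the orbit of `f` at
zero. -/
theorem exists_lintegral_enorm_sub_translate_le {f : E → V} {P : ℝ} (hP : 1 ≤ P)
    (hf : MemLp f (ENNReal.ofReal P) μ) {η : ℝ≥0∞} (hη : η ≠ 0) :
    ∃ δ > 0, ∀ t : E, ‖t‖ < δ → ∫⁻ x, ‖f (x - t) - f x‖ₑ ^ P ∂μ ≤ η := by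
  have : Fact (1 ≤ ENNReal.ofReal P) := ⟨by simpa using ENNReal.ofReal_le_ofReal hP⟩
  have : Fact (ENNReal.ofReal P ≠ ⊤) := ⟨ENNReal.ofReal_ne_top⟩
  have hP0 : 0 < P := by linarith
  set F := hf.toLp f with hF
  have hc : Continuous fun t : E => (DomAddAct.mk (-t)) +ᵥ F :=
    (DomAddAct.continuous_mk.comp continuous_neg).vadd continuous_const
  have h0 := hc.tendsto 0
  simp only [neg_zero] at h0
  have hη' : 0 < η ^ (1 / P) := by
    rcases eq_or_ne η ⊤ with rfl | h
    · rw [ENNReal.top_rpow_of_pos (by positivity)]; simp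
    · exact ENNReal.rpow_pos (pos_iff_ne_zero.2 hη) h
  have h1 := h0 (Metric.closedEBall_mem_nhds _ hη')
  obtain ⟨δ, hδ, h2⟩ := Metric.mem_nhds_iff.1 h1
  refine ⟨δ, hδ, fun t ht => ?_⟩
  have h3 := h2 (mem_ball_zero_iff.2 ht)
  simp only [mem_preimage, Metric.mem_closedEBall] at h3
  have hmp : MeasurePreserving (fun x : E => -t +ᵥ x) μ μ := measurePreserving_vadd (-t) μ
  have h4 : (DomAddAct.mk (-t)) +ᵥ F = (hf.comp_measurePreserving hmp).toLp (fun x => f (-t +ᵥ x)) :=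
    DomAddAct.mk_vadd_toLp (-t) hf
  have h5 : (DomAddAct.mk (0 : E)) +ᵥ F = F := by simp
  rw [h4, h5, hF, Lp.edist_toLp_toLp] at h3
  rw [eLpNorm_eq_lintegral_rpow_enorm_toReal (by simpa using hP0) ENNReal.ofReal_ne_top,
    ENNReal.toReal_ofReal hP0.le, ENNReal.rpow_le_rpow_iff (by positivity)] at h3
  refine le_trans (le_of_eq ?_) h3
  refine lintegral_congr fun x => ?_
  simp [sub_eq_neg_add]

/-- Jensen's inequality, obtained from Hölder's inequality against the constant `1`. -/
theorem lintegral_rpow_le_of_isProbabilityMeasure {X : Type*} [MeasurableSpace X] {ν : Measure X}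
    [IsProbabilityMeasure ν] {g : X → ℝ≥0∞} (hg : AEMeasurable g ν) {P : ℝ} (hP : 1 ≤ P) :
    (∫⁻ x, g x ∂ν) ^ P ≤ ∫⁻ x, g x ^ P ∂ν := by
  have hP0 : 0 < P := by linarith
  have h := ENNReal.lintegral_mul_norm_pow_le (μ := ν) (hg.pow_const P)
    (aemeasurable_const (b := (1 : ℝ≥0∞))) (p := 1 / P) (q := 1 - 1 / P) (by positivity)
    (by rw [sub_nonneg, div_le_one hP0]; exact hP) (by ring)
  simp only [ENNReal.one_rpow, mul_one, lintegral_const, measure_univ] at h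
  simp_rw [← ENNReal.rpow_mul, mul_one_div_cancel hP0.ne', ENNReal.rpow_one] at h
  rwa [one_div, ENNReal.le_rpow_inv_iff hP0] at h

/-- The difference is the average of `f(x - t) - f(x)` for the probability measure with density the
kernel. Jensen moves the power inside, and Tonelli leaves translation differences with `|t|` below
the radius. -/
theorem lintegral_enorm_mollify_sub_le {f : E → V} {P : ℝ} (hP : 1 ≤ P)
    (hf : MemLp f (ENNReal.ofReal P) μ) (ρ : ContDiffBump (0 : E)) {η : ℝ≥0∞}
    (h : ∀ t : E, ‖t‖ < ρ.rOut → ∫⁻ x, ‖f (x - t) - f x‖ₑ ^ P ∂μ ≤ η) :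
    ∫⁻ x, ‖mollify μ ρ f x - f x‖ₑ ^ P ∂μ ≤ η := by
  have hP1 : (1 : ℝ≥0∞) ≤ ENNReal.ofReal P := by simpa using ENNReal.ofReal_le_ofReal hP
  have hli : LocallyIntegrable f μ := hf.locallyIntegrable hP1
  set κ : E → ℝ≥0∞ := fun t => ENNReal.ofReal (ρ.normed μ t) with hκ
  have hκm : Measurable κ := (ρ.continuous_normed.measurable).ennreal_ofReal
  set ν : Measure E := μ.withDensity κ with hν
  have hν1 : IsProbabilityMeasure ν := by
    refine ⟨?_⟩
    rw [hν, withDensity_apply _ MeasurableSet.univ, setLIntegral_univ,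
      ← ofReal_integral_eq_lintegral_ofReal ρ.integrable_normed
        (Eventually.of_forall ρ.nonneg_normed), ρ.integral_normed, ENNReal.ofReal_one]
  have hsub : ∀ x, mollify μ ρ f x - f x = ∫ t, ρ.normed μ t • (f (x - t) - f x) ∂μ := by
    intro x
    have e1 : Integrable (fun t => ρ.normed μ t • f (x - t)) μ :=
      (ρ.hasCompactSupport_normed (μ := μ)).convolutionExists_left
        (ContinuousLinearMap.lsmul ℝ ℝ) ρ.continuous_normed hli x
    have e2 : Integrable (fun t => ρ.normed μ t • f x) μ := ρ.integrable_normed.smul_const _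
    simp_rw [smul_sub]
    rw [integral_sub e1 e2, ρ.integral_normed_smul]
    rfl
  have hqmp : ∀ x : E, Measure.QuasiMeasurePreserving (fun t => x - t) μ μ := fun x =>
    (Measure.measurePreserving_sub_left μ x).quasiMeasurePreserving
  have hm : AEMeasurable (fun q : E × E => ‖f (q.2 - q.1) - f q.2‖ₑ) (μ.prod μ) := by
    have h1 : AEStronglyMeasurable (fun q : E × E => f (q.2 - q.1)) (μ.prod μ) := by
      have hq : Measure.QuasiMeasurePreserving (fun q : E × E => q.2 - q.1) (μ.prod μ) μ := by
        exact (quasiMeasurePreserving_sub μ μ).comp Measure.measurePreserving_swap.quasiMeasurePreserving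
      exact hf.1.comp_quasiMeasurePreserving hq
    have h2 : AEStronglyMeasurable (fun q : E × E => f q.2) (μ.prod μ) :=
      hf.1.comp_quasiMeasurePreserving Measure.quasiMeasurePreserving_snd
    exact (h1.sub h2).enorm
  have hpt : ∀ x, ‖mollify μ ρ f x - f x‖ₑ ^ P ≤ ∫⁻ t, κ t * ‖f (x - t) - f x‖ₑ ^ P ∂μ := by
    intro x
    have hmx : AEMeasurable (fun t => ‖f (x - t) - f x‖ₑ) μ :=
      ((hf.1.comp_quasiMeasurePreserving (hqmp x)).sub aestronglyMeasurable_const).enorm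
    have hac : ν ≪ μ := withDensity_absolutelyContinuous _ _
    calc ‖mollify μ ρ f x - f x‖ₑ ^ P ≤ (∫⁻ t, ‖f (x - t) - f x‖ₑ ∂ν) ^ P := by
          refine ENNReal.rpow_le_rpow ?_ (by linarith)
          rw [hsub, hν, lintegral_withDensity_eq_lintegral_mul₀ hκm.aemeasurable hmx]
          refine (enorm_integral_le_lintegral_enorm _).trans (lintegral_mono fun t => ?_)
          rw [enorm_smul, Real.enorm_of_nonneg (ρ.nonneg_normed t)]
          rfl
      _ ≤ ∫⁻ t, ‖f (x - t) - f x‖ₑ ^ P ∂ν :=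
          lintegral_rpow_le_of_isProbabilityMeasure (hmx.mono_ac hac) hP
      _ = _ := by
          rw [hν, lintegral_withDensity_eq_lintegral_mul₀ hκm.aemeasurable (hmx.pow_const P)]
          rfl
  have hm2 : AEMeasurable (fun q : E × E => κ q.1 * ‖f (q.2 - q.1) - f q.2‖ₑ ^ P) (μ.prod μ) :=
    (hκm.comp measurable_fst).aemeasurable.mul (hm.pow_const P)
  calc ∫⁻ x, ‖mollify μ ρ f x - f x‖ₑ ^ P ∂μ
      ≤ ∫⁻ x, ∫⁻ t, κ t * ‖f (x - t) - f x‖ₑ ^ P ∂μ ∂μ := lintegral_mono hpt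
    _ = ∫⁻ t, ∫⁻ x, κ t * ‖f (x - t) - f x‖ₑ ^ P ∂μ ∂μ := (lintegral_lintegral_swap hm2).symm
    _ ≤ ∫⁻ t, κ t * η ∂μ := by
        refine lintegral_mono fun t => ?_
        rw [lintegral_const_mul' _ _ ENNReal.ofReal_ne_top]
        by_cases ht : ‖t‖ < ρ.rOut
        · exact mul_le_mul_right (h t ht) _
        · have : ρ.normed μ t = 0 := by
            have : t ∉ Function.support (ρ.normed μ) := by
              rwa [ρ.support_normed_eq, mem_ball_zero_iff]
            simpa using this
          simp [hκ, this]
    _ = η := by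
        rw [lintegral_mul_const _ hκm]
        have := hν1.measure_univ
        rw [hν, withDensity_apply _ MeasurableSet.univ, setLIntegral_univ] at this
        rw [this, one_mul]

/-- Mollifications with quickly shrinking kernels converge almost everywhere, and they are dominated by
a function with the same integrability. -/
theorem exists_mollify_dominated {f : E → V} {P : ℝ} (hP : 1 ≤ P)
    (hf : MemLp f (ENNReal.ofReal P) μ) :
    ∃ δ : ℕ → ℝ, (∀ j, 0 < δ j) ∧ ∀ ρ : ℕ → ContDiffBump (0 : E), (∀ j, (ρ j).rOut ≤ δ j) →
      (∀ᵐ x ∂μ, Tendsto (fun j => mollify μ (ρ j) f x) atTop (𝓝 (f x))) ∧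
      ∃ h : E → ℝ≥0∞, AEMeasurable h μ ∧ ∫⁻ x, h x ^ P ∂μ ≠ ⊤ ∧
        ∀ j x, ‖mollify μ (ρ j) f x‖ₑ ≤ h x := by
  have hP0 : 0 < P := by linarith
  have hP1 : (1 : ℝ≥0∞) ≤ ENNReal.ofReal P := by simpa using ENNReal.ofReal_le_ofReal hP
  have hli : LocallyIntegrable f μ := hf.locallyIntegrable hP1
  have hη : ∀ j : ℕ, ((2 : ℝ≥0∞)⁻¹ ^ j) ≠ 0 := fun j => by simp
  choose δ hδ hδ' using fun j => exists_lintegral_enorm_sub_translate_le hP hf (hη j)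
  refine ⟨δ, hδ, fun ρ hρ => ?_⟩
  have hj : ∀ j, ∫⁻ x, ‖mollify μ (ρ j) f x - f x‖ₑ ^ P ∂μ ≤ (2 : ℝ≥0∞)⁻¹ ^ j := fun j =>
    lintegral_enorm_mollify_sub_le hP hf (ρ j) fun t ht => hδ' j t (ht.trans_le (hρ j))
  have hmj : ∀ j, AEMeasurable (fun x => ‖mollify μ (ρ j) f x - f x‖ₑ) μ := fun j =>
    (((contDiff_mollify (ρ j) hli 0).continuous.aestronglyMeasurable).sub hf.1).enorm
  -- The errors are at most `2^{-j}`, so this sum is integrable. Its finiteness gives convergence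
  -- almost everywhere for the whole sequence, and `|f| + S^{1/P}` dominates all mollifications at
  -- once.
  set S : E → ℝ≥0∞ := fun x => ∑' j, ‖mollify μ (ρ j) f x - f x‖ₑ ^ P with hS
  have hSm : AEMeasurable S μ := AEMeasurable.tsum fun j => (hmj j).pow_const P
  have hSi : ∫⁻ x, S x ∂μ ≠ ⊤ := by
    rw [hS, lintegral_tsum fun j => (hmj j).pow_const P]
    refine ne_top_of_le_ne_top ?_ (ENNReal.tsum_le_tsum hj)
    rw [ENNReal.tsum_geometric, ENNReal.one_sub_inv_two, inv_inv]
    simp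
  refine ⟨?_, fun x => ‖f x‖ₑ + S x ^ (1 / P), hf.1.enorm.add (hSm.pow_const _), ?_, ?_⟩
  · filter_upwards [ae_lt_top' hSm hSi] with x hx
    have h1 := ENNReal.tendsto_atTop_zero_of_tsum_ne_top hx.ne
    have h2 : Tendsto (fun j => ‖mollify μ (ρ j) f x - f x‖ₑ) atTop (𝓝 0) := by
      have h3 := (ENNReal.continuous_rpow_const (y := 1 / P)).tendsto 0 |>.comp h1
      simp only [Function.comp_def, ← ENNReal.rpow_mul, mul_one_div_cancel hP0.ne',
        ENNReal.rpow_one] at h3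
      rwa [ENNReal.zero_rpow_of_pos (by positivity)] at h3
    rw [tendsto_iff_edist_tendsto_0]
    simpa [edist_eq_enorm_sub] using h2
  · have hfP : ∫⁻ x, ‖f x‖ₑ ^ P ∂μ ≠ ⊤ := by
      have := lintegral_rpow_enorm_lt_top_of_eLpNorm_lt_top (by simpa using hP0)
        ENNReal.ofReal_ne_top hf.2
      rw [ENNReal.toReal_ofReal hP0.le] at this
      exact this.ne
    refine ne_top_of_le_ne_top ?_ (lintegral_mono fun x =>
      ENNReal.rpow_add_le_mul_rpow_add_rpow (‖f x‖ₑ) (S x ^ (1 / P)) hP)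
    simp_rw [← ENNReal.rpow_mul, one_div_mul_cancel hP0.ne', ENNReal.rpow_one]
    rw [lintegral_const_mul' _ _ (by finiteness), lintegral_add_left' (hf.1.enorm.pow_const _)]
    exact ENNReal.mul_ne_top (by finiteness) (ENNReal.add_ne_top.2 ⟨hfP, hSi⟩)
  · intro j x
    have h1 : ‖mollify μ (ρ j) f x - f x‖ₑ ≤ S x ^ (1 / P) := by
      rw [one_div, ENNReal.le_rpow_inv_iff hP0]
      exact ENNReal.le_tsum j
    calc ‖mollify μ (ρ j) f x‖ₑ = ‖f x + (mollify μ (ρ j) f x - f x)‖ₑ := by congr 1; abel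
      _ ≤ _ := (enorm_add_le _ _).trans (add_le_add le_rfl h1)

end Mollify

/-! ### Weak derivatives and weakly closed forms under mollification. -/

section Weak

open Module Metric Filter

variable {n k : ℕ} {V : Type*} [NormedAddCommGroup V] [NormedSpace ℝ V] [CompleteSpace V]
  {Ω : Set (EuclideanSpace ℝ (Fin n))}

/-- Weak closedness of a form on an open subset of `ℝⁿ`. -/
def IsWeaklyClosed (Ω : Set (EuclideanSpace ℝ (Fin n)))
    (A : EuclideanSpace ℝ (Fin n) → EuclideanSpace ℝ (Fin n) [⋀^Fin k]→L[ℝ] ℝ) : Prop :=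
  ∀ φ : EuclideanSpace ℝ (Fin n) → ℝ, ContDiff ℝ ∞ φ → HasCompactSupport φ → tsupport φ ⊆ Ω →
    ∀ v : Fin (k + 1) → EuclideanSpace ℝ (Fin n),
      ∫ x, ∑ i : Fin (k + 1), (-1) ^ (i : ℕ) * (fderiv ℝ φ x (v i) * A x (i.removeNth v)) = 0

theorem integrable_mollifier_smul (ρ : ContDiffBump (0 : EuclideanSpace ℝ (Fin n)))
    {f : EuclideanSpace ℝ (Fin n) → V} (hf : LocallyIntegrable f volume)
    (x : EuclideanSpace ℝ (Fin n)) :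
    Integrable fun y => mollifier volume ρ x y • f y :=
  hf.integrable_smul_left_of_hasCompactSupport (contDiff_mollifier ρ x).continuous
    (hasCompactSupport_mollifier ρ x)

theorem integrable_fderiv_mollifier_smul (ρ : ContDiffBump (0 : EuclideanSpace ℝ (Fin n)))
    {f : EuclideanSpace ℝ (Fin n) → V} (hf : LocallyIntegrable f volume)
    (x v : EuclideanSpace ℝ (Fin n)) :
    Integrable fun y => fderiv ℝ (mollifier volume ρ x) y v • f y :=
  hf.integrable_smul_left_of_hasCompactSupport
    (((contDiff_mollifier ρ x).continuous_fderiv (by simp)).clm_apply continuous_const)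
    ((hasCompactSupport_mollifier ρ x).fderiv_apply (𝕜 := ℝ) v)

/-- The kernel centred at `x` is supported in the ball of radius `rOut` about `x`, so it is an
admissible test function as soon as that ball lies in `Ω`. -/
theorem fderiv_mollify_of_hasWeakDeriv {f : EuclideanSpace ℝ (Fin n) → V}
    {g : EuclideanSpace ℝ (Fin n) → EuclideanSpace ℝ (Fin n) →L[ℝ] V}
    (hf : LocallyIntegrable f volume) (hg : LocallyIntegrable g volume) (h : HasWeakDeriv Ω f g)
    (ρ : ContDiffBump (0 : EuclideanSpace ℝ (Fin n))) {x : EuclideanSpace ℝ (Fin n)}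
    (hx : closedBall x ρ.rOut ⊆ Ω) :
    fderiv ℝ (mollify volume ρ f) x = mollify volume ρ g x := by
  ext1 v
  rw [fderiv_mollify_apply ρ hf, h _ (contDiff_mollifier ρ x) (hasCompactSupport_mollifier ρ x)
    ((tsupport_mollifier_subset ρ x).trans hx), neg_neg, mollify_apply,
    ContinuousLinearMap.integral_apply (integrable_mollifier_smul ρ hg x)]
  rfl

/-- The value of the exterior derivative at `x` is, up to sign, the weak identity tested with the
kernel centred at `x`. -/
theorem extDeriv_mollify_of_isWeaklyClosed
    {A : EuclideanSpace ℝ (Fin n) → EuclideanSpace ℝ (Fin n) [⋀^Fin k]→L[ℝ] ℝ}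
    (hA : LocallyIntegrable A volume) (h : IsWeaklyClosed Ω A)
    (ρ : ContDiffBump (0 : EuclideanSpace ℝ (Fin n))) {x : EuclideanSpace ℝ (Fin n)}
    (hx : closedBall x ρ.rOut ⊆ Ω) :
    extDeriv (mollify volume ρ A) x = 0 := by
  ext v
  have h1 := h _ (contDiff_mollifier (μ := volume) ρ x) (hasCompactSupport_mollifier ρ x)
    ((tsupport_mollifier_subset ρ x).trans hx) v
  have hi : ∀ (w : EuclideanSpace ℝ (Fin n)) (u : Fin k → EuclideanSpace ℝ (Fin n)),
      ContinuousAlternatingMap.apply ℝ _ ℝ u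
        (∫ y, fderiv ℝ (mollifier volume ρ x) y w • A y) =
      ∫ y, fderiv ℝ (mollifier volume ρ x) y w * A y u := by
    intro w u
    rw [← ContinuousLinearMap.integral_comp_comm _ (integrable_fderiv_mollifier_smul ρ hA x w)]
    rfl
  have hint : ∀ (w : EuclideanSpace ℝ (Fin n)) (u : Fin k → EuclideanSpace ℝ (Fin n)),
      Integrable fun y => fderiv ℝ (mollifier volume ρ x) y w * A y u := fun w u =>
    (ContinuousAlternatingMap.apply ℝ _ ℝ u).integrable_comp
      (integrable_fderiv_mollifier_smul ρ hA x w)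
  rw [integral_finsetSum _ fun i _ => (hint _ _).const_mul _] at h1
  simp only [integral_const_mul, ← hi] at h1
  rw [extDeriv, ContinuousAlternatingMap.alternatizeUncurryFin_apply,
    ContinuousAlternatingMap.coe_zero, Pi.zero_apply, ← neg_zero, ← h1, ← Finset.sum_neg_distrib]
  refine Finset.sum_congr rfl fun i _ => ?_
  rw [fderiv_mollify_apply ρ hA]
  simp [ContinuousAlternatingMap.apply_apply]

/-- Cutting off to a compact set makes locally integrable data globally integrable, hence
mollifiable, while test functions supported in the smaller open set `U` do not notice. -/
theorem HasWeakDeriv.indicator {f : EuclideanSpace ℝ (Fin n) → V}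
    {g : EuclideanSpace ℝ (Fin n) → EuclideanSpace ℝ (Fin n) →L[ℝ] V} (h : HasWeakDeriv Ω f g)
    {U C : Set (EuclideanSpace ℝ (Fin n))} (hUC : U ⊆ C) (hU : U ⊆ Ω) :
    HasWeakDeriv U (C.indicator f) (C.indicator g) := by
  intro φ hφ hc hs v
  have h1 := h φ hφ hc (hs.trans hU) v
  have e : ∀ x, x ∉ C → φ x = 0 ∧ fderiv ℝ φ x = 0 := fun x hx => by
    have hx' : x ∉ tsupport φ := fun h => hx (hUC (hs h))
    exact ⟨image_eq_zero_of_notMem_tsupport hx',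
      image_eq_zero_of_notMem_tsupport fun h => hx' (tsupport_fderiv_subset ℝ h)⟩
  refine Eq.trans ?_ (h1.trans ?_)
  · congr 1; ext x
    by_cases hx : x ∈ C
    · rw [indicator_of_mem hx]
    · simp [(e x hx).2]
  · congr 2; ext x
    by_cases hx : x ∈ C
    · rw [indicator_of_mem hx]
    · simp [(e x hx).1]

theorem IsWeaklyClosed.indicator
    {A : EuclideanSpace ℝ (Fin n) → EuclideanSpace ℝ (Fin n) [⋀^Fin k]→L[ℝ] ℝ}
    (h : IsWeaklyClosed Ω A) {U C : Set (EuclideanSpace ℝ (Fin n))} (hUC : U ⊆ C) (hU : U ⊆ Ω) :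
    IsWeaklyClosed U (C.indicator A) := by
  intro φ hφ hc hs v
  refine Eq.trans ?_ (h φ hφ hc (hs.trans hU) v)
  congr 1; ext x
  by_cases hx : x ∈ C
  · rw [indicator_of_mem hx]
  · have h0 : fderiv ℝ φ x = 0 :=
      image_eq_zero_of_notMem_tsupport fun h => hx (hUC (hs (tsupport_fderiv_subset ℝ h)))
    simp [h0]

theorem MemLpLoc.memLp_indicator {f : EuclideanSpace ℝ (Fin n) → V} {p : ℝ≥0∞}
    (hf : MemLpLoc f p Ω) {C : Set (EuclideanSpace ℝ (Fin n))} (hC : IsCompact C) (hCΩ : C ⊆ Ω) :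
    MemLp (C.indicator f) p volume :=
  (memLp_indicator_iff_restrict hC.measurableSet).2 (hf C hCΩ hC)

/-- The conclusion of `exists_mollify_dominated` with a real valued dominating function. -/
theorem exists_mollify_dominated_real {f : EuclideanSpace ℝ (Fin n) → V} {P : ℝ} (hP : 1 ≤ P)
    (hf : MemLp f (ENNReal.ofReal P) volume) :
    ∃ δ : ℕ → ℝ, (∀ j, 0 < δ j) ∧ ∀ ρ : ℕ → ContDiffBump (0 : EuclideanSpace ℝ (Fin n)),
      (∀ j, (ρ j).rOut ≤ δ j) →
      (∀ᵐ x, Tendsto (fun j => mollify volume (ρ j) f x) atTop (𝓝 (f x))) ∧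
      ∃ H : EuclideanSpace ℝ (Fin n) → ℝ, MemLp H (ENNReal.ofReal P) volume ∧
        ∀ᵐ x, ∀ j, ‖mollify volume (ρ j) f x‖ ≤ H x := by
  have hP0 : 0 < P := by linarith
  obtain ⟨δ, hδ, h⟩ := exists_mollify_dominated hP hf
  refine ⟨δ, hδ, fun ρ hρ => ⟨(h ρ hρ).1, ?_⟩⟩
  obtain ⟨h, hm, hi, hb⟩ := (h ρ hρ).2
  have hfin : ∀ᵐ x, h x < ⊤ := by
    filter_upwards [ae_lt_top' (hm.pow_const P) hi] with x hx
    exact (ENNReal.rpow_lt_top_iff_of_pos hP0).1 hx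
  refine ⟨fun x => (h x).toReal, ⟨hm.ennreal_toReal.aestronglyMeasurable, ?_⟩, ?_⟩
  · refine (eLpNorm_lt_top_iff_lintegral_rpow_enorm_lt_top (by simpa using hP0)
      ENNReal.ofReal_ne_top).2 ?_
    rw [ENNReal.toReal_ofReal hP0.le]
    refine lt_of_le_of_lt (lintegral_mono_ae ?_) hi.lt_top
    filter_upwards [hfin] with x hx
    rw [Real.enorm_of_nonneg ENNReal.toReal_nonneg, ENNReal.ofReal_toReal hx.ne]
  · filter_upwards [hfin] with x hx j
    have := hb j x
    rw [← ofReal_norm] at this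
    exact (ENNReal.ofReal_le_iff_le_toReal hx.ne).1 this

/-- A sequence of mollifying kernels with prescribed upper bounds for the radii. -/
theorem exists_contDiffBump_rOut_le {δ : ℕ → ℝ} (hδ : ∀ j, 0 < δ j) :
    ∃ ρ : ℕ → ContDiffBump (0 : EuclideanSpace ℝ (Fin n)), ∀ j, (ρ j).rOut ≤ δ j :=
  ⟨fun j => ⟨δ j / 2, δ j, half_pos (hδ j), half_lt_self (hδ j)⟩, fun _ => le_rfl⟩

/-- Local approximation of a bounded Sobolev function by smooth functions, in dominated form. -/
theorem exists_contDiff_approx (hΩ : IsOpen Ω) {f : EuclideanSpace ℝ (Fin n) → V}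
    {g : EuclideanSpace ℝ (Fin n) → EuclideanSpace ℝ (Fin n) →L[ℝ] V} {P R : ℝ} (hP : 1 ≤ P)
    (hf : MemLpLoc f (ENNReal.ofReal P) Ω) (hR : ∀ x, ‖f x‖ ≤ R)
    (hg : MemLpLoc g (ENNReal.ofReal P) Ω) (h : HasWeakDeriv Ω f g)
    {C : Set (EuclideanSpace ℝ (Fin n))} (hC : IsCompact C) (hCΩ : C ⊆ Ω) :
    ∃ fj : ℕ → EuclideanSpace ℝ (Fin n) → V, (∀ j, ContDiff ℝ ∞ (fj j)) ∧ (∀ j x, ‖fj j x‖ ≤ R) ∧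
      (∀ᵐ x ∂volume.restrict C, Tendsto (fun j => fj j x) atTop (𝓝 (f x))) ∧
      (∀ᵐ x ∂volume.restrict C, Tendsto (fun j => fderiv ℝ (fj j) x) atTop (𝓝 (g x))) ∧
      ∃ H : EuclideanSpace ℝ (Fin n) → ℝ, MemLp H (ENNReal.ofReal P) volume ∧
        ∀ᵐ x ∂volume.restrict C, ∀ j, ‖fderiv ℝ (fj j) x‖ ≤ H x := by
  have hP1 : (1 : ℝ≥0∞) ≤ ENNReal.ofReal P := by simpa using ENNReal.ofReal_le_ofReal hP
  -- Room around `C` in which to mollify: kernels of radius at most `δ / 2` centred in `C` see only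
  -- the thickening, where the cut-off data still satisfy the weak identity.
  obtain ⟨δ, hδ, hδΩ⟩ := hC.exists_cthickening_subset_open hΩ hCΩ
  set C' := cthickening δ C with hC'
  have hC'c : IsCompact C' := hC.cthickening
  have hf' := hf.memLp_indicator hC'c hδΩ
  have hg' := hg.memLp_indicator hC'c hδΩ
  have h' : HasWeakDeriv (thickening δ C) (C'.indicator f) (C'.indicator g) :=
    h.indicator (thickening_subset_cthickening _ _)
      ((thickening_subset_cthickening _ _).trans hδΩ)
  obtain ⟨δ₁, hδ₁, h₁⟩ := exists_mollify_dominated_real hP hf'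
  obtain ⟨δ₂, hδ₂, h₂⟩ := exists_mollify_dominated_real hP hg'
  obtain ⟨ρ, hρ⟩ := exists_contDiffBump_rOut_le (n := n) (δ := fun j => min (δ / 2) (min (δ₁ j) (δ₂ j)))
    fun j => lt_min (half_pos hδ) (lt_min (hδ₁ j) (hδ₂ j))
  obtain ⟨a₁, -⟩ := h₁ ρ fun j => (hρ j).trans ((min_le_right _ _).trans (min_le_left _ _))
  obtain ⟨a₂, H, hH, b₂⟩ := h₂ ρ fun j => (hρ j).trans ((min_le_right _ _).trans (min_le_right _ _))
  have hder : ∀ j, ∀ x ∈ C, fderiv ℝ (mollify volume (ρ j) (C'.indicator f)) x =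
      mollify volume (ρ j) (C'.indicator g) x := fun j x hx =>
    fderiv_mollify_of_hasWeakDeriv (hf'.locallyIntegrable hP1) (hg'.locallyIntegrable hP1) h' (ρ j)
      fun y hy => mem_thickening_iff.2 ⟨x, hx, (mem_closedBall.1 hy).trans_lt
        (((hρ j).trans (min_le_left _ _)).trans_lt (half_lt_self hδ))⟩
  have hsub : C ⊆ C' := self_subset_cthickening C
  refine ⟨fun j => mollify volume (ρ j) (C'.indicator f), fun j => ?_, fun j x => ?_, ?_, ?_, H, hH, ?_⟩
  · exact contDiff_mollify (ρ j) (hf'.locallyIntegrable hP1) ⊤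
  · exact norm_mollify_le _ (fun y => (norm_indicator_le_norm_self f y).trans (hR y)) x
  · filter_upwards [ae_restrict_of_ae a₁, ae_restrict_mem hC.measurableSet] with x hx hxC
    rwa [indicator_of_mem (hsub hxC)] at hx
  · filter_upwards [ae_restrict_of_ae a₂, ae_restrict_mem hC.measurableSet] with x hx hxC
    rw [indicator_of_mem (hsub hxC)] at hx
    simpa only [hder _ x hxC] using hx
  · filter_upwards [ae_restrict_of_ae b₂, ae_restrict_mem hC.measurableSet] with x hx hxC j
    rw [hder j x hxC]
    exact hx j

end Weak

/-! ### Pull-backs of forms by bounded Sobolev maps. -/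

section WeakPullback

open Module Metric Filter

variable {n k : ℕ} {V : Type*} [NormedAddCommGroup V] [NormedSpace ℝ V] [FiniteDimensional ℝ V]
  {Ω : Set (EuclideanSpace ℝ (Fin n))}

theorem abs_compContinuousLinearMap_apply_le {E : Type*} [NormedAddCommGroup E] [NormedSpace ℝ E]
    (β : V [⋀^Fin k]→L[ℝ] ℝ) (L : E →L[ℝ] V) (v : Fin k → E) :
    |β.compContinuousLinearMap L v| ≤ ‖β‖ * ‖L‖ ^ k * ∏ i, ‖v i‖ := by
  refine ((β.compContinuousLinearMap L).le_opNorm v).trans ?_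
  gcongr
  simpa using ContinuousAlternatingMap.norm_compContinuousLinearMap_le β L

/-- Passage to the limit in integrals of pull-backs of a form. -/
theorem tendsto_integral_mul_pullback {β : V → V [⋀^Fin k]→L[ℝ] ℝ} (hβ : Continuous β) {p : ℝ}
    (hkp : (k : ℝ) ≤ p) {C : Set (EuclideanSpace ℝ (Fin n))} (hC : IsCompact C) {R : ℝ}
    {f : EuclideanSpace ℝ (Fin n) → V}
    {g : EuclideanSpace ℝ (Fin n) → EuclideanSpace ℝ (Fin n) →L[ℝ] V}
    {fj : ℕ → EuclideanSpace ℝ (Fin n) → V} (hfj : ∀ j, ContDiff ℝ ∞ (fj j))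
    (hR : ∀ j x, ‖fj j x‖ ≤ R)
    (hlim : ∀ᵐ x ∂volume.restrict C, Tendsto (fun j => fj j x) atTop (𝓝 (f x)))
    (hlim' : ∀ᵐ x ∂volume.restrict C, Tendsto (fun j => fderiv ℝ (fj j) x) atTop (𝓝 (g x)))
    {H : EuclideanSpace ℝ (Fin n) → ℝ} (hH : MemLp H (ENNReal.ofReal p) volume)
    (hHj : ∀ᵐ x ∂volume.restrict C, ∀ j, ‖fderiv ℝ (fj j) x‖ ≤ H x)
    {ψ : EuclideanSpace ℝ (Fin n) → ℝ} (hψ : Continuous ψ) (hψC : tsupport ψ ⊆ C)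
    (v : Fin k → EuclideanSpace ℝ (Fin n)) :
    Integrable (fun x => ψ x * (β (f x)).compContinuousLinearMap (g x) v) ∧
    Tendsto (fun j => ∫ x, ψ x * (β (fj j x)).compContinuousLinearMap (fderiv ℝ (fj j) x) v) atTop
      (𝓝 (∫ x, ψ x * (β (f x)).compContinuousLinearMap (g x) v)) := by
  have hψ0 : ∀ x ∉ C, ψ x = 0 := fun x hx => image_eq_zero_of_notMem_tsupport fun h => hx (hψC h)
  have hset : ∀ {u : EuclideanSpace ℝ (Fin n) → ℝ}, ∫ x, ψ x * u x = ∫ x in C, ψ x * u x := fun {u} =>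
    (setIntegral_eq_integral_of_forall_compl_eq_zero fun x hx => by rw [hψ0 x hx, zero_mul]).symm
  obtain ⟨Bβ, hBβ⟩ := (isCompact_closedBall (0 : V) R).exists_bound_of_continuousOn hβ.continuousOn
  obtain ⟨Bψ, hBψ⟩ := hC.exists_bound_of_continuousOn hψ.continuousOn
  set F : ℕ → EuclideanSpace ℝ (Fin n) → ℝ :=
    fun j x => ψ x * (β (fj j x)).compContinuousLinearMap (fderiv ℝ (fj j) x) v with hF
  have hev : Continuous fun q : (V [⋀^Fin k]→L[ℝ] ℝ) × (EuclideanSpace ℝ (Fin n) →L[ℝ] V) =>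
      q.1.compContinuousLinearMap q.2 v :=
    (ContinuousAlternatingMap.apply ℝ _ ℝ v).continuous.comp continuous_alternating_comp
  have hFc : ∀ j, Continuous (F j) := fun j => by
    refine hψ.mul ?_
    exact hev.comp
      ((hβ.comp (hfj j).continuous).prodMk ((hfj j).continuous_fderiv (by simp)))
  have hFlim : ∀ᵐ x ∂volume.restrict C, Tendsto (fun j => F j x) atTop
      (𝓝 (ψ x * (β (f x)).compContinuousLinearMap (g x) v)) := by
    filter_upwards [hlim, hlim'] with x h1 h2
    refine tendsto_const_nhds.mul ?_
    exact (hev.tendsto (β (f x), g x)).comp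
      (((hβ.tendsto _).comp h1).prodMk_nhds h2)
  -- A pulled-back `k`-form is bounded by a multiple of `|H|^k`, integrable on `C` because `k ≤ p`
  -- and `C` has finite measure.
  set bd : EuclideanSpace ℝ (Fin n) → ℝ := fun x => Bψ * (Bβ * (|H x| ^ k * ∏ i, ‖v i‖)) with hbd
  have hfin : IsFiniteMeasure (volume.restrict C) := ⟨by simpa using hC.measure_lt_top⟩
  have hbdi : Integrable bd (volume.restrict C) := by
    have h1 : MemLp H (k : ℝ≥0∞) (volume.restrict C) :=
      (hH.restrict C).mono_exponent (by
        rw [← ENNReal.ofReal_natCast]; exact ENNReal.ofReal_le_ofReal hkp)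
    exact ((h1.integrable_norm_pow'.mul_const _).const_mul _).const_mul _
  have hb : ∀ᵐ x ∂volume.restrict C, ∀ j, ‖F j x‖ ≤ bd x := by
    filter_upwards [hHj, ae_restrict_mem hC.measurableSet] with x hx hxC j
    have h0 : 0 ≤ H x := (norm_nonneg _).trans (hx j)
    have h1 := abs_compContinuousLinearMap_apply_le (β (fj j x)) (fderiv ℝ (fj j) x) v
    have h2 : ‖β (fj j x)‖ ≤ Bβ := hBβ _ (mem_closedBall_zero_iff.2 (hR j x))
    simp only [hF, norm_mul, hbd]
    refine mul_le_mul (hBψ x hxC) ?_ (norm_nonneg _) ((norm_nonneg _).trans (hBψ x hxC))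
    rw [Real.norm_eq_abs, ← mul_assoc]
    refine h1.trans ?_
    gcongr
    · exact (norm_nonneg _).trans h2
    · exact (hx j).trans (le_abs_self _)
  have hi : Integrable (fun x => ψ x * (β (f x)).compContinuousLinearMap (g x) v)
      (volume.restrict C) := by
    refine hbdi.mono' (aestronglyMeasurable_of_tendsto_ae atTop
      (fun j => (hFc j).aestronglyMeasurable) hFlim) ?_
    filter_upwards [hFlim, hb] with x h1 h2
    exact le_of_tendsto h1.norm (Eventually.of_forall h2)
  refine ⟨?_, ?_⟩
  · refine (integrableOn_iff_integrable_of_support_subset ?_).1 hi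
    intro x hx
    by_contra h
    exact hx (by simp [hψ0 x h])
  · simp_rw [hset]
    refine tendsto_integral_of_dominated_convergence bd (fun j => (hFc j).aestronglyMeasurable) hbdi
      (fun j => ?_) hFlim
    filter_upwards [hb] with x hx using hx j

/-- The weak exterior derivative of the pull-back of a form by a bounded Sobolev function is the
pull-back of its exterior derivative. -/
theorem integral_mul_pullback_extDeriv_eq (hΩ : IsOpen Ω) {f : EuclideanSpace ℝ (Fin n) → V}
    {g : EuclideanSpace ℝ (Fin n) → EuclideanSpace ℝ (Fin n) →L[ℝ] V} {p R : ℝ}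
    (hp : 1 ≤ p) (hkp : ((k + 1 : ℕ) : ℝ) ≤ p)
    (hf : MemLpLoc f (ENNReal.ofReal p) Ω) (hR : ∀ x, ‖f x‖ ≤ R)
    (hg : MemLpLoc g (ENNReal.ofReal p) Ω) (h : HasWeakDeriv Ω f g)
    {α : V → V [⋀^Fin k]→L[ℝ] ℝ} (hα : ContDiff ℝ 1 α) {φ : EuclideanSpace ℝ (Fin n) → ℝ}
    (hφ : ContDiff ℝ ∞ φ) (hc : HasCompactSupport φ) (hs : tsupport φ ⊆ Ω)
    (v : Fin (k + 1) → EuclideanSpace ℝ (Fin n)) :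
    ∫ x, φ x * (extDeriv α (f x)).compContinuousLinearMap (g x) v =
      -∫ x, ∑ i : Fin (k + 1), (-1) ^ (i : ℕ) *
        (fderiv ℝ φ x (v i) * (α (f x)).compContinuousLinearMap (g x) (i.removeNth v)) := by
  obtain ⟨fj, hfj, hRj, hlim, hlim', H, hH, hHj⟩ :=
    exists_contDiff_approx hΩ hp hf hR hg h hc.isCompact hs
  have hd : Continuous fun y => extDeriv α y :=
    (ContinuousAlternatingMap.alternatizeUncurryFinCLM ℝ V ℝ).continuous.comp
      (hα.continuous_fderiv one_ne_zero)
  have h1 := (tendsto_integral_mul_pullback hd hkp hc.isCompact hfj hRj hlim hlim' hH hHj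
    hφ.continuous le_rfl v).2
  have h2 : ∀ i : Fin (k + 1), _ := fun i =>
    tendsto_integral_mul_pullback hα.continuous (le_trans (by simp) hkp) hc.isCompact hfj hRj
      hlim hlim' hH hHj (ψ := fun x => fderiv ℝ φ x (v i))
      ((hφ.continuous_fderiv (by simp)).clm_apply continuous_const)
      (tsupport_fderiv_apply_subset ℝ (v i)) (i.removeNth v)
  -- The identity holds for each smooth approximation `fj` by commuting `d` with pull-back and
  -- integrating by parts; both sides converge.
  refine tendsto_nhds_unique h1 ?_
  have hφ1 : ContDiff ℝ 1 φ := hφ.of_le (by simp)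
  have h3 : ∀ j, ∫ x, φ x * (extDeriv α (fj j x)).compContinuousLinearMap (fderiv ℝ (fj j) x) v =
      -∑ i : Fin (k + 1), (-1) ^ (i : ℕ) * ∫ x, fderiv ℝ φ x (v i) *
        (α (fj j x)).compContinuousLinearMap (fderiv ℝ (fj j) x) (i.removeNth v) := by
    intro j
    have h2j : ContDiff ℝ 2 (fj j) := (hfj j).of_le (by norm_cast)
    have hP := contDiff_pullback h2j hα
    simp_rw [← extDeriv_pullback_of_contDiff h2j hα]
    rw [integral_mul_extDeriv_apply hP hφ1 hc, integral_finsetSum _ fun i _ => ?_]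
    · simp_rw [integral_const_mul]
    · refine Integrable.const_mul ?_ _
      exact (((hφ1.continuous_fderiv one_ne_zero).clm_apply continuous_const).mul
        (contDiff_alternating_apply hP _).continuous).integrable_of_hasCompactSupport
          (hc.fderiv_apply (𝕜 := ℝ) (v i)).mul_right
  simp_rw [h3]
  rw [integral_finsetSum _ fun i _ => (h2 i).1.const_mul _]
  simp_rw [integral_const_mul]
  exact (tendsto_finsetSum _ fun i _ => (h2 i).2.const_mul _).neg

/-- The ambient form `α` is not assumed closed: for the extension of a closed form on `M`, `dα`
vanishes only on vectors tangent to `M`, and that suffices since `g` maps into tangent spaces. The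
condition `k + 1 ≤ p` is what makes the pull-back of `dα` locally integrable. -/
theorem isWeaklyClosed_pullback (hΩ : IsOpen Ω) {f : EuclideanSpace ℝ (Fin n) → V}
    {g : EuclideanSpace ℝ (Fin n) → EuclideanSpace ℝ (Fin n) →L[ℝ] V} {p R : ℝ}
    (hp : 1 ≤ p) (hkp : ((k + 1 : ℕ) : ℝ) ≤ p)
    (hf : MemLpLoc f (ENNReal.ofReal p) Ω) (hR : ∀ x, ‖f x‖ ≤ R)
    (hg : MemLpLoc g (ENNReal.ofReal p) Ω) (h : HasWeakDeriv Ω f g)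
    {α : V → V [⋀^Fin k]→L[ℝ] ℝ} (hα : ContDiff ℝ 1 α)
    (hd : ∀ᵐ x ∂volume.restrict Ω, (extDeriv α (f x)).compContinuousLinearMap (g x) = 0) :
    IsWeaklyClosed Ω fun x => (α (f x)).compContinuousLinearMap (g x) := by
  intro φ hφ hc hs v
  rw [← neg_eq_zero, ← integral_mul_pullback_extDeriv_eq hΩ hp hkp hf hR hg h hα hφ hc hs v]
  refine integral_eq_zero_of_ae ?_
  filter_upwards [(ae_restrict_iff' hΩ.measurableSet).1 hd] with x hx
  by_cases hxΩ : x ∈ Ω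
  · simp [hx hxΩ]
  · simp [image_eq_zero_of_notMem_tsupport fun h => hxΩ (hs h)]

end WeakPullback

/-! ### The two integral estimates for Sobolev data, by passage to the limit. -/

section WeakEstimates

open Module Metric Filter

variable {n k l : ℕ} {V : Type*} [NormedAddCommGroup V] [NormedSpace ℝ V] [FiniteDimensional ℝ V]
  {Ω : Set (EuclideanSpace ℝ (Fin n))}

theorem tendsto_lintegral_enorm_rpow {W : Type*} [NormedAddCommGroup W] {X : Type*}
    [MeasurableSpace X] {ν : Measure X} [IsFiniteMeasure ν]
    {u : ℕ → X → W} {u₀ : X → W} (hu : ∀ j, AEStronglyMeasurable (u j) ν)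
    (hlim : ∀ᵐ x ∂ν, Tendsto (fun j => u j x) atTop (𝓝 (u₀ x))) {H : X → ℝ} {q Q : ℝ}
    (hH : MemLp H (ENNReal.ofReal Q) ν) (hHj : ∀ᵐ x ∂ν, ∀ j, ‖u j x‖ ≤ H x) (hq : 0 < q)
    (hqQ : q ≤ Q) :
    ∫⁻ x, ‖u₀ x‖ₑ ^ q ∂ν ≠ ⊤ ∧
      Tendsto (fun j => ∫⁻ x, ‖u j x‖ₑ ^ q ∂ν) atTop (𝓝 (∫⁻ x, ‖u₀ x‖ₑ ^ q ∂ν)) := by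
  have hHq : MemLp H (ENNReal.ofReal q) ν := hH.mono_exponent (ENNReal.ofReal_le_ofReal hqQ)
  have hfin : ∫⁻ x, ‖H x‖ₑ ^ q ∂ν < ⊤ := by
    have := (eLpNorm_lt_top_iff_lintegral_rpow_enorm_lt_top (by simpa using hq)
      ENNReal.ofReal_ne_top).1 hHq.2
    rwa [ENNReal.toReal_ofReal hq.le] at this
  have hle : ∀ᵐ x ∂ν, ∀ j, ‖u j x‖ₑ ≤ ‖H x‖ₑ := by
    filter_upwards [hHj] with x hx j
    exact enorm_le_iff_norm_le.2 ((hx j).trans (le_abs_self _))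
  refine ⟨(lt_of_le_of_lt (lintegral_mono_ae ?_) hfin).ne, ?_⟩
  · filter_upwards [hle, hlim] with x h1 h2
    refine ENNReal.rpow_le_rpow ?_ hq.le
    exact le_of_tendsto h2.enorm (Eventually.of_forall h1)
  · refine tendsto_lintegral_of_dominated_convergence' (fun x => ‖H x‖ₑ ^ q)
      (fun j => (hu j).enorm.pow_const q) (fun j => ?_) hfin.ne ?_
    · filter_upwards [hle] with x h1
      exact ENNReal.rpow_le_rpow (h1 j) hq.le
    · filter_upwards [hlim] with x h2
      exact (ENNReal.continuous_rpow_const.tendsto _).comp h2.enorm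

theorem continuous_altPairing (v : Fin k ⊕ Fin l → EuclideanSpace ℝ (Fin n)) :
    Continuous fun z : (EuclideanSpace ℝ (Fin n) [⋀^Fin k]→L[ℝ] ℝ) ×
      (EuclideanSpace ℝ (Fin n) [⋀^Fin l]→L[ℝ] ℝ) => altPairing v z.1 z.2 := by
  refine continuous_finsetSum _ fun σ _ => continuous_const.mul (Continuous.mul ?_ ?_)
  · exact (ContinuousAlternatingMap.apply ℝ _ ℝ _).continuous.comp continuous_fst
  · exact (ContinuousAlternatingMap.apply ℝ _ ℝ _).continuous.comp continuous_snd

theorem tendsto_altPairing (v : Fin k ⊕ Fin l → EuclideanSpace ℝ (Fin n))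
    {a : ℕ → EuclideanSpace ℝ (Fin n) [⋀^Fin k]→L[ℝ] ℝ}
    {b : ℕ → EuclideanSpace ℝ (Fin n) [⋀^Fin l]→L[ℝ] ℝ} {a₀ b₀}
    (ha : Tendsto a atTop (𝓝 a₀)) (hb : Tendsto b atTop (𝓝 b₀)) :
    Tendsto (fun j => altPairing v (a j) (b j)) atTop (𝓝 (altPairing v a₀ b₀)) := by
  unfold altPairing
  refine tendsto_finsetSum _ fun σ _ => tendsto_const_nhds.mul (Tendsto.mul ?_ ?_)
  · exact ((ContinuousAlternatingMap.apply ℝ _ ℝ _).continuous.tendsto a₀).comp ha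
  · exact ((ContinuousAlternatingMap.apply ℝ _ ℝ _).continuous.tendsto b₀).comp hb

/-- The estimate for the integral of the exterior product of two weakly closed forms. -/
theorem enorm_integral_mul_altPairing_le_of_isWeaklyClosed
    {A : EuclideanSpace ℝ (Fin n) → EuclideanSpace ℝ (Fin n) [⋀^Fin (k + 1)]→L[ℝ] ℝ}
    {B : EuclideanSpace ℝ (Fin n) → EuclideanSpace ℝ (Fin n) [⋀^Fin l]→L[ℝ] ℝ}
    {φ : EuclideanSpace ℝ (Fin n) → ℝ} {Q₁ Q₂ : ℝ} (hQ : Q₁.HolderConjugate Q₂)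
    (hA : MemLpLoc A (ENNReal.ofReal Q₁) Ω) (hB : MemLpLoc B (ENNReal.ofReal Q₂) Ω)
    (hcA : IsWeaklyClosed Ω A) (hcB : IsWeaklyClosed Ω B)
    (hφ : ContDiff ℝ 1 φ) {x₀ : EuclideanSpace ℝ (Fin n)} {r : ℝ} (hr : 0 < r)
    (hΩ : closedBall x₀ (5 * r) ⊆ Ω) (hφs : tsupport φ ⊆ ball x₀ (2 * r))
    (hφ1 : ∀ x, |φ x| ≤ 1) {m : ℝ} (hm : 0 ≤ m) (hdφ : ∀ x, ‖fderiv ℝ φ x‖ ≤ m / r)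
    (v : Fin (k + 1) ⊕ Fin l → EuclideanSpace ℝ (Fin n)) (hv : ∀ i, ‖v i‖ ≤ 1)
    {θ s₁ s₂ : ℝ} (hθ : n * θ = 1 / 2) (hθ0 : 0 ≤ θ) (hs₁ : 0 < s₁) (hs₂ : 0 < s₂)
    (hs₁' : s₁ ≤ 1) (hs₂' : s₂ ≤ 1) (hs : s₁ + s₂ = 1 + θ) (h₁ : 1 / s₁ ≤ Q₁) (h₂ : 1 / s₂ ≤ Q₂) :
    volume (ball (0 : EuclideanSpace ℝ (Fin n)) (2 * r)) *
        ‖∫ x, φ x * altPairing v (A x) (B x)‖ₑ ≤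
      ((k + 1) * (k + 1 + l).factorial : ℕ) * (1 + 4 * ENNReal.ofReal m) *
        (volume (ball (0 : EuclideanSpace ℝ (Fin n)) (2 * r)) ^ (1 - θ) *
          ((∫⁻ x in ball x₀ (4 * r), ‖A x‖ₑ ^ (1 / s₁)) ^ s₁ *
            (∫⁻ x in ball x₀ (4 * r), ‖B x‖ₑ ^ (1 / s₂)) ^ s₂)) := by
  set C := closedBall x₀ (5 * r) with hC
  have hCc : IsCompact C := isCompact_closedBall _ _
  have h15 : ball x₀ (4 * r) ⊆ C := ball_subset_closedBall.trans (closedBall_subset_closedBall (by linarith))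
  have hQ1 : 1 ≤ Q₁ := hQ.lt.le
  have hQ2 : 1 ≤ Q₂ := hQ.symm.lt.le
  have hE1 : (1 : ℝ≥0∞) ≤ ENNReal.ofReal Q₁ := by simpa using ENNReal.ofReal_le_ofReal hQ1
  have hE2 : (1 : ℝ≥0∞) ≤ ENNReal.ofReal Q₂ := by simpa using ENNReal.ofReal_le_ofReal hQ2
  have hA' := hA.memLp_indicator hCc hΩ
  have hB' := hB.memLp_indicator hCc hΩ
  have hU : ball x₀ (5 * r) ⊆ C := ball_subset_closedBall
  have hcA' := hcA.indicator hU (hU.trans hΩ)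
  have hcB' := hcB.indicator hU (hU.trans hΩ)
  obtain ⟨δ₁, hδ₁, a₁⟩ := exists_mollify_dominated_real hQ1 hA'
  obtain ⟨δ₂, hδ₂, a₂⟩ := exists_mollify_dominated_real hQ2 hB'
  obtain ⟨ρ, hρ⟩ := exists_contDiffBump_rOut_le (n := n) (δ := fun j => min (r / 2) (min (δ₁ j) (δ₂ j)))
    fun j => lt_min (half_pos hr) (lt_min (hδ₁ j) (hδ₂ j))
  obtain ⟨l₁, H₁, hH₁, b₁⟩ := a₁ ρ fun j => (hρ j).trans ((min_le_right _ _).trans (min_le_left _ _))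
  obtain ⟨l₂, H₂, hH₂, b₂⟩ := a₂ ρ fun j => (hρ j).trans ((min_le_right _ _).trans (min_le_right _ _))
  have hli₁ := hA'.locallyIntegrable hE1
  have hli₂ := hB'.locallyIntegrable hE2
  set Aj := fun j => mollify volume (ρ j) (C.indicator A) with hAj
  set Bj := fun j => mollify volume (ρ j) (C.indicator B) with hBj
  have hAc : ∀ j, ContDiff ℝ 1 (Aj j) := fun j => contDiff_mollify (ρ j) hli₁ 1
  have hBc : ∀ j, ContDiff ℝ 1 (Bj j) := fun j => contDiff_mollify (ρ j) hli₂ 1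
  -- The mollification radii are at most `r / 2`, so mollifying at points of the ball of radius `4r`
  -- uses only the ball of radius `5r`, where the cut-off forms are weakly closed.
  have hcl : ∀ j, ∀ x ∈ ball x₀ (4 * r), closedBall x (ρ j).rOut ⊆ ball x₀ (5 * r) := by
    intro j x hx
    refine closedBall_subset_ball' ?_
    have := (hρ j).trans (min_le_left _ _)
    rw [mem_ball] at hx
    linarith
  have hest := fun j => enorm_integral_mul_altPairing_le_of_closed (μ := volume) (hAc j) (hBc j) hφ hr hφs
    hφ1 hm hdφ (fun x hx => extDeriv_mollify_of_isWeaklyClosed hli₁ hcA' (ρ j) (hcl j x hx))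
    (fun x hx => extDeriv_mollify_of_isWeaklyClosed hli₂ hcB' (ρ j) (hcl j x hx)) v hv
    (θ := θ) (by simpa using hθ) hθ0 hs₁ hs₂ hs₁' hs₂' hs
  have hind : ∀ {j : ℕ} (X : EuclideanSpace ℝ (Fin n) → EuclideanSpace ℝ (Fin n) [⋀^Fin j]→L[ℝ] ℝ)
      (s : ℝ), ∫⁻ x in ball x₀ (4 * r), ‖C.indicator X x‖ₑ ^ s =
        ∫⁻ x in ball x₀ (4 * r), ‖X x‖ₑ ^ s := fun X s =>
    setLIntegral_congr_fun measurableSet_ball fun x hx => by rw [indicator_of_mem (h15 hx)]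
  have : IsFiniteMeasure (volume.restrict (ball x₀ (4 * r))) := ⟨by simpa using measure_ball_lt_top⟩
  obtain ⟨f₁, t₁⟩ := tendsto_lintegral_enorm_rpow (ν := volume.restrict (ball x₀ (4 * r)))
    (fun j => (hAc j).continuous.aestronglyMeasurable) (ae_restrict_of_ae l₁) (hH₁.restrict _)
    (ae_restrict_of_ae b₁) (one_div_pos.2 hs₁) h₁
  obtain ⟨f₂, t₂⟩ := tendsto_lintegral_enorm_rpow (ν := volume.restrict (ball x₀ (4 * r)))
    (fun j => (hBc j).continuous.aestronglyMeasurable) (ae_restrict_of_ae l₂) (hH₂.restrict _)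
    (ae_restrict_of_ae b₂) (one_div_pos.2 hs₂) h₂
  rw [hind] at f₁ f₂ t₁ t₂
  have hI : Tendsto (fun j => ∫ x, φ x * altPairing v (Aj j x) (Bj j x)) atTop
      (𝓝 (∫ x, φ x * altPairing v (A x) (B x))) := by
    -- The exponents `Q₁`, `Q₂` are conjugate precisely so that the product of the two dominating
    -- functions is integrable.
    have hbd : Integrable fun x => (k + 1 + l).factorial * (H₁ x * H₂ x) := by
      have : (ENNReal.ofReal Q₁).HolderConjugate (ENNReal.ofReal Q₂) := hQ.ennrealOfReal
      exact (MemLp.integrable_mul hH₁ hH₂).const_mul _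
    refine tendsto_integral_of_dominated_convergence _ (fun j => ?_) hbd (fun j => ?_) ?_
    · exact (hφ.continuous.mul ((continuous_altPairing v).comp
        ((hAc j).continuous.prodMk (hBc j).continuous))).aestronglyMeasurable
    · filter_upwards [b₁, b₂] with x h1 h2
      rw [norm_mul, Real.norm_eq_abs, Real.norm_eq_abs]
      refine (mul_le_of_le_one_left (abs_nonneg _) (hφ1 x)).trans ?_
      refine (abs_altPairing_le v hv _ _).trans ?_
      exact mul_le_mul_of_nonneg_left (mul_le_mul (h1 j) (h2 j) (norm_nonneg _)
        ((norm_nonneg _).trans (h1 j))) (by positivity)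
    · filter_upwards [l₁, l₂] with x h1 h2
      by_cases hx : x ∈ C
      · rw [indicator_of_mem hx] at h1 h2
        exact tendsto_const_nhds.mul (tendsto_altPairing v h1 h2)
      · have : φ x = 0 := image_eq_zero_of_notMem_tsupport fun h =>
          hx (closedBall_subset_closedBall (by linarith) (ball_subset_closedBall (hφs h)))
        simp [this]
  have hr₁ := (ENNReal.continuous_rpow_const (y := s₁)).tendsto _ |>.comp t₁
  have hr₂ := (ENNReal.continuous_rpow_const (y := s₂)).tendsto _ |>.comp t₂
  have g₁ := ENNReal.rpow_ne_top_of_nonneg hs₁.le f₁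
  have g₂ := ENNReal.rpow_ne_top_of_nonneg hs₂.le f₂
  have hV : volume (ball (0 : EuclideanSpace ℝ (Fin n)) (2 * r)) ≠ ⊤ := measure_ball_lt_top.ne
  have hV0 : volume (ball (0 : EuclideanSpace ℝ (Fin n)) (2 * r)) ≠ 0 :=
    (measure_ball_pos _ _ (by linarith)).ne'
  refine le_of_tendsto_of_tendsto' (ENNReal.Tendsto.const_mul hI.enorm (Or.inr hV))
    (ENNReal.Tendsto.const_mul (ENNReal.Tendsto.const_mul
      (ENNReal.Tendsto.mul hr₁ (Or.inr g₂) hr₂ (Or.inr g₁)) (Or.inr ?_)) (Or.inr ?_)) hest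
  · exact ENNReal.rpow_ne_top_of_ne_zero hV0 hV
  · finiteness

/-- The estimate for the integral of the pull-back of an exact form by a bounded Sobolev function. -/
theorem enorm_integral_mul_pullback_extDeriv_le_of_hasWeakDeriv (hΩo : IsOpen Ω)
    {f : EuclideanSpace ℝ (Fin n) → V}
    {g : EuclideanSpace ℝ (Fin n) → EuclideanSpace ℝ (Fin n) →L[ℝ] V} {p R : ℝ}
    (hkp : ((k + 1 : ℕ) : ℝ) ≤ p)
    (hf : MemLpLoc f (ENNReal.ofReal p) Ω) (hR : ∀ x, ‖f x‖ ≤ R)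
    (hg : MemLpLoc g (ENNReal.ofReal p) Ω) (h : HasWeakDeriv Ω f g)
    {τ : V → V [⋀^Fin k]→L[ℝ] ℝ} (hτ : ContDiff ℝ 1 τ) {φ : EuclideanSpace ℝ (Fin n) → ℝ}
    (hφ : ContDiff ℝ 1 φ) {x₀ : EuclideanSpace ℝ (Fin n)}
    {r : ℝ} (hr : 0 < r) (hΩ : closedBall x₀ (2 * r) ⊆ Ω)
    (hφs : tsupport φ ⊆ ball x₀ (2 * r)) {m L : ℝ} (hm : 0 ≤ m) (hL : 0 ≤ L)
    (hdφ : ∀ x, ‖fderiv ℝ φ x‖ ≤ m / r)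
    (hLip : ∀ y z, ‖y‖ ≤ R → ‖z‖ ≤ R → ‖τ y - τ z‖ ≤ L * ‖y - z‖)
    (v : Fin (k + 1) → EuclideanSpace ℝ (Fin n)) (hv : ∀ i, ‖v i‖ ≤ 1)
    {θ s₁ s₂ : ℝ} (hθ : n * θ = 1 / 2) (hθ0 : 0 ≤ θ) (hs₁ : 0 < s₁) (hs₂ : 0 < s₂)
    (hs₁' : s₁ ≤ 1) (hs₂' : s₂ ≤ 1) (hs : s₁ + s₂ = 1 + θ) (h₁ : 1 / s₁ ≤ p)
    (hk : 0 < k) (h₂ : k * (1 / s₂) ≤ p) :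
    volume (ball x₀ (2 * r)) *
        ‖∫ x, φ x * (extDeriv τ (f x)).compContinuousLinearMap (g x) v‖ₑ ≤
      (k + 1) * (8 * ENNReal.ofReal (m * L)) *
        (volume (ball (0 : EuclideanSpace ℝ (Fin n)) (4 * r)) ^ (1 - θ) *
          ((∫⁻ x in ball x₀ (2 * r), ‖g x‖ₑ ^ (1 / s₁)) ^ s₁ *
            (∫⁻ x in ball x₀ (2 * r), ‖g x‖ₑ ^ (k * (1 / s₂))) ^ s₂)) := by
  have hp : 1 ≤ p := le_trans (by simp) hkp
  obtain ⟨fj, hfj, hRj, hlim, hlim', H, hH, hHj⟩ :=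
    exists_contDiff_approx hΩo hp hf hR hg h (isCompact_closedBall x₀ (2 * r)) hΩ
  have hd : Continuous fun y => extDeriv τ y :=
    (ContinuousAlternatingMap.alternatizeUncurryFinCLM ℝ V ℝ).continuous.comp
      (hτ.continuous_fderiv one_ne_zero)
  have hI := (tendsto_integral_mul_pullback hd hkp (isCompact_closedBall x₀ (2 * r)) hfj hRj hlim
    hlim' hH hHj hφ.continuous (hφs.trans ball_subset_closedBall) v).2
  have hfj2 : ∀ j, ContDiff ℝ 2 (fj j) := fun j => (hfj j).of_le (by norm_cast)
  -- The approximations obey the same bound `R` as `f`, so the Lipschitz estimate for `τ` on the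
  -- ball of radius `R` applies to their values.
  have hest := fun j => enorm_integral_mul_pullback_extDeriv_le_of_lipschitz (μ := volume) (hfj2 j) hτ hφ
    hr hφs hm hL hdφ (fun x z => hLip _ _ (hRj j x) (hRj j z)) v hv (θ := θ) (by simpa using hθ) hθ0
    hs₁ hs₂ hs₁' hs₂' hs
  simp_rw [← ENNReal.rpow_natCast_mul] at hest
  have : IsFiniteMeasure (volume.restrict (ball x₀ (2 * r))) := ⟨by simpa using measure_ball_lt_top⟩
  have hle : volume.restrict (ball x₀ (2 * r)) ≤ volume.restrict (closedBall x₀ (2 * r)) :=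
    Measure.restrict_mono ball_subset_closedBall le_rfl
  have hDm : ∀ j, AEStronglyMeasurable (fderiv ℝ (fj j)) (volume.restrict (ball x₀ (2 * r))) := fun j =>
    ((hfj2 j).continuous_fderiv two_ne_zero).aestronglyMeasurable
  obtain ⟨f₁, t₁⟩ := tendsto_lintegral_enorm_rpow (ν := volume.restrict (ball x₀ (2 * r)))
    hDm (ae_mono hle hlim') (hH.restrict _) (ae_mono hle hHj) (one_div_pos.2 hs₁) h₁
  obtain ⟨f₂, t₂⟩ := tendsto_lintegral_enorm_rpow (ν := volume.restrict (ball x₀ (2 * r)))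
    hDm (ae_mono hle hlim') (hH.restrict _) (ae_mono hle hHj)
    (mul_pos (Nat.cast_pos.2 hk) (one_div_pos.2 hs₂)) h₂
  have hr₁ := (ENNReal.continuous_rpow_const (y := s₁)).tendsto _ |>.comp t₁
  have hr₂ := (ENNReal.continuous_rpow_const (y := s₂)).tendsto _ |>.comp t₂
  have g₁ := ENNReal.rpow_ne_top_of_nonneg hs₁.le f₁
  have g₂ := ENNReal.rpow_ne_top_of_nonneg hs₂.le f₂
  have hV : volume (ball (0 : EuclideanSpace ℝ (Fin n)) (4 * r)) ≠ ⊤ := measure_ball_lt_top.ne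
  have hV0 : volume (ball (0 : EuclideanSpace ℝ (Fin n)) (4 * r)) ≠ 0 :=
    (measure_ball_pos _ _ (by linarith)).ne'
  refine le_of_tendsto_of_tendsto' (ENNReal.Tendsto.const_mul hI.enorm (Or.inr measure_ball_lt_top.ne))
    (ENNReal.Tendsto.const_mul (ENNReal.Tendsto.const_mul
      (ENNReal.Tendsto.mul hr₁ (Or.inr g₂) hr₂ (Or.inr g₁)) (Or.inr ?_)) (Or.inr ?_)) hest
  · exact ENNReal.rpow_ne_top_of_ne_zero hV0 hV
  · finiteness

end WeakEstimates

/-! ### Compensated bounds for exterior products and exact forms. -/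

section ReverseHolder

open Module Metric Filter

variable {n k l : ℕ} {V : Type*} [NormedAddCommGroup V] [NormedSpace ℝ V] [FiniteDimensional ℝ V]
  {Ω : Set (EuclideanSpace ℝ (Fin n))}

theorem aestronglyMeasurable_pullback {X : Type*} [MeasurableSpace X] {ν : Measure X}
    {α : V → V [⋀^Fin k]→L[ℝ] ℝ} (hα : Continuous α) {f : X → V}
    {g : X → EuclideanSpace ℝ (Fin n) →L[ℝ] V} (hf : AEStronglyMeasurable f ν)
    (hg : AEStronglyMeasurable g ν) :
    AEStronglyMeasurable (fun x => (α (f x)).compContinuousLinearMap (g x)) ν :=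
  continuous_alternating_comp.comp_aestronglyMeasurable
    ((hα.comp_aestronglyMeasurable hf).prodMk hg)

theorem aestronglyMeasurable_altPairing {X : Type*} [MeasurableSpace X] {ν : Measure X}
    (v : Fin k ⊕ Fin l → EuclideanSpace ℝ (Fin n))
    {a : X → EuclideanSpace ℝ (Fin n) [⋀^Fin k]→L[ℝ] ℝ}
    {b : X → EuclideanSpace ℝ (Fin n) [⋀^Fin l]→L[ℝ] ℝ}
    (ha : AEStronglyMeasurable a ν) (hb : AEStronglyMeasurable b ν) :
    AEStronglyMeasurable (fun x => altPairing v (a x) (b x)) ν := by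
  unfold altPairing
  refine Finset.aestronglyMeasurable_fun_sum _ fun σ _ => aestronglyMeasurable_const.mul
    (AEStronglyMeasurable.mul ?_ ?_)
  · exact (ContinuousAlternatingMap.apply ℝ _ ℝ _).continuous.comp_aestronglyMeasurable ha
  · exact (ContinuousAlternatingMap.apply ℝ _ ℝ _).continuous.comp_aestronglyMeasurable hb

theorem exists_norm_pullback_le {α : V → V [⋀^Fin k]→L[ℝ] ℝ} (hα : Continuous α) {X : Type*}
    {f : X → V} {R : ℝ} (hR : ∀ x, ‖f x‖ ≤ R) (g : X → EuclideanSpace ℝ (Fin n) →L[ℝ] V) :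
    ∃ b : ℝ, 0 ≤ b ∧ ∀ x, ‖(α (f x)).compContinuousLinearMap (g x)‖ ≤ b * ‖g x‖ ^ k := by
  obtain ⟨b, hb⟩ := (isCompact_closedBall (0 : V) R).exists_bound_of_continuousOn hα.continuousOn
  refine ⟨|b|, abs_nonneg _, fun x => ?_⟩
  refine (ContinuousAlternatingMap.norm_compContinuousLinearMap_le _ _).trans ?_
  simp only [Fintype.card_fin]
  gcongr
  exact (hb _ (by simpa using hR x)).trans (le_abs_self _)

/-- The coefficients of `α` are bounded on the range of `f`, so the pull-back is `O(|g|^k)`. -/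
theorem memLpLoc_pullback {α : V → V [⋀^Fin k]→L[ℝ] ℝ} (hα : Continuous α) (hk : 0 < k) {p : ℝ}
    {f : EuclideanSpace ℝ (Fin n) → V} {R : ℝ} (hR : ∀ x, ‖f x‖ ≤ R)
    {g : EuclideanSpace ℝ (Fin n) → EuclideanSpace ℝ (Fin n) →L[ℝ] V}
    (hf : MemLpLoc f (ENNReal.ofReal p) Ω) (hg : MemLpLoc g (ENNReal.ofReal p) Ω) :
    MemLpLoc (fun x => (α (f x)).compContinuousLinearMap (g x)) (ENNReal.ofReal (p / k)) Ω := by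
  intro C hC hCc
  obtain ⟨b, hb0, hb⟩ := exists_norm_pullback_le hα hR g
  have h1 := (hg C hC hCc).norm_rpow_div (k : ℝ≥0∞)
  rw [ENNReal.ofReal_div_of_pos (by exact_mod_cast hk), ENNReal.ofReal_natCast]
  refine MemLp.of_le_mul (c := b) h1
    (aestronglyMeasurable_pullback hα (hf C hC hCc).1 (hg C hC hCc).1) (ae_of_all _ fun x => ?_)
  refine (hb x).trans (le_of_eq ?_)
  simp

/-- A locally integrable function whose integrals against test functions are controlled by lower order
integrals of `g`. -/
def HasCompensatedBound (Ω : Set (EuclideanSpace ℝ (Fin n))) (θ p m : ℝ)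
    (g : EuclideanSpace ℝ (Fin n) → EuclideanSpace ℝ (Fin n) →L[ℝ] V)
    (J : EuclideanSpace ℝ (Fin n) → ℝ) : Prop :=
  (∀ C ⊆ Ω, IsCompact C → IntegrableOn J C) ∧
  ∃ c : ℝ≥0∞, c ≠ ⊤ ∧ ∀ (x₀ : EuclideanSpace ℝ (Fin n)) (r : ℝ) (φ : EuclideanSpace ℝ (Fin n) → ℝ),
    0 < r → closedBall x₀ (5 * r) ⊆ Ω → ContDiff ℝ 1 φ → tsupport φ ⊆ ball x₀ (2 * r) →
    (∀ x, |φ x| ≤ 1) → (∀ x, ‖fderiv ℝ φ x‖ ≤ m / r) →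
    volume (ball (0 : EuclideanSpace ℝ (Fin n)) (2 * r)) ^ θ * ‖∫ x, φ x * J x‖ₑ ≤
      c * (∫⁻ x in ball x₀ (4 * r), ‖g x‖ₑ ^ p) ^ (1 + θ)

theorem integrable_mul_of_tsupport_subset {φ J : EuclideanSpace ℝ (Fin n) → ℝ}
    {C : Set (EuclideanSpace ℝ (Fin n))} (hC : MeasurableSet C) (hφ : Continuous φ)
    (hs : tsupport φ ⊆ C) (hφ1 : ∀ x, |φ x| ≤ 1) (hJ : IntegrableOn J C) :
    Integrable fun x => φ x * J x := by
  have h1 : Integrable (C.indicator J) := (integrable_indicator_iff hC).2 hJ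
  have h2 := h1.bdd_mul (c := 1) hφ.aestronglyMeasurable (ae_of_all _ hφ1)
  refine h2.congr (ae_of_all _ fun x => ?_)
  by_cases hx : x ∈ C
  · simp [hx]
  · simp [hx, image_eq_zero_of_notMem_tsupport fun h => hx (hs h)]

variable {θ p m : ℝ} {g : EuclideanSpace ℝ (Fin n) → EuclideanSpace ℝ (Fin n) →L[ℝ] V}

theorem HasCompensatedBound.const_mul {J : EuclideanSpace ℝ (Fin n) → ℝ}
    (h : HasCompensatedBound Ω θ p m g J) (a : ℝ) :
    HasCompensatedBound Ω θ p m g fun x => a * J x := by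
  obtain ⟨h1, c, hc, h2⟩ := h
  refine ⟨fun C hC hCc => (h1 C hC hCc).const_mul a, ‖a‖ₑ * c, by finiteness,
    fun x₀ r φ hr hΩ hφ hs hφ1 hdφ => ?_⟩
  have := h2 x₀ r φ hr hΩ hφ hs hφ1 hdφ
  simp_rw [mul_left_comm _ a, integral_const_mul, enorm_mul]
  rw [mul_left_comm, mul_assoc]
  gcongr

theorem HasCompensatedBound.sum {ι : Type*} {s : Finset ι} {J : ι → EuclideanSpace ℝ (Fin n) → ℝ}
    (h : ∀ i ∈ s, HasCompensatedBound Ω θ p m g (J i)) :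
    HasCompensatedBound Ω θ p m g fun x => ∑ i ∈ s, J i x := by
  classical
  choose! h1 c hc h2 using h
  refine ⟨fun C hC hCc => integrable_finsetSum _ fun i hi => h1 i hi C hC hCc, ∑ i ∈ s, c i,
    ENNReal.sum_ne_top.2 hc, fun x₀ r φ hr hΩ hφ hs hφ1 hdφ => ?_⟩
  simp_rw [Finset.mul_sum]
  have hsub : closedBall x₀ (2 * r) ⊆ Ω := (closedBall_subset_closedBall (by linarith)).trans hΩ
  rw [integral_finsetSum _ fun i hi => integrable_mul_of_tsupport_subset measurableSet_closedBall
    hφ.continuous (hs.trans ball_subset_closedBall) hφ1 (h1 i hi _ hsub (isCompact_closedBall _ _))]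
  rw [Finset.sum_mul]
  refine (mul_le_mul_right (enorm_sum_le _ _) _).trans ?_
  rw [Finset.mul_sum]
  exact Finset.sum_le_sum fun i hi => h2 i hi x₀ r φ hr hΩ hφ hs hφ1 hdφ

theorem HasCompensatedBound.add {J J' : EuclideanSpace ℝ (Fin n) → ℝ}
    (h : HasCompensatedBound Ω θ p m g J) (h' : HasCompensatedBound Ω θ p m g J') :
    HasCompensatedBound Ω θ p m g fun x => J x + J' x := by
  have := HasCompensatedBound.sum (s := Finset.univ) (J := fun b : Bool => if b then J else J')
    (Ω := Ω) (θ := θ) (p := p) (m := m) (g := g) fun b _ => by cases b <;> simpa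
  simpa using this

/-- With `s = k / p`, the `L^{1/s}` norm of a form of size `|u|^k` is the power `s` of the integral
of `|u|^p`. Factors of different degrees thus become powers of one and the same integral. -/
theorem rpow_lintegral_norm_le {W : Type*} [NormedAddCommGroup W] {X : Type*} [MeasurableSpace X]
    {ν : Measure X} {A : X → W} {u : X → V} {b s p : ℝ} (hk : 0 < k) (hb : 0 ≤ b) (hp : 0 < p)
    (hs : s = k / p) (h : ∀ x, ‖A x‖ ≤ b * ‖u x‖ ^ k) :
    (∫⁻ x, ‖A x‖ₑ ^ (1 / s) ∂ν) ^ s ≤ ENNReal.ofReal b * (∫⁻ x, ‖u x‖ₑ ^ p ∂ν) ^ s := by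
  have hk' : (0 : ℝ) < k := by exact_mod_cast hk
  have hs0 : 0 < s := hs ▸ by positivity
  have h1 : ∀ x, ‖A x‖ₑ ^ (1 / s) ≤ ENNReal.ofReal b ^ (1 / s) * ‖u x‖ₑ ^ p := fun x => by
    have : ‖A x‖ₑ ≤ ENNReal.ofReal b * ‖u x‖ₑ ^ k := by
      rw [← ofReal_norm, ← ofReal_norm, ← ENNReal.ofReal_pow (norm_nonneg _), ← ENNReal.ofReal_mul hb]
      exact ENNReal.ofReal_le_ofReal (h x)
    refine (ENNReal.rpow_le_rpow this (by positivity)).trans (le_of_eq ?_)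
    rw [ENNReal.mul_rpow_of_nonneg _ _ (by positivity), ← ENNReal.rpow_natCast_mul]
    congr 2
    rw [hs]; field_simp
  calc _ ≤ (∫⁻ x, ENNReal.ofReal b ^ (1 / s) * ‖u x‖ₑ ^ p ∂ν) ^ s :=
        ENNReal.rpow_le_rpow (lintegral_mono h1) hs0.le
    _ = _ := by
        rw [lintegral_const_mul' _ _ (by finiteness), ENNReal.mul_rpow_of_nonneg _ _ hs0.le,
          ← ENNReal.rpow_mul, one_div_mul_cancel hs0.ne', ENNReal.rpow_one]

theorem rpow_mul_le_of_mul_le {v a b : ℝ≥0∞} (hv : v ≠ 0) (hv' : v ≠ ⊤) {θ : ℝ}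
    (h : v * a ≤ v ^ (1 - θ) * b) : v ^ θ * a ≤ b := by
  have e1 : v ^ θ = v ^ (θ - 1) * v := by
    have := ENNReal.rpow_add (θ - 1) 1 hv hv'
    rwa [ENNReal.rpow_one, sub_add_cancel] at this
  calc v ^ θ * a = v ^ (θ - 1) * (v * a) := by rw [e1, mul_assoc]
    _ ≤ v ^ (θ - 1) * (v ^ (1 - θ) * b) := by gcongr
    _ = b := by rw [← mul_assoc, ← ENNReal.rpow_add _ _ hv hv']; simp

theorem integrableOn_of_norm_le_pow {J : EuclideanSpace ℝ (Fin n) → ℝ} (hn : 0 < n)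
    (hg : MemLpLoc g (ENNReal.ofReal n) Ω)
    (hJ : ∀ C ⊆ Ω, IsCompact C → AEStronglyMeasurable J (volume.restrict C)) {b : ℝ}
    (hb : ∀ x, |J x| ≤ b * ‖g x‖ ^ n) : ∀ C ⊆ Ω, IsCompact C → IntegrableOn J C := by
  intro C hC hCc
  have h1 := hg C hC hCc
  rw [ENNReal.ofReal_natCast] at h1
  exact (h1.integrable_norm_pow hn.ne').const_mul b |>.mono' (hJ C hC hCc) (ae_of_all _ hb)

/-- The exterior product of the pull-backs of two closed forms. -/
theorem hasCompensatedBound_wedge (hΩ : IsOpen Ω) (h : k + l = n) (hk : 0 < k) (hl : 0 < l)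
    {f : EuclideanSpace ℝ (Fin n) → V} {R : ℝ} (hR : ∀ x, ‖f x‖ ≤ R)
    (hf : MemLpLoc f (ENNReal.ofReal n) Ω) (hg : MemLpLoc g (ENNReal.ofReal n) Ω)
    (hfg : HasWeakDeriv Ω f g) {α : V → V [⋀^Fin k]→L[ℝ] ℝ} {β : V → V [⋀^Fin l]→L[ℝ] ℝ}
    (hα : ContDiff ℝ 1 α) (hβ : ContDiff ℝ 1 β)
    (hdα : ∀ᵐ x ∂volume.restrict Ω, (extDeriv α (f x)).compContinuousLinearMap (g x) = 0)
    (hdβ : ∀ᵐ x ∂volume.restrict Ω, (extDeriv β (f x)).compContinuousLinearMap (g x) = 0)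
    (hm : 0 ≤ m) (hθ : n * θ = 1 / 2) (hp : p = n / (1 + θ))
    (v : Fin n → EuclideanSpace ℝ (Fin n)) (hv : ∀ i, ‖v i‖ ≤ 1) :
    HasCompensatedBound Ω θ p m g fun x => wedge h ((α (f x)).compContinuousLinearMap (g x))
      ((β (f x)).compContinuousLinearMap (g x)) v := by
  have hk' : (0 : ℝ) < k := by exact_mod_cast hk
  have hl' : (0 : ℝ) < l := by exact_mod_cast hl
  have hk1 : (1 : ℝ) ≤ k := by exact_mod_cast hk
  have hl1 : (1 : ℝ) ≤ l := by exact_mod_cast hl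
  have hn' : (n : ℝ) = k + l := by exact_mod_cast h.symm
  have hn0 : (0 : ℝ) < n := by linarith
  have hθ0 : 0 < θ := by
    by_contra hc; push Not at hc
    nlinarith
  have hp0 : 0 < p := by rw [hp]; positivity
  obtain ⟨a, ha0, ha⟩ := exists_norm_pullback_le hα.continuous hR g
  obtain ⟨b, hb0, hb⟩ := exists_norm_pullback_le hβ.continuous hR g
  have hMA := memLpLoc_pullback hα.continuous hk hR hf hg
  have hMB := memLpLoc_pullback hβ.continuous hl hR hf hg
  -- Weak closedness needs `k + 1 ≤ n`, that is `l ≥ 1`, and symmetrically `k ≥ 1` for `B`. Here the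
  -- restriction to products of positive degrees in the Künneth ideal is essential.
  have hwA := isWeaklyClosed_pullback hΩ (p := n) (by linarith) (by push_cast; linarith) hf hR hg hfg hα hdα
  have hwB := isWeaklyClosed_pullback hΩ (p := n) (by linarith) (by push_cast; linarith) hf hR hg hfg hβ hdβ
  set A : EuclideanSpace ℝ (Fin n) → EuclideanSpace ℝ (Fin n) [⋀^Fin k]→L[ℝ] ℝ :=
    fun x => (α (f x)).compContinuousLinearMap (g x) with hA
  set B : EuclideanSpace ℝ (Fin n) → EuclideanSpace ℝ (Fin n) [⋀^Fin l]→L[ℝ] ℝ :=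
    fun x => (β (f x)).compContinuousLinearMap (g x) with hB
  set u : Fin k ⊕ Fin l → EuclideanSpace ℝ (Fin n) := fun i => v (finCongr h (finSumFinEquiv i)) with hu
  have hu1 : ∀ i, ‖u i‖ ≤ 1 := fun i => hv _
  have hw : ∀ x, wedge h (A x) (B x) v =
      ((k.factorial * l.factorial : ℕ) : ℝ)⁻¹ * altPairing u (A x) (B x) := fun x => by
    rw [hu, altPairing_eq_wedge, inv_mul_cancel_left₀ (by positivity)]
  change HasCompensatedBound Ω θ p m g fun x => wedge h (A x) (B x) v
  rw [funext hw]
  refine HasCompensatedBound.const_mul ⟨?_, ?_⟩ _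
  · refine integrableOn_of_norm_le_pow (by omega) hg (b := (k + l).factorial * (a * b))
      (fun C hC hCc => ?_) fun x => ?_
    · exact aestronglyMeasurable_altPairing u (hMA C hC hCc).1 (hMB C hC hCc).1
    · refine (abs_altPairing_le u hu1 _ _).trans ?_
      rw [mul_assoc]
      refine mul_le_mul_of_nonneg_left ?_ (by positivity)
      calc ‖A x‖ * ‖B x‖ ≤ (a * ‖g x‖ ^ k) * (b * ‖g x‖ ^ l) :=
            mul_le_mul (ha x) (hb x) (norm_nonneg _) (by positivity)
        _ = a * b * ‖g x‖ ^ (k + l) := by rw [pow_add]; ring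
        _ = a * b * ‖g x‖ ^ n := congrArg (fun j => a * b * ‖g x‖ ^ j) h
  obtain ⟨k, rfl⟩ : ∃ k', k = k' + 1 := ⟨k - 1, by omega⟩
  -- From here on `k + 1` is the original degree `k`. The exponents are `s₁ = (k + 1) / p` and `s₂ =
  -- l / p`, with sum `n / p = 1 + θ`.
  have hs₁ : 0 < ((k + 1 : ℕ) : ℝ) / p := by positivity
  have hs₂ : 0 < (l : ℝ) / p := by positivity
  have hsum : ((k + 1 : ℕ) : ℝ) / p + l / p = 1 + θ := by
    rw [← add_div, ← hn', hp]; field_simp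
  have h1θ : 0 < 1 + θ := by linarith
  -- Hölder's inequality requires `s₁, s₂ ≤ 1`. As both degrees are at most `n - 1`, this is `(n -
  -- 1)(1 + θ) ≤ n`, which holds because `nθ = 1/2`.
  have hle : ∀ t : ℝ, t ≤ n - 1 → t / p ≤ 1 := fun t ht => by
    rw [div_le_one hp0, hp, le_div_iff₀ h1θ]
    nlinarith
  have hpn : p ≤ n := by
    rw [hp, div_le_iff₀ h1θ]; nlinarith
  refine ⟨((k + 1) * (k + 1 + l).factorial : ℕ) * (1 + 4 * ENNReal.ofReal m) *
    (ENNReal.ofReal a * ENNReal.ofReal b), by finiteness, fun x₀ r φ hr hrΩ hφ hs hφ1 hdφ => ?_⟩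
  have hest := enorm_integral_mul_altPairing_le_of_isWeaklyClosed (Q₁ := n / (k + 1 : ℕ)) (Q₂ := n / l)
    (by
      rw [Real.holderConjugate_iff, lt_div_iff₀ hk', inv_div, inv_div, ← add_div, ← hn', div_self hn0.ne']
      exact ⟨by linarith, rfl⟩) hMA hMB hwA hwB hφ hr hrΩ hs hφ1 hm hdφ u hu1 hθ hθ0.le hs₁ hs₂
      (hle _ (by linarith)) (hle _ (by linarith)) hsum (by rw [one_div_div]; gcongr)
      (by rw [one_div_div]; gcongr)
  refine rpow_mul_le_of_mul_le (measure_ball_pos _ _ (by linarith)).ne' measure_ball_lt_top.ne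
    (hest.trans ?_)
  rw [mul_left_comm]
  refine mul_le_mul_right ?_ _
  rw [mul_assoc (_ * _)]
  refine mul_le_mul_right ?_ _
  rw [← hsum, ENNReal.rpow_add_of_nonneg _ _ hs₁.le hs₂.le, mul_mul_mul_comm]
  exact mul_le_mul' (rpow_lintegral_norm_le hk ha0 hp0 rfl ha) (rpow_lintegral_norm_le hl hb0 hp0 rfl hb)

/-- The pull-back of an exact form. -/
theorem hasCompensatedBound_extDeriv (hΩ : IsOpen Ω) (h : k + 1 = n) (hk : 0 < k)
    {f : EuclideanSpace ℝ (Fin n) → V} {R : ℝ} (hR : ∀ x, ‖f x‖ ≤ R)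
    (hf : MemLpLoc f (ENNReal.ofReal n) Ω) (hg : MemLpLoc g (ENNReal.ofReal n) Ω)
    (hfg : HasWeakDeriv Ω f g) {τ : V → V [⋀^Fin k]→L[ℝ] ℝ} (hτ : ContDiff ℝ 1 τ)
    (hm : 0 ≤ m) (hθ : n * θ = 1 / 2) (hp : p = n / (1 + θ))
    (v : Fin (k + 1) → EuclideanSpace ℝ (Fin n)) (hv : ∀ i, ‖v i‖ ≤ 1) :
    HasCompensatedBound Ω θ p m g fun x => (extDeriv τ (f x)).compContinuousLinearMap (g x) v := by
  have hk' : (0 : ℝ) < k := by exact_mod_cast hk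
  have hk1 : (1 : ℝ) ≤ k := by exact_mod_cast hk
  have hn' : (n : ℝ) = k + 1 := by exact_mod_cast h.symm
  have hn0 : (0 : ℝ) < n := by linarith
  have hθ0 : 0 < θ := by
    by_contra hc; push Not at hc
    nlinarith
  have hp0 : 0 < p := by rw [hp]; positivity
  have h1θ : 0 < 1 + θ := by linarith
  have hpn : p ≤ n := by
    rw [hp, div_le_iff₀ h1θ]; nlinarith
  have hd : Continuous fun y => extDeriv τ y :=
    (ContinuousAlternatingMap.alternatizeUncurryFinCLM ℝ V ℝ).continuous.comp
      (hτ.continuous_fderiv one_ne_zero)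
  obtain ⟨a, ha0, ha⟩ := exists_norm_pullback_le hd hR g
  -- `τ` is `C^1`, and the closed ball containing the values of `f` is compact and convex: the mean
  -- value inequality gives a Lipschitz constant there.
  obtain ⟨L, hL0, hL⟩ : ∃ L : ℝ, 0 ≤ L ∧ ∀ y z, ‖y‖ ≤ R → ‖z‖ ≤ R → ‖τ y - τ z‖ ≤ L * ‖y - z‖ := by
    obtain ⟨L, hL⟩ := (isCompact_closedBall (0 : V) R).exists_bound_of_continuousOn
      (hτ.continuous_fderiv one_ne_zero).continuousOn
    refine ⟨|L|, abs_nonneg _, fun y z hy hz => ?_⟩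
    exact (convex_closedBall (0 : V) R).norm_image_sub_le_of_norm_fderiv_le
      (fun x _ => hτ.differentiable one_ne_zero x) (fun x hx => (hL x hx).trans (le_abs_self _))
      (by simpa using hz) (by simpa using hy)
  refine ⟨?_, ?_⟩
  · refine integrableOn_of_norm_le_pow (by omega) hg (b := a) (fun C hC hCc => ?_) fun x => ?_
    · exact (ContinuousAlternatingMap.apply ℝ _ ℝ v).continuous.comp_aestronglyMeasurable
        (aestronglyMeasurable_pullback hd (hf C hC hCc).1 (hg C hC hCc).1)
    · refine (abs_alternating_apply_le hv).trans ((ha x).trans (le_of_eq ?_))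
      exact congrArg (fun j => a * ‖g x‖ ^ j) h
  -- One factor `|g|` comes from the oscillation of the coefficients of `τ`, the other `k = n - 1`
  -- from the pull-back of `τ`; this is the splitting `1 / p + k / p = 1 + θ`.
  have hs₁ : 0 < 1 / p := by positivity
  have hs₂ : 0 < (k : ℝ) / p := by positivity
  have hsum : 1 / p + k / p = 1 + θ := by
    rw [← add_div, add_comm, ← hn', hp]; field_simp
  have hle : ∀ t : ℝ, t ≤ n - 1 → t / p ≤ 1 := fun t ht => by
    rw [div_le_one hp0, hp, le_div_iff₀ h1θ]
    nlinarith
  set c : ℝ≥0∞ := (k + 1) * (8 * ENNReal.ofReal (m * L)) with hc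
  have hcf : c ≠ ⊤ := by finiteness
  refine ⟨c * (2 ^ n) ^ (1 - θ), by
    refine ENNReal.mul_ne_top hcf (ENNReal.rpow_ne_top_of_ne_zero (by simp) (by finiteness)),
    fun x₀ r φ hr hrΩ hφ hs hφ1 hdφ => ?_⟩
  have hest := enorm_integral_mul_pullback_extDeriv_le_of_hasWeakDeriv hΩ (p := n)
    (by rw [h]) hf hR hg hfg hτ hφ hr ((closedBall_subset_closedBall (by linarith)).trans hrΩ) hs hm
    hL0 hdφ hL v hv hθ hθ0.le hs₁ hs₂ (hle _ (by linarith)) (hle _ (by linarith)) hsum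
    (by rw [one_div_one_div]; exact hpn) hk (by rw [one_div_div]; field_simp; exact hpn)
  have hV4 : volume (ball (0 : EuclideanSpace ℝ (Fin n)) (4 * r)) =
      2 ^ n * volume (ball (0 : EuclideanSpace ℝ (Fin n)) (2 * r)) := by
    have := Measure.addHaar_ball_mul_of_pos (volume : Measure (EuclideanSpace ℝ (Fin n))) 0 (r := 2) (by norm_num)
      (2 * r)
    rw [show 4 * r = 2 * (2 * r) by ring, this]
    simp [ENNReal.ofReal_pow]
  rw [Measure.addHaar_ball_center, one_div_one_div, hV4,
    show (k : ℝ) * (1 / (k / p)) = p by field_simp,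
    ← ENNReal.rpow_add_of_nonneg _ _ hs₁.le hs₂.le, hsum] at hest
  refine rpow_mul_le_of_mul_le (measure_ball_pos _ _ (by linarith)).ne' measure_ball_lt_top.ne
    (hest.trans ?_)
  rw [ENNReal.mul_rpow_of_ne_top (by finiteness) measure_ball_lt_top.ne]
  have hmono : (∫⁻ x in ball x₀ (2 * r), ‖g x‖ₑ ^ p) ^ (1 + θ) ≤
      (∫⁻ x in ball x₀ (4 * r), ‖g x‖ₑ ^ p) ^ (1 + θ) :=
    ENNReal.rpow_le_rpow (lintegral_mono_set (ball_subset_ball (by linarith))) h1θ.le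
  calc _ ≤ c * ((2 ^ n) ^ (1 - θ) * volume (ball (0 : EuclideanSpace ℝ (Fin n)) (2 * r)) ^ (1 - θ) *
        (∫⁻ x in ball x₀ (4 * r), ‖g x‖ₑ ^ p) ^ (1 + θ)) := by gcongr
    _ = _ := by ring

end ReverseHolder

/-! ### Gehring's lemma: stopping times and the level set inequality. -/

section Gehring

open Module Metric Filter

variable {E : Type*} [NormedAddCommGroup E] [NormedSpace ℝ E] [FiniteDimensional ℝ E]
  [MeasurableSpace E] [BorelSpace E] {μ : Measure E} [μ.IsAddHaarMeasure]

/-- The stopping time argument behind Gehring's lemma. -/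
theorem exists_stopping_radius {h s : E → ℝ≥0∞} {ρ : ℝ} (hρ : 0 < ρ) {x : E} {t T : ℝ≥0∞}
    (htop : ∀ r, ρ / 32 < r → r ≤ ρ → ∫⁻ y in closedBall x r, h y ∂μ ≤ t * μ (closedBall x r) ∧
      ∫⁻ y in closedBall x r, s y ∂μ ≤ T * μ (closedBall x r))
    (hlim : Tendsto (fun r => (∫⁻ y in closedBall x r, h y ∂μ) / μ (closedBall x r)) (𝓝[>] 0)
      (𝓝 (h x))) (hx : t < h x) :
    ∃ r, 0 < r ∧ 32 * r ≤ ρ ∧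
      ∫⁻ y in closedBall x (32 * r), h y ∂μ ≤ t * μ (closedBall x (32 * r)) ∧
      ∫⁻ y in closedBall x (32 * r), s y ∂μ ≤ T * μ (closedBall x (32 * r)) ∧
      (t * μ (closedBall x r) < ∫⁻ y in closedBall x r, h y ∂μ ∨
        T * μ (closedBall x r) < ∫⁻ y in closedBall x r, s y ∂μ) := by
  classical
  -- The stopping rule at the dyadic radius `ρ / 2^j`: one of the two averages exceeds its
  -- threshold. Lebesgue differentiation makes it happen eventually, and the least such `j` is
  -- taken.
  set P : ℕ → Prop := fun j => t * μ (closedBall x (ρ / 2 ^ j)) < ∫⁻ y in closedBall x (ρ / 2 ^ j), h y ∂μ ∨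
        T * μ (closedBall x (ρ / 2 ^ j)) < ∫⁻ y in closedBall x (ρ / 2 ^ j), s y ∂μ with hP
  have hpos : ∀ j : ℕ, 0 < ρ / 2 ^ j := fun j => by positivity
  have hex : ∃ j, P j := by
    have h1 : Tendsto (fun j : ℕ => ρ / 2 ^ j) atTop (𝓝[>] 0) := by
      refine tendsto_nhdsWithin_iff.2 ⟨?_, Eventually.of_forall hpos⟩
      exact tendsto_const_nhds.div_atTop (tendsto_pow_atTop_atTop_of_one_lt one_lt_two)
    obtain ⟨j, hj⟩ := ((hlim.comp h1).eventually (lt_mem_nhds hx)).exists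
    refine ⟨j, Or.inl ?_⟩
    exact (ENNReal.lt_div_iff_mul_lt (Or.inl (measure_closedBall_pos μ _ (hpos j)).ne')
      (Or.inl measure_closedBall_lt_top.ne)).1 hj
  -- For `j < 5` the radius exceeds `ρ / 32`, where the averages are below the thresholds by
  -- hypothesis. Hence the ball 32 times larger belongs to the earlier index `j - 5`, at which the
  -- rule has not yet fired.
  have h5 : 5 ≤ Nat.find hex := by
    rw [Nat.le_find_iff]
    intro j hj hPj
    have h2 : (2 : ℝ) ^ j < 32 := by
      calc (2 : ℝ) ^ j < 2 ^ 5 := pow_lt_pow_right₀ one_lt_two hj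
        _ = 32 := by norm_num
    have := htop (ρ / 2 ^ j) (div_lt_div_of_pos_left hρ (by positivity) h2)
      (div_le_self hρ.le (one_le_pow₀ one_le_two))
    rcases hPj with h | h
    · exact this.1.not_gt h
    · exact this.2.not_gt h
  set j := Nat.find hex with hj
  have h32 : 32 * (ρ / 2 ^ j) = ρ / 2 ^ (j - 5) := by
    obtain ⟨i, hi⟩ := Nat.exists_eq_add_of_le h5
    rw [hi, pow_add, Nat.add_sub_cancel_left]
    field_simp
    norm_num
  have hnot := Nat.find_min hex (m := j - 5) (by omega)
  simp only [hP, not_or, not_lt] at hnot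
  refine ⟨ρ / 2 ^ j, hpos j, ?_, ?_, ?_, Nat.find_spec hex⟩
  · rw [h32]
    exact div_le_self hρ.le (one_le_pow₀ one_le_two)
  · rw [h32]; exact hnot.1
  · rw [h32]; exact hnot.2

/-- The values of `u` up to `t / 2` contribute at most half of `t μ(B)`, so the values above `t / 2`
carry the other half. -/
theorem mul_measure_le_two_mul_setLIntegral {u : E → ℝ≥0∞} {B : Set E}
    (hB : μ B ≠ ⊤) {t : ℝ≥0∞} (ht : t ≠ ⊤) (h : t * μ B < ∫⁻ y in B, u y ∂μ) :
    t * μ B ≤ 2 * ∫⁻ y in B, {y | t / 2 < u y}.indicator u y ∂μ := by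
  have h1 : ∫⁻ y in B, u y ∂μ ≤
      ∫⁻ y in B, {y | t / 2 < u y}.indicator u y ∂μ + t / 2 * μ B := by
    rw [← setLIntegral_const, ← lintegral_add_right' _ aemeasurable_const]
    refine lintegral_mono fun y => ?_
    by_cases hy : t / 2 < u y
    · simp [hy]
    · simpa [hy] using not_lt.1 hy
  have h2 : t * μ B = t / 2 * μ B + t / 2 * μ B := by rw [← add_mul, ENNReal.add_halves]
  have h3 : t / 2 * μ B ≤ ∫⁻ y in B, {y | t / 2 < u y}.indicator u y ∂μ := by
    refine ENNReal.le_of_add_le_add_right (a := t / 2 * μ B) (by finiteness) ?_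
    rw [← h2]
    exact h.le.trans h1
  rw [h2, two_mul]
  exact add_le_add h3 h3

/-- The level set inequality in Gehring's lemma. -/
theorem lintegral_levelSet_le {h s : E → ℝ≥0∞} (hh : AEMeasurable h μ) (hs : AEMeasurable s μ)
    {q : ℝ} (hq : 1 ≤ q) (hhi : ∫⁻ x, h x ∂μ ≠ ⊤) {ρ : E → ℝ} {D : ℝ} (hD : ∀ x, ρ x ≤ D)
    (hρ : ∀ x, h x ≠ 0 → 0 < ρ x) {c : ℝ≥0∞}
    (hrev : ∀ x r, 0 < r → 32 * r ≤ ρ x → ∫⁻ y in closedBall x (5 * r), h y ^ q ∂μ ≤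
      c * (μ (closedBall x r) ^ (1 - q) * (∫⁻ y in closedBall x (32 * r), h y ∂μ) ^ q +
        ∫⁻ y in closedBall x (32 * r), s y ∂μ))
    {t : ℝ≥0∞} (ht0 : t ≠ 0) (ht : t ≠ ⊤)
    (htop : ∀ x r, ρ x / 32 < r → r ≤ ρ x →
      ∫⁻ y in closedBall x r, h y ∂μ ≤ t * μ (closedBall x r) ∧
      ∫⁻ y in closedBall x r, s y ∂μ ≤ t ^ q * μ (closedBall x r)) :
    ∫⁻ x in {x | t < h x}, h x ^ q ∂μ ≤
      2 * c * (ENNReal.ofReal (32 ^ finrank ℝ E) ^ q + ENNReal.ofReal (32 ^ finrank ℝ E)) *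
        (t ^ (q - 1) * ∫⁻ x in {x | t / 2 < h x}, h x ∂μ + ∫⁻ x in {x | t ^ q / 2 < s x}, s x ∂μ) := by
  have hq0 : 0 < q := by linarith
  have htq : t ^ q ≠ ⊤ := ENNReal.rpow_ne_top_of_nonneg hq0.le ht
  set A : Set E := {x | t < h x ∧
    Tendsto (fun r => (∫⁻ y in closedBall x r, h y ∂μ) / μ (closedBall x r)) (𝓝[>] 0) (𝓝 (h x))}
    with hA
  -- Almost every point of the superlevel set is a Lebesgue point of `h`, so the stopping argument
  -- applies to it.
  have hae : {x | t < h x} ≤ᵐ[μ] A := by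
    filter_upwards [(Besicovitch.vitaliFamily μ).ae_tendsto_lintegral_div hh hhi] with x hx hxt
    exact ⟨hxt, hx.comp (Besicovitch.tendsto_filterAt μ x)⟩
  have hst : ∀ x ∈ A, _ := fun x hx => exists_stopping_radius (hρ x (pos_of_gt hx.1).ne')
    (htop x) hx.2 hx.1
  choose! r hr0 hr32 hrh hrs hrst using hst
  -- Vitali selects disjoint stopping balls whose fivefold enlargements cover. This accounts for the
  -- radius `5r` on the left of the reverse Hölder inequality, as the stopping rule does for `32r`
  -- on the right.
  obtain ⟨u, huA, hud, huc⟩ := Vitali.exists_disjoint_subfamily_covering_enlargement_closedBall A id r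
    D (fun x hx => by have := hr0 x hx; have := hr32 x hx; have := hD x; linarith) 5 (by norm_num)
  simp only [id] at hud huc
  have hucount : u.Countable := hud.countable_of_nonempty_interior fun b hb => by
    refine ⟨b, ?_⟩
    exact interior_mono ball_subset_closedBall (by
      rw [isOpen_ball.interior_eq]; exact mem_ball_self (hr0 b (huA hb)))
  have hAsub : A ⊆ ⋃ b ∈ u, closedBall b (5 * r b) := fun x hx => by
    obtain ⟨b, hb, hsub⟩ := huc x hx
    exact mem_iUnion₂.2 ⟨b, hb, hsub (mem_closedBall_self (hr0 x hx).le)⟩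
  set d := ENNReal.ofReal (32 ^ finrank ℝ E) with hd
  set w : E → ℝ≥0∞ := fun y => t ^ (q - 1) * {y | t / 2 < h y}.indicator h y +
    {y | t ^ q / 2 < s y}.indicator s y with hw
  have hball : ∀ b ∈ u, ∫⁻ y in closedBall b (5 * r b), h y ^ q ∂μ ≤
      2 * c * (d ^ q + d) * ∫⁻ y in closedBall b (r b), w y ∂μ := by
    intro b hb
    have hbA := huA hb
    have hv0 : μ (closedBall b (r b)) ≠ 0 := (measure_closedBall_pos μ _ (hr0 b hbA)).ne'
    have hvt : μ (closedBall b (r b)) ≠ ⊤ := measure_closedBall_lt_top.ne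
    have h32 : μ (closedBall b (32 * r b)) = d * μ (closedBall b (r b)) := by
      rw [Measure.addHaar_closedBall_mul_of_pos μ b (by norm_num : (0 : ℝ) < 32),
        Measure.addHaar_closedBall_center μ b]
    have e1 := hrh b hbA
    have e2 := hrs b hbA
    rw [h32] at e1 e2
    set v := μ (closedBall b (r b)) with hv
    have hd0 : d ≠ ⊤ := ENNReal.ofReal_ne_top
    -- Whichever of the two averages triggered the stop, the large values of that function on the
    -- ball account for its measure.
    have hsel : t ^ q * v ≤ 2 * ∫⁻ y in closedBall b (r b), w y ∂μ := by
      rcases hrst b hbA with h' | h'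
      · have := mul_measure_le_two_mul_setLIntegral hvt ht h'
        calc t ^ q * v = t ^ (q - 1) * (t * v) := by
              have := ENNReal.rpow_add (q - 1) 1 ht0 ht
              rw [ENNReal.rpow_one, sub_add_cancel] at this
              rw [this, mul_assoc]
          _ ≤ t ^ (q - 1) * (2 * ∫⁻ y in closedBall b (r b), {y | t / 2 < h y}.indicator h y ∂μ) := by
              gcongr
          _ = 2 * ∫⁻ y in closedBall b (r b), t ^ (q - 1) * {y | t / 2 < h y}.indicator h y ∂μ := by
              rw [lintegral_const_mul' _ _ (ENNReal.rpow_ne_top_of_ne_zero ht0 ht)]; ring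
          _ ≤ _ := by
              gcongr with y
              exact le_self_add
      · refine (mul_measure_le_two_mul_setLIntegral hvt htq h').trans ?_
        gcongr with y
        exact le_add_self
    calc _ ≤ c * (v ^ (1 - q) * (t * (d * v)) ^ q + t ^ q * (d * v)) := by
          refine (hrev b (r b) (hr0 b hbA) (hr32 b hbA)).trans ?_
          gcongr
      _ = c * ((d ^ q + d) * (t ^ q * v)) := by
          have : v ^ (1 - q) * v ^ q = v := by
            rw [← ENNReal.rpow_add _ _ hv0 hvt]; simp
          rw [ENNReal.mul_rpow_of_nonneg _ _ hq0.le, ENNReal.mul_rpow_of_nonneg _ _ hq0.le]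
          calc c * (v ^ (1 - q) * (t ^ q * (d ^ q * v ^ q)) + t ^ q * (d * v)) =
              c * (d ^ q * (t ^ q * (v ^ (1 - q) * v ^ q)) + d * (t ^ q * v)) := by ring
            _ = _ := by rw [this]; ring
      _ ≤ c * ((d ^ q + d) * (2 * ∫⁻ y in closedBall b (r b), w y ∂μ)) := by gcongr
      _ = _ := by ring
  have hms : ∀ {v : E → ℝ≥0∞} (_ : AEMeasurable v μ) (a : ℝ≥0∞), NullMeasurableSet {x | a < v x} μ :=
    fun hv a => nullMeasurableSet_lt aemeasurable_const hv
  have hind1 : AEMeasurable ({y | t / 2 < h y}.indicator h) μ := hh.indicator₀ (hms hh _)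
  calc _ ≤ ∫⁻ x in A, h x ^ q ∂μ := lintegral_mono' (Measure.restrict_mono_ae hae) le_rfl
    _ ≤ ∫⁻ x in ⋃ b ∈ u, closedBall b (5 * r b), h x ^ q ∂μ := lintegral_mono_set hAsub
    _ ≤ ∑' b : u, ∫⁻ x in closedBall (b : E) (5 * r b), h x ^ q ∂μ := by
        have := hucount.to_subtype
        rw [biUnion_eq_iUnion]
        exact lintegral_iUnion_le _ _
    _ ≤ ∑' b : u, 2 * c * (d ^ q + d) * ∫⁻ y in closedBall (b : E) (r b), w y ∂μ :=
        ENNReal.tsum_le_tsum fun b => hball b b.2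
    -- The selected balls are disjoint, so the sum collapses to one integral.
    _ = 2 * c * (d ^ q + d) * ∫⁻ y in ⋃ b ∈ u, closedBall b (r b), w y ∂μ := by
        rw [ENNReal.tsum_mul_left, lintegral_biUnion hucount (fun _ _ => measurableSet_closedBall) hud]
    _ ≤ 2 * c * (d ^ q + d) * ∫⁻ y, w y ∂μ := by
        gcongr
        exact Measure.restrict_le_self
    _ = _ := by
        rw [hw, lintegral_add_left' (hind1.const_mul _),
          lintegral_const_mul' _ _ (ENNReal.rpow_ne_top_of_ne_zero ht0 ht),
          lintegral_indicator₀ (hms hh _), lintegral_indicator₀ (hms hs _)]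

end Gehring

/-! ### Gehring's lemma: integration over the levels. -/

section LayerCake

open Filter

variable {X : Type*} [MeasurableSpace X] {μ : Measure X}

theorem lintegral_rpow_eq_lintegral_distribution {ν : Measure X} {f : X → ℝ≥0∞} (hf : AEMeasurable f ν)
    (hft : ∀ x, f x ≠ ⊤) {a : ℝ} (ha : 0 < a) :
    ∫⁻ x, f x ^ a ∂ν =
      ENNReal.ofReal a * ∫⁻ t in Ioi (0 : ℝ), ν {x | ENNReal.ofReal t < f x} * ENNReal.ofReal (t ^ (a - 1)) := by
  have h1 := lintegral_rpow_eq_lintegral_meas_lt_mul ν (f := fun x => (f x).toReal)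
    (ae_of_all _ fun x => ENNReal.toReal_nonneg) hf.ennreal_toReal ha
  have h2 : ∀ x, ENNReal.ofReal ((f x).toReal ^ a) = f x ^ a := fun x => by
    rw [← ENNReal.ofReal_rpow_of_nonneg ENNReal.toReal_nonneg ha.le, ENNReal.ofReal_toReal (hft x)]
  simp_rw [h2] at h1
  rw [h1]
  congr 1
  refine setLIntegral_congr_fun measurableSet_Ioi fun t ht => ?_
  have : {x | t < (f x).toReal} = {x | ENNReal.ofReal t < f x} := by
    ext x
    exact (ENNReal.ofReal_lt_iff_lt_toReal (le_of_lt ht) (hft x)).symm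
  rw [this]

theorem measurable_distribution (ν : Measure X) (f : X → ℝ≥0∞) :
    Measurable fun t : ℝ => ν {x | ENNReal.ofReal t < f x} := by
  refine Antitone.measurable fun t t' htt' => measure_mono fun x hx => ?_
  exact (ENNReal.ofReal_le_ofReal htt').trans_lt hx

/-- The self-improving integrability in Gehring's lemma, derived from a level set inequality. -/
theorem lintegral_rpow_ne_top_of_levelSet_le {h s : X → ℝ≥0∞} (hh : AEMeasurable h μ)
    (hs : AEMeasurable s μ) (hst : ∀ x, s x ≠ ⊤) {q δ t₀ : ℝ} (hq : 1 < q) (hδ : 0 < δ)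
    {c : ℝ≥0∞} (hc : c ≠ ⊤) (hhq : ∫⁻ x, h x ^ q ∂μ ≠ ⊤)
    (hlev : ∀ t : ℝ, t₀ ≤ t → 0 < t → ∫⁻ x in {x | ENNReal.ofReal t < h x}, h x ^ q ∂μ ≤
      c * (ENNReal.ofReal t ^ (q - 1) * ∫⁻ x in {x | ENNReal.ofReal t / 2 < h x}, h x ∂μ +
        ∫⁻ x in {x | ENNReal.ofReal t ^ q / 2 < s x}, s x ∂μ))
    (hcδ : c * (ENNReal.ofReal (δ / (q - 1 + δ)) * 2 ^ (q - 1 + δ)) ≤ 2⁻¹)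
    (hsδ : ∫⁻ x, s x ^ (1 + δ / q) ∂μ ≠ ⊤) :
    ∫⁻ x, h x ^ (q + δ) ∂μ ≠ ⊤ := by
  have hq0 : 0 < q := by linarith
  set a := q - 1 + δ with ha
  have ha0 : 0 < a := by linarith
  set ν₀ := μ.withDensity fun x => h x ^ q with hν₀
  set ν₁ := μ.withDensity h with hν₁
  set ν₂ := μ.withDensity s with hν₂
  have hhqm : AEMeasurable (fun x => h x ^ q) μ := hh.pow_const q
  have hac₀ : ν₀ ≪ μ := withDensity_absolutelyContinuous _ _
  have hac₁ : ν₁ ≪ μ := withDensity_absolutelyContinuous _ _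
  have hac₂ : ν₂ ≪ μ := withDensity_absolutelyContinuous _ _
  -- The contributions that do not involve the unknown integral: levels below `t₀`, and the large
  -- values of `s`.
  set A := ∫⁻ _, ENNReal.ofReal (max t₀ 0) ^ δ ∂ν₀ + c * (∫⁻ x, ((2 * s x) ^ (1 / q)) ^ δ ∂ν₂) with hA
  have hAt : A ≠ ⊤ := by
    refine ENNReal.add_ne_top.2 ⟨?_, ENNReal.mul_ne_top hc ?_⟩
    · rw [lintegral_const, hν₀, withDensity_apply _ MeasurableSet.univ, Measure.restrict_univ]
      finiteness
    · rw [hν₂, lintegral_withDensity_eq_lintegral_mul₀ hs (((hs.const_mul 2).pow_const _).pow_const _)]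
      have : ∀ x, (s * fun x => ((2 * s x) ^ (1 / q)) ^ δ) x = 2 ^ (δ / q) * s x ^ (1 + δ / q) := fun x => by
        have hdq : 0 ≤ δ / q := by positivity
        rw [Pi.mul_apply, ← ENNReal.rpow_mul, one_div_mul_eq_div, ENNReal.mul_rpow_of_nonneg _ _ hdq,
          ENNReal.rpow_add_of_nonneg _ _ zero_le_one hdq, ENNReal.rpow_one]
        ring
      simp_rw [this]
      rw [lintegral_const_mul' _ _ (ENNReal.rpow_ne_top_of_nonneg (by positivity) (by simp))]
      exact ENNReal.mul_ne_top (ENNReal.rpow_ne_top_of_nonneg (by positivity) (by simp)) hsδ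
  -- Truncating the extra factor at `N` makes `Φ N` finite, so that a multiple of it may be
  -- absorbed; `N → ∞` at the end.
  set Φ : ℕ → ℝ≥0∞ := fun N => ∫⁻ x, h x ^ q * min (h x) N ^ δ ∂μ with hΦ
  have hmin : ∀ N : ℕ, AEMeasurable (fun x => min (h x) (N : ℝ≥0∞)) μ := fun N => hh.min aemeasurable_const
  have key : ∀ N : ℕ, Φ N ≤ A + 2⁻¹ * Φ N := by
    intro N
    have e0 : Φ N = ENNReal.ofReal δ * ∫⁻ t in Ioi (0 : ℝ), ν₀ {x | ENNReal.ofReal t < min (h x) N} *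
        ENNReal.ofReal (t ^ (δ - 1)) := by
      rw [← lintegral_rpow_eq_lintegral_distribution ((hmin N).mono_ac hac₀)
        (fun x => ((min_le_right _ _).trans_lt (ENNReal.natCast_lt_top N)).ne) hδ, hν₀,
        lintegral_withDensity_eq_lintegral_mul₀ hhqm ((hmin N).pow_const δ)]
      rfl
    have e1 := lintegral_rpow_eq_lintegral_distribution (ν := ν₀)
      (f := fun _ => ENNReal.ofReal (max t₀ 0)) aemeasurable_const (fun _ => ENNReal.ofReal_ne_top) hδ
    have e2 := lintegral_rpow_eq_lintegral_distribution (ν := ν₁) (f := fun x => min (2 * h x) N)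
      (((hh.const_mul 2).min aemeasurable_const).mono_ac hac₁)
      (fun x => ((min_le_right _ _).trans_lt (ENNReal.natCast_lt_top N)).ne) ha0
    have e3 := lintegral_rpow_eq_lintegral_distribution (ν := ν₂) (f := fun x => (2 * s x) ^ (1 / q))
      (((hs.const_mul 2).pow_const _).mono_ac hac₂)
      (fun x => ENNReal.rpow_ne_top_of_nonneg (by positivity)
        (ENNReal.mul_ne_top (by simp) (hst x))) hδ
    set I₁ : ℝ → ℝ≥0∞ := fun t => ν₀ {x | ENNReal.ofReal t < ENNReal.ofReal (max t₀ 0)} *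
      ENNReal.ofReal (t ^ (δ - 1)) with hI₁
    set I₂ : ℝ → ℝ≥0∞ := fun t => ν₁ {x | ENNReal.ofReal t < min (2 * h x) N} *
      ENNReal.ofReal (t ^ (a - 1)) with hI₂
    set I₃ : ℝ → ℝ≥0∞ := fun t => ν₂ {x | ENNReal.ofReal t < (2 * s x) ^ (1 / q)} *
      ENNReal.ofReal (t ^ (δ - 1)) with hI₃
    have hms : ∀ {v : X → ℝ≥0∞} (_ : AEMeasurable v μ) (b : ℝ≥0∞), NullMeasurableSet {x | b < v x} μ :=
      fun hv b => nullMeasurableSet_lt aemeasurable_const hv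
    -- Three ranges of levels: below `t₀` the term `I₁` suffices, between `t₀` and `N` the level set
    -- inequality is used, and from `N` on the truncated superlevel set is empty.
    have hpt : ∀ t ∈ Ioi (0 : ℝ), ν₀ {x | ENNReal.ofReal t < min (h x) N} * ENNReal.ofReal (t ^ (δ - 1)) ≤
        I₁ t + c * (I₂ t + I₃ t) := by
      intro t ht
      have ht' : (0 : ℝ) < t := ht
      rcases lt_or_ge t t₀ with htt | htt
      · refine le_add_right (mul_le_mul_left (measure_mono fun x _ => ?_) _)
        exact (ENNReal.ofReal_lt_ofReal_iff (ht'.trans (htt.trans_le (le_max_left _ _)))).2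
          (htt.trans_le (le_max_left _ _))
      rcases lt_or_ge (ENNReal.ofReal t) (N : ℝ≥0∞) with htN | htN
      · have s0 : {x | ENNReal.ofReal t < min (h x) N} = {x | ENNReal.ofReal t < h x} := by
          ext x; simp [htN]
        have s2 : {x | ENNReal.ofReal t < min (2 * h x) N} = {x | ENNReal.ofReal t / 2 < h x} := by
          ext x
          simp only [mem_ofPred_eq, lt_min_iff, htN, and_true]
          rw [ENNReal.div_lt_iff (by simp) (by simp), mul_comm]
        have s3 : {x | ENNReal.ofReal t < (2 * s x) ^ (1 / q)} = {x | ENNReal.ofReal t ^ q / 2 < s x} := by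
          ext x
          simp only [mem_ofPred_eq]
          rw [ENNReal.div_lt_iff (by simp) (by simp), mul_comm, one_div, ENNReal.lt_rpow_inv_iff hq0]
        have hl := hlev t htt ht'
        rw [s0]
        simp only [hI₂, hI₃, s2, s3]
        rw [hν₀, hν₁, hν₂, withDensity_apply₀ _ ((hms hh _)), withDensity_apply₀ _ ((hms hh _)),
          withDensity_apply₀ _ ((hms hs _))]
        refine le_trans (mul_le_mul_left hl _) (le_trans (le_of_eq ?_) le_add_self)
        have : ENNReal.ofReal (t ^ (a - 1)) = ENNReal.ofReal t ^ (q - 1) * ENNReal.ofReal (t ^ (δ - 1)) := by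
          rw [ENNReal.ofReal_rpow_of_pos ht', ← ENNReal.ofReal_mul (by positivity), ← Real.rpow_add ht']
          congr 2; rw [ha]; ring
        rw [this]; ring
      · have : {x | ENNReal.ofReal t < min (h x) N} = ∅ := by
          ext x
          simp only [mem_ofPred_eq, lt_min_iff, mem_empty_iff_false, iff_false, not_and, not_lt]
          exact fun _ => htN
        rw [this, measure_empty, zero_mul]
        exact zero_le
    have hm1 : Measurable I₁ := (measurable_distribution _ _).mul (by fun_prop)
    have hm2 : Measurable I₂ := (measurable_distribution _ _).mul (by fun_prop)
    -- The layer cake formula on the left has exponent `δ`, while the one for `I₂` has exponent `a =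
    -- q - 1 + δ`. Their quotient `δ / a` is the small factor that permits absorption.
    have hfin : ENNReal.ofReal δ * (∫⁻ t in Ioi (0 : ℝ), I₂ t) ≤
        ENNReal.ofReal (δ / a) * 2 ^ a * Φ N := by
      have h1 : ENNReal.ofReal δ = ENNReal.ofReal (δ / a) * ENNReal.ofReal a := by
        rw [← ENNReal.ofReal_mul (by positivity), div_mul_cancel₀ _ ha0.ne']
      rw [h1, mul_assoc, ← e2, mul_assoc]
      refine mul_le_mul_right ?_ _
      rw [hν₁, lintegral_withDensity_eq_lintegral_mul₀ hh (((hh.const_mul 2).min aemeasurable_const).pow_const a),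
        ← lintegral_const_mul' _ _ (ENNReal.rpow_ne_top_of_nonneg ha0.le (by simp))]
      refine lintegral_mono fun x => ?_
      have h2 : min (2 * h x) N ≤ 2 * min (h x) N := by
        rcases le_total (h x) N with hx | hx
        · rw [min_eq_left hx]; exact min_le_left _ _
        · rw [min_eq_right hx]
          exact (min_le_right _ _).trans (le_mul_of_one_le_left zero_le one_le_two)
      calc h x * min (2 * h x) N ^ a ≤ h x * (2 * min (h x) N) ^ a := by gcongr
        _ = 2 ^ a * (h x * (min (h x) N ^ (q - 1) * min (h x) N ^ δ)) := by
            rw [ENNReal.mul_rpow_of_nonneg _ _ ha0.le, ha,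
              ENNReal.rpow_add_of_nonneg (q - 1) δ (by linarith) hδ.le,
              ENNReal.rpow_add_of_nonneg (q - 1) δ (by linarith) hδ.le]
            ring
        _ ≤ 2 ^ a * (h x * (h x ^ (q - 1) * min (h x) N ^ δ)) := by
            gcongr
            exact min_le_left _ _
        _ = 2 ^ a * (h x ^ q * min (h x) N ^ δ) := by
            have : h x ^ q = h x * h x ^ (q - 1) := by
              conv_lhs => rw [show q = 1 + (q - 1) by ring]
              rw [ENNReal.rpow_add_of_nonneg _ _ zero_le_one (by linarith), ENNReal.rpow_one]
            rw [this, mul_assoc]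
    calc Φ N ≤ ENNReal.ofReal δ * ∫⁻ t in Ioi (0 : ℝ), (I₁ t + c * (I₂ t + I₃ t)) := by
          rw [e0]
          exact mul_le_mul_right (setLIntegral_mono' measurableSet_Ioi hpt) _
      _ = ENNReal.ofReal δ * (∫⁻ t in Ioi (0 : ℝ), I₁ t) +
          c * (ENNReal.ofReal δ * (∫⁻ t in Ioi (0 : ℝ), I₂ t) +
            ENNReal.ofReal δ * (∫⁻ t in Ioi (0 : ℝ), I₃ t)) := by
          rw [lintegral_add_left hm1, lintegral_const_mul' _ _ hc, lintegral_add_left hm2]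
          ring
      _ ≤ ENNReal.ofReal δ * (∫⁻ t in Ioi (0 : ℝ), I₁ t) +
          c * (ENNReal.ofReal (δ / a) * 2 ^ a * Φ N +
            ENNReal.ofReal δ * (∫⁻ t in Ioi (0 : ℝ), I₃ t)) := by gcongr
      _ = A + c * (ENNReal.ofReal (δ / a) * 2 ^ a) * Φ N := by
          rw [← e1, ← e3, hA]; ring
      _ ≤ A + 2⁻¹ * Φ N := by gcongr
  -- Absorption of `Φ N / 2` into the left-hand side, legitimate because `Φ N` is finite.
  have hΦA : ∀ N, Φ N ≤ 2 * A := by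
    intro N
    have hfin : Φ N ≠ ⊤ := by
      refine ((lintegral_mono (g := fun x => h x ^ q * (N : ℝ≥0∞) ^ δ) fun x => ?_).trans_lt ?_).ne
      · exact mul_le_mul_right (ENNReal.rpow_le_rpow (min_le_right _ _) hδ.le) _
      · rw [lintegral_mul_const' _ _ (ENNReal.rpow_ne_top_of_nonneg hδ.le (ENNReal.natCast_ne_top N))]
        exact ENNReal.mul_lt_top hhq.lt_top
          (ENNReal.rpow_lt_top_of_nonneg hδ.le (ENNReal.natCast_ne_top N))
    have h1 : 2⁻¹ * Φ N ≤ A := by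
      refine ENNReal.le_of_add_le_add_right (a := 2⁻¹ * Φ N) (by finiteness) ?_
      rw [← add_mul, ENNReal.inv_two_add_inv_two, one_mul]
      exact key N
    calc Φ N = 2 * (2⁻¹ * Φ N) := by rw [← mul_assoc, ENNReal.mul_inv_cancel (by simp) (by simp), one_mul]
      _ ≤ 2 * A := by gcongr
  have hlim : Tendsto Φ atTop (𝓝 (∫⁻ x, h x ^ (q + δ) ∂μ)) := by
    refine lintegral_tendsto_of_tendsto_of_monotone (fun N => hhqm.mul ((hmin N).pow_const δ))
      (ae_of_all _ fun x N N' hN => ?_) (ae_of_all _ fun x => ?_)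
    · exact mul_le_mul_right
        (ENNReal.rpow_le_rpow (min_le_min_left _ (by exact_mod_cast hN)) hδ.le) _
    · have h1 : Tendsto (fun N : ℕ => min (h x) (N : ℝ≥0∞)) atTop (𝓝 (h x)) := by
        simpa using (tendsto_const_nhds (x := h x)).min ENNReal.tendsto_nat_nhds_top
      have h2 := (ENNReal.continuous_rpow_const (y := δ)).tendsto _ |>.comp h1
      rw [ENNReal.rpow_add_of_nonneg _ _ hq0.le hδ.le]
      refine ENNReal.Tendsto.const_mul h2 ?_
      by_cases hx : h x = ⊤
      · left; simp [hx, hδ]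
      · right; exact ENNReal.rpow_ne_top_of_nonneg hq0.le hx
  exact ((le_of_tendsto' hlim hΦA).trans_lt (ENNReal.mul_lt_top (by simp) hAt.lt_top)).ne

end LayerCake

/-! ### Gehring's lemma: localization. -/

section LocalGehring

open Module Metric Filter

variable {E : Type*} [NormedAddCommGroup E] [NormedSpace ℝ E] [FiniteDimensional ℝ E]
  [MeasurableSpace E] [BorelSpace E] {μ : Measure E} [μ.IsAddHaarMeasure]

/-- The quantity is continuous in `δ` and vanishes at `δ = 0`, because `q - 1 > 0` keeps the
denominator away from zero. -/
theorem exists_small_exponent {q ε : ℝ} (hq : 1 < q) (hε : 0 < ε) {c : ℝ≥0∞} (hc : c ≠ ⊤) :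
    ∃ δ : ℝ, 0 < δ ∧ δ / q ≤ ε ∧
      c * (ENNReal.ofReal (δ / (q - 1 + δ)) * 2 ^ (q - 1 + δ)) ≤ 2⁻¹ := by
  have hq1 : q - 1 + 0 ≠ 0 := by linarith
  have hcont : ContinuousAt (fun δ : ℝ => c.toReal * (δ / (q - 1 + δ) * 2 ^ (q - 1 + δ))) 0 := by
    refine continuousAt_const.mul (ContinuousAt.mul (continuousAt_id.div (by fun_prop) hq1) ?_)
    exact (continuousAt_const (y := (2 : ℝ))).rpow (by fun_prop) (Or.inl two_ne_zero)
  have h1 : ∀ᶠ δ : ℝ in 𝓝 0, c.toReal * (δ / (q - 1 + δ) * 2 ^ (q - 1 + δ)) < 1 / 2 :=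
    hcont.eventually_lt continuousAt_const (by simp)
  have h2 : ∀ᶠ δ : ℝ in 𝓝 0, δ / q < ε := by
    have : ContinuousAt (fun δ : ℝ => δ / q) 0 := by fun_prop
    exact this.eventually_lt continuousAt_const (by simpa)
  have h3 : ∀ᶠ δ : ℝ in 𝓝[>] 0, 0 < δ := self_mem_nhdsWithin
  obtain ⟨δ, ha, hb, hδ⟩ := ((h1.filter_mono nhdsWithin_le_nhds).and
    ((h2.filter_mono nhdsWithin_le_nhds).and h3)).exists
  refine ⟨δ, hδ, hb.le, ?_⟩
  have hpos : 0 < q - 1 + δ := by linarith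
  have h2' : (2 : ℝ≥0∞) ^ (q - 1 + δ) = ENNReal.ofReal (2 ^ (q - 1 + δ)) := by
    rw [← ENNReal.ofReal_rpow_of_pos two_pos]; simp
  calc _ = ENNReal.ofReal (c.toReal * (δ / (q - 1 + δ) * 2 ^ (q - 1 + δ))) := by
        rw [ENNReal.ofReal_mul ENNReal.toReal_nonneg, ENNReal.ofReal_mul (by positivity),
          ENNReal.ofReal_toReal hc, h2']
    _ ≤ ENNReal.ofReal (1 / 2) := ENNReal.ofReal_le_ofReal ha.le
    _ = 2⁻¹ := by simp [ENNReal.ofReal_inv_of_pos]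

theorem ennreal_rpow_le_one_add {a b : ℝ} (ha : 0 ≤ a) (hab : a ≤ b) (x : ℝ≥0∞) : x ^ a ≤ 1 + x ^ b := by
  rcases le_total x 1 with h | h
  · exact (ENNReal.rpow_le_one h ha).trans le_self_add
  · exact (ENNReal.rpow_le_rpow_of_exponent_le h hab).trans le_add_self

/-- Gehring's lemma on a ball, with an exponent that depends only on the constants. -/
theorem lintegral_closedBall_rpow_ne_top {u s : E → ℝ≥0∞} {q δ ε : ℝ} (hq : 1 < q)
    (hδ : 0 < δ) (hδε : δ / q ≤ ε) {c : ℝ≥0∞} (hc : c ≠ ⊤) (hN : finrank ℝ E ≠ 0)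
    (hcδ : 2 * (c * ((2 ^ finrank ℝ E) ^ q * (2 ^ finrank ℝ E) ^ q)) *
      (ENNReal.ofReal (32 ^ finrank ℝ E) ^ q + ENNReal.ofReal (32 ^ finrank ℝ E)) *
      (ENNReal.ofReal (δ / (q - 1 + δ)) * 2 ^ (q - 1 + δ)) ≤ 2⁻¹)
    (hst : ∀ x, s x ≠ ⊤) {x₀ : E} {R : ℝ} (hR : 0 < R)
    (hum : AEMeasurable u (μ.restrict (closedBall x₀ R)))
    (hsm : AEMeasurable s (μ.restrict (closedBall x₀ R)))
    (hu : ∫⁻ x in closedBall x₀ R, u x ^ q ∂μ ≠ ⊤)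
    (hs : ∫⁻ x in closedBall x₀ R, s x ^ (1 + ε) ∂μ ≠ ⊤)
    (hrev : ∀ x r, 0 < r → closedBall x (32 * r) ⊆ closedBall x₀ R →
      ∫⁻ y in closedBall x (5 * r), u y ^ q ∂μ ≤
      c * (μ (closedBall x r) ^ (1 - q) * (∫⁻ y in closedBall x (32 * r), u y ∂μ) ^ q +
        ∫⁻ y in closedBall x (32 * r), s y ∂μ)) :
    ∫⁻ x in closedBall x₀ (R / 2), u x ^ (q + δ) ∂μ ≠ ⊤ := by
  set N := finrank ℝ E with hNdef
  have hq0 : 0 < q := by linarith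
  have : Nontrivial E := nontrivial_of_finrank_pos (Nat.pos_of_ne_zero hN)
  set B := closedBall x₀ R with hB
  set d : E → ℝ := fun x => R - dist x x₀ with hd
  -- The weight is the `N`-th power of the distance to the boundary of the ball. It vanishes
  -- outside, so `h = w u` lives on all of `E`. Its power matches the volume of balls whose radius
  -- is comparable to that distance, which bounds the averages of `h` at large scales.
  set w : E → ℝ≥0∞ := fun x => ENNReal.ofReal (d x) ^ N with hw
  set b : ℝ≥0∞ := ENNReal.ofReal R ^ N with hb
  have hbt : b ≠ ⊤ := by finiteness
  have hwb : ∀ x, w x ≤ b := fun x => by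
    simp only [hw, hb]; gcongr; simp [hd]
  have hwt : ∀ x, w x ≠ ⊤ := fun x => ne_top_of_le_ne_top hbt (hwb x)
  have hwc : Measurable w := by
    have : Continuous d := by fun_prop
    exact (this.measurable.ennreal_ofReal).pow_const N
  have hw0 : ∀ x ∉ B, w x = 0 := fun x hx => by
    have : d x ≤ 0 := by simp only [hB, mem_closedBall, not_le] at hx; simp only [hd]; linarith
    simp [hw, ENNReal.ofReal_of_nonpos this, hN]
  set h : E → ℝ≥0∞ := fun x => w x * u x with hh
  set σ : E → ℝ≥0∞ := fun x => w x ^ q * s x with hσ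
  have hBm : MeasurableSet B := measurableSet_closedBall
  have hBv : μ B ≠ ⊤ := measure_closedBall_lt_top.ne
  have hhm : AEMeasurable h μ := by
    have : h = B.indicator h := by
      ext x; by_cases hx : x ∈ B
      · simp [hx]
      · simp [hx, hh, hw0 x hx]
    rw [this]
    exact (aemeasurable_indicator_iff hBm).2 (hwc.aemeasurable.mul hum)
  have hσm : AEMeasurable σ μ := by
    have : σ = B.indicator σ := by
      ext x; by_cases hx : x ∈ B
      · simp [hx]
      · simp [hx, hσ, hw0 x hx, hq0]
    rw [this]
    exact (aemeasurable_indicator_iff hBm).2 ((hwc.pow_const q).aemeasurable.mul hsm)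
  have hglob : ∀ {v : E → ℝ≥0∞} {a : ℝ}, 0 < a → ∫⁻ x, (w x * v x) ^ a ∂μ ≤
      b ^ a * ∫⁻ x in B, v x ^ a ∂μ := by
    intro v a ha
    rw [← lintegral_const_mul' _ _ (ENNReal.rpow_ne_top_of_nonneg ha.le hbt), ← lintegral_indicator hBm]
    refine lintegral_mono fun x => ?_
    by_cases hx : x ∈ B
    · rw [indicator_of_mem hx, ENNReal.mul_rpow_of_nonneg _ _ ha.le]
      gcongr
      exact hwb x
    · simp [hw0 x hx, hx, ha]
  have hfin : ∀ {v : E → ℝ≥0∞} {a a' : ℝ}, 0 ≤ a → a ≤ a' → ∫⁻ x in B, v x ^ a' ∂μ ≠ ⊤ →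
      ∫⁻ x in B, v x ^ a ∂μ ≠ ⊤ := by
    intro v a a' ha haa hv
    refine ((lintegral_mono fun x => ennreal_rpow_le_one_add ha haa (v x)).trans_lt ?_).ne
    rw [lintegral_add_left measurable_const]
    simp only [lintegral_const, Measure.restrict_apply_univ, one_mul]
    exact ENNReal.add_lt_top.2 ⟨hBv.lt_top, hv.lt_top⟩
  have hU : ∫⁻ x in B, u x ∂μ ≠ ⊤ := by simpa using hfin zero_le_one hq.le hu
  have hε : 0 < ε := lt_of_lt_of_le (by positivity) hδε
  have hS : ∫⁻ x in B, s x ∂μ ≠ ⊤ := by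
    simpa using hfin (a := 1) zero_le_one (by linarith) hs
  have hhi : ∫⁻ x, h x ∂μ ≠ ⊤ := by
    have := hglob (v := u) one_pos
    simp only [ENNReal.rpow_one] at this
    exact ne_top_of_le_ne_top (ENNReal.mul_ne_top hbt hU) this
  have hhq : ∫⁻ x, h x ^ q ∂μ ≠ ⊤ := ne_top_of_le_ne_top
    (ENNReal.mul_ne_top (ENNReal.rpow_ne_top_of_nonneg hq0.le hbt) hu) (hglob hq0)
  -- comparison of the weights at nearby points
  have hdd : ∀ x y, |d y - d x| ≤ dist y x := fun x y => by
    have : d y - d x = dist x x₀ - dist y x₀ := by simp only [hd]; ring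
    rw [this, dist_comm y x]
    exact abs_dist_sub_le x y x₀
  have hnear : ∀ x y, dist y x ≤ d x / 2 → w y ≤ 2 ^ N * w x ∧ w x ≤ 2 ^ N * w y := by
    intro x y hxy
    have h1 := abs_le.1 (hdd x y)
    have h2 : (2 : ℝ≥0∞) = ENNReal.ofReal 2 := by simp
    have h0 : 0 ≤ dist y x := dist_nonneg
    simp only [hw]
    rw [← mul_pow, ← mul_pow, h2, ← ENNReal.ofReal_mul (by norm_num), ← ENNReal.ofReal_mul (by norm_num)]
    constructor <;> gcongr <;> linarith
  have hsubB : ∀ x r, r ≤ d x / 2 → closedBall x r ⊆ B := fun x r hr => by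
    refine fun y hy => ?_
    have h1 := mem_closedBall.1 hy
    have h2 := dist_triangle y x x₀
    have h3 : 0 ≤ dist y x := dist_nonneg
    simp only [hd] at hr
    rw [hB, mem_closedBall]
    linarith
  set ρ : E → ℝ := fun x => d x / 2 with hρ
  -- The weight is taken out of the left-hand side and put back under the integrals on the right;
  -- each passage costs at most `(2^N)^q`.
  set c' := c * ((2 ^ N) ^ q * (2 ^ N) ^ q) with hc'
  have h2N : ((2 : ℝ≥0∞) ^ N) ^ q ≠ ⊤ := ENNReal.rpow_ne_top_of_nonneg hq0.le (by finiteness)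
  have hc't : c' ≠ ⊤ := ENNReal.mul_ne_top hc (ENNReal.mul_ne_top h2N h2N)
  have hwq : ∀ x, w x ^ q ≠ ⊤ := fun x => ENNReal.rpow_ne_top_of_nonneg hq0.le (hwt x)
  have hrev' : ∀ x r, 0 < r → 32 * r ≤ ρ x → ∫⁻ y in closedBall x (5 * r), h y ^ q ∂μ ≤
      c' * (μ (closedBall x r) ^ (1 - q) * (∫⁻ y in closedBall x (32 * r), h y ∂μ) ^ q +
        ∫⁻ y in closedBall x (32 * r), σ y ∂μ) := by
    intro x r hr hrρ
    have hn32 : ∀ y ∈ closedBall x (32 * r), w y ≤ 2 ^ N * w x ∧ w x ≤ 2 ^ N * w y := fun y hy =>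
      hnear x y ((mem_closedBall.1 hy).trans hrρ)
    have i1 : ∫⁻ y in closedBall x (5 * r), h y ^ q ∂μ ≤
        (2 ^ N) ^ q * w x ^ q * ∫⁻ y in closedBall x (5 * r), u y ^ q ∂μ := by
      rw [← lintegral_const_mul' _ _ (ENNReal.mul_ne_top h2N (hwq x))]
      refine setLIntegral_mono' measurableSet_closedBall fun y hy => ?_
      rw [← ENNReal.mul_rpow_of_nonneg _ _ hq0.le, ← ENNReal.mul_rpow_of_nonneg _ _ hq0.le]
      change (w y * u y) ^ q ≤ _
      gcongr
      exact (hn32 y (closedBall_subset_closedBall (by linarith) hy)).1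
    have i2 : w x * ∫⁻ y in closedBall x (32 * r), u y ∂μ ≤
        2 ^ N * ∫⁻ y in closedBall x (32 * r), h y ∂μ := by
      rw [← lintegral_const_mul' _ _ (hwt x), ← lintegral_const_mul' _ _ (by finiteness)]
      refine setLIntegral_mono' measurableSet_closedBall fun y hy => ?_
      rw [hh, ← mul_assoc]
      gcongr
      exact (hn32 y hy).2
    have i3 : w x ^ q * ∫⁻ y in closedBall x (32 * r), s y ∂μ ≤
        (2 ^ N) ^ q * ∫⁻ y in closedBall x (32 * r), σ y ∂μ := by
      rw [← lintegral_const_mul' _ _ (hwq x), ← lintegral_const_mul' _ _ h2N]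
      refine setLIntegral_mono' measurableSet_closedBall fun y hy => ?_
      rw [hσ, ← mul_assoc, ← ENNReal.mul_rpow_of_nonneg _ _ hq0.le]
      gcongr
      exact (hn32 y hy).2
    calc _ ≤ (2 ^ N) ^ q * w x ^ q * (c * (μ (closedBall x r) ^ (1 - q) *
          (∫⁻ y in closedBall x (32 * r), u y ∂μ) ^ q + ∫⁻ y in closedBall x (32 * r), s y ∂μ)) := by
          refine i1.trans ?_
          gcongr
          exact hrev x r hr (hsubB x _ hrρ)
      _ = c * (2 ^ N) ^ q * (μ (closedBall x r) ^ (1 - q) *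
          (w x * ∫⁻ y in closedBall x (32 * r), u y ∂μ) ^ q +
            w x ^ q * ∫⁻ y in closedBall x (32 * r), s y ∂μ) := by
          rw [ENNReal.mul_rpow_of_nonneg _ _ hq0.le]; ring
      _ ≤ c * (2 ^ N) ^ q * (μ (closedBall x r) ^ (1 - q) *
          (2 ^ N * ∫⁻ y in closedBall x (32 * r), h y ∂μ) ^ q +
            (2 ^ N) ^ q * ∫⁻ y in closedBall x (32 * r), σ y ∂μ) := by gcongr
      _ = _ := by
          rw [ENNReal.mul_rpow_of_nonneg _ _ hq0.le, hc']; ring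
  -- large scales
  set V := μ (closedBall (0 : E) 1) with hV
  have hV0 : V ≠ 0 := (measure_closedBall_pos μ _ one_pos).ne'
  have hVt : V ≠ ⊤ := measure_closedBall_lt_top.ne
  -- A radius `r > ρ(x) / 32 = d(x) / 64` gives a ball of volume at least `(d(x) / 64)^N V`, hence
  -- the factor `64^N`.
  have hvol : ∀ x r, ρ x / 32 < r → r ≤ ρ x → 0 < d x ∧ w x ≤ 64 ^ N * V⁻¹ * μ (closedBall x r) := by
    intro x r h1 h2
    have hd0 : 0 < d x := by simp only [hρ] at h1 h2; linarith
    refine ⟨hd0, ?_⟩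
    have hr : 0 < r := by simp only [hρ] at h1; linarith
    rw [Measure.addHaar_closedBall μ x hr.le, ← hNdef, ← Measure.addHaar_closedBall_eq_addHaar_ball μ 0 1, ← hV,
      mul_assoc, mul_comm (V⁻¹), mul_assoc, ENNReal.mul_inv_cancel hV0 hVt, mul_one]
    have h64 : (64 : ℝ≥0∞) = ENNReal.ofReal 64 := by simp
    rw [ENNReal.ofReal_pow hr.le, ← mul_pow, h64, ← ENNReal.ofReal_mul (by norm_num)]
    simp only [hw]
    gcongr
    simp only [hρ] at h1; linarith
  set K₁ := 2 ^ N * (64 ^ N * V⁻¹) * ∫⁻ x in B, u x ∂μ with hK₁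
  set K₂ := (2 ^ N) ^ q * b ^ (q - 1) * (64 ^ N * V⁻¹) * ∫⁻ x in B, s x ∂μ with hK₂
  have hVi : V⁻¹ ≠ ⊤ := ENNReal.inv_ne_top.2 hV0
  have hK₁t : K₁ ≠ ⊤ := by finiteness
  have hbq : b ^ (q - 1) ≠ ⊤ := ENNReal.rpow_ne_top_of_nonneg (by linarith) hbt
  have hK₂t : K₂ ≠ ⊤ := by finiteness
  have hK₂t' : K₂ ^ (1 / q) ≠ ⊤ := ENNReal.rpow_ne_top_of_nonneg (by positivity) hK₂t
  -- At or above this level both averages over balls of radius between `ρ / 32` and `ρ` are below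
  -- their thresholds, which is the starting condition of the stopping argument.
  set t₀ := max K₁.toReal (K₂ ^ (1 / q)).toReal with ht₀
  have htop : ∀ t : ℝ, t₀ ≤ t → ∀ x r, ρ x / 32 < r → r ≤ ρ x →
      ∫⁻ y in closedBall x r, h y ∂μ ≤ ENNReal.ofReal t * μ (closedBall x r) ∧
      ∫⁻ y in closedBall x r, σ y ∂μ ≤ ENNReal.ofReal t ^ q * μ (closedBall x r) := by
    intro t ht x r h1 h2
    obtain ⟨hd0, hwx⟩ := hvol x r h1 h2
    have hkt1 : K₁ ≤ ENNReal.ofReal t := by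
      rw [← ENNReal.ofReal_toReal hK₁t]
      exact ENNReal.ofReal_le_ofReal ((le_max_left _ _).trans ht)
    have hkt2 : K₂ ≤ ENNReal.ofReal t ^ q := by
      rw [← ENNReal.rpow_inv_le_iff hq0, ← one_div, ← ENNReal.ofReal_toReal hK₂t']
      exact ENNReal.ofReal_le_ofReal ((le_max_right _ _).trans ht)
    have hn : ∀ y ∈ closedBall x r, w y ≤ 2 ^ N * w x := fun y hy =>
      (hnear x y ((mem_closedBall.1 hy).trans h2)).1
    have hsub := hsubB x r h2
    constructor
    · calc _ ≤ ∫⁻ y in closedBall x r, 2 ^ N * w x * u y ∂μ := by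
            refine setLIntegral_mono' measurableSet_closedBall fun y hy => ?_
            change w y * u y ≤ _
            gcongr
            exact hn y hy
        _ ≤ 2 ^ N * w x * ∫⁻ y in B, u y ∂μ := by
            have := hwt x
            rw [lintegral_const_mul' _ _ (by finiteness)]
            gcongr
        _ ≤ 2 ^ N * (64 ^ N * V⁻¹ * μ (closedBall x r)) * ∫⁻ y in B, u y ∂μ := by gcongr
        _ = K₁ * μ (closedBall x r) := by rw [hK₁]; ring
        _ ≤ _ := by gcongr
    · have hwx0 : w x ≠ 0 := by simp [hw, hd0]
      calc _ ≤ ∫⁻ y in closedBall x r, (2 ^ N) ^ q * w x ^ q * s y ∂μ := by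
            refine setLIntegral_mono' measurableSet_closedBall fun y hy => ?_
            rw [← ENNReal.mul_rpow_of_nonneg _ _ hq0.le]
            change w y ^ q * s y ≤ _
            gcongr
            exact hn y hy
        _ ≤ (2 ^ N) ^ q * w x ^ q * ∫⁻ y in B, s y ∂μ := by
            rw [lintegral_const_mul' _ _ (ENNReal.mul_ne_top h2N (hwq x))]
            gcongr
        -- One factor `w x` is compared with the volume of the ball; the remaining power `q - 1` is
        -- just bounded by its maximum.
        _ = (2 ^ N) ^ q * (w x ^ (q - 1) * w x) * ∫⁻ y in B, s y ∂μ := by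
            have := ENNReal.rpow_add (q - 1) 1 hwx0 (hwt x)
            rw [ENNReal.rpow_one, sub_add_cancel] at this
            rw [this]
        _ ≤ (2 ^ N) ^ q * (b ^ (q - 1) * (64 ^ N * V⁻¹ * μ (closedBall x r))) * ∫⁻ y in B, s y ∂μ := by
            gcongr
            exact hwb x
        _ = K₂ * μ (closedBall x r) := by rw [hK₂]; ring
        _ ≤ _ := by gcongr
  have hρpos : ∀ x, h x ≠ 0 → 0 < ρ x := fun x hx => by
    by_contra hcon
    refine hx ?_
    have : d x ≤ 0 := by simp only [hρ] at hcon; linarith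
    simp [hh, hw, ENNReal.ofReal_of_nonpos this, hN]
  have hσt : ∀ x, σ x ≠ ⊤ := fun x => ENNReal.mul_ne_top (hwq x) (hst x)
  have hσδ : ∫⁻ x, σ x ^ (1 + δ / q) ∂μ ≠ ⊤ := by
    have ha : 0 < 1 + δ / q := by positivity
    have h1 : ∫⁻ x in B, s x ^ (1 + δ / q) ∂μ ≠ ⊤ := hfin ha.le (by linarith) hs
    refine ne_top_of_le_ne_top (ENNReal.mul_ne_top
      (ENNReal.rpow_ne_top_of_nonneg ha.le (ENNReal.rpow_ne_top_of_nonneg hq0.le hbt)) h1)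
      (b := (b ^ q) ^ (1 + δ / q) * ∫⁻ x in B, s x ^ (1 + δ / q) ∂μ) ?_
    rw [← lintegral_const_mul' _ _ (ENNReal.rpow_ne_top_of_nonneg ha.le
      (ENNReal.rpow_ne_top_of_nonneg hq0.le hbt)), ← lintegral_indicator hBm]
    refine lintegral_mono fun x => ?_
    by_cases hx : x ∈ B
    · rw [indicator_of_mem hx, ← ENNReal.mul_rpow_of_nonneg _ _ ha.le]
      simp only [hσ]
      gcongr
      exact hwb x
    · simp [hσ, hw0 x hx, hx, ha, hq0]
  have hmain := lintegral_rpow_ne_top_of_levelSet_le (t₀ := t₀) hhm hσm hσt hq hδ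
    (c := 2 * c' * (ENNReal.ofReal (32 ^ N) ^ q + ENNReal.ofReal (32 ^ N)))
    (ENNReal.mul_ne_top (ENNReal.mul_ne_top (by simp) hc't)
      (ENNReal.add_ne_top.2 ⟨ENNReal.rpow_ne_top_of_nonneg hq0.le ENNReal.ofReal_ne_top,
        ENNReal.ofReal_ne_top⟩)) hhq
    (fun t ht htpos => lintegral_levelSet_le (D := R) hhm hσm hq.le hhi
      (fun x => by
        have : 0 ≤ dist x x₀ := dist_nonneg
        simp only [hρ, hd]; linarith) hρpos hrev'
      (by simpa using htpos) ENNReal.ofReal_ne_top (htop t ht))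
    hcδ hσδ
  set a := q + δ with ha
  have ha0 : 0 < a := by positivity
  set e : ℝ≥0∞ := ENNReal.ofReal (R / 2) ^ N with he
  have he0 : e ≠ 0 := by simp [he, hR]
  have het : e ≠ ⊤ := by finiteness
  -- On the half ball the weight is at least `(R / 2)^N`, so integrability of `h` passes to `u`
  -- there.
  have hlow : e ^ a * ∫⁻ x in closedBall x₀ (R / 2), u x ^ a ∂μ ≤ ∫⁻ x, h x ^ a ∂μ := by
    rw [← lintegral_const_mul' _ _ (ENNReal.rpow_ne_top_of_nonneg ha0.le het)]
    refine (setLIntegral_mono' (g := fun x => h x ^ a) measurableSet_closedBall fun x hx => ?_).trans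
      (lintegral_mono' Measure.restrict_le_self le_rfl)
    rw [← ENNReal.mul_rpow_of_nonneg _ _ ha0.le]
    simp only [hh, he, hw]
    gcongr
    have := mem_closedBall.1 hx
    simp only [hd]; linarith
  intro htop'
  rw [htop', ENNReal.mul_top (by simp [ENNReal.rpow_eq_zero_iff, he0, het])] at hlow
  exact hmain (top_le_iff.1 hlow)

/-- Gehring's lemma. -/
theorem exists_lintegral_rpow_ne_top {u s : E → ℝ≥0∞} {Ω : Set E} (hΩ : IsOpen Ω) {q ε : ℝ}
    (hq : 1 < q) (hε : 0 < ε) {c : ℝ≥0∞} (hc : c ≠ ⊤) (hN : finrank ℝ E ≠ 0) (hst : ∀ x, s x ≠ ⊤)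
    (hum : ∀ C ⊆ Ω, IsCompact C → AEMeasurable u (μ.restrict C))
    (hsm : ∀ C ⊆ Ω, IsCompact C → AEMeasurable s (μ.restrict C))
    (hu : ∀ C ⊆ Ω, IsCompact C → ∫⁻ x in C, u x ^ q ∂μ ≠ ⊤)
    (hs : ∀ C ⊆ Ω, IsCompact C → ∫⁻ x in C, s x ^ (1 + ε) ∂μ ≠ ⊤)
    (hrev : ∀ x r, 0 < r → closedBall x (32 * r) ⊆ Ω →
      ∫⁻ y in closedBall x (5 * r), u y ^ q ∂μ ≤
      c * (μ (closedBall x r) ^ (1 - q) * (∫⁻ y in closedBall x (32 * r), u y ∂μ) ^ q +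
        ∫⁻ y in closedBall x (32 * r), s y ∂μ)) :
    ∃ δ : ℝ, 0 < δ ∧ ∀ C ⊆ Ω, IsCompact C → ∫⁻ x in C, u x ^ (q + δ) ∂μ ≠ ⊤ := by
  have hq0 : 0 < q := by linarith
  have h2N : ((2 : ℝ≥0∞) ^ finrank ℝ E) ^ q ≠ ⊤ := ENNReal.rpow_ne_top_of_nonneg hq0.le (by finiteness)
  -- The gain `δ` depends only on `q`, `ε`, `c` and the dimension, not on the ball. A finite cover
  -- of a compact set by half balls therefore yields the same `δ`.
  obtain ⟨δ, hδ, hδε, hcδ⟩ := exists_small_exponent hq hε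
    (c := 2 * (c * ((2 ^ finrank ℝ E) ^ q * (2 ^ finrank ℝ E) ^ q)) *
      (ENNReal.ofReal (32 ^ finrank ℝ E) ^ q + ENNReal.ofReal (32 ^ finrank ℝ E)))
    (ENNReal.mul_ne_top (ENNReal.mul_ne_top (by simp) (ENNReal.mul_ne_top hc (ENNReal.mul_ne_top h2N h2N)))
      (ENNReal.add_ne_top.2 ⟨ENNReal.rpow_ne_top_of_nonneg hq0.le ENNReal.ofReal_ne_top,
        ENNReal.ofReal_ne_top⟩))
  refine ⟨δ, hδ, fun C hCΩ hC => ?_⟩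
  refine hC.induction_on (p := fun C => ∫⁻ x in C, u x ^ (q + δ) ∂μ ≠ ⊤) (by simp)
    (fun s t hst ht => ne_top_of_le_ne_top ht (lintegral_mono_set hst))
    (fun s t hs ht => ne_top_of_le_ne_top (ENNReal.add_ne_top.2 ⟨hs, ht⟩) (lintegral_union_le _ _ _))
    fun x hx => ?_
  obtain ⟨R, hR, hRΩ⟩ := nhds_basis_closedBall.mem_iff.1 (hΩ.mem_nhds (hCΩ hx))
  have hcpt := isCompact_closedBall x R
  exact ⟨closedBall x (R / 2), mem_nhdsWithin_of_mem_nhds (closedBall_mem_nhds x (half_pos hR)),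
    lintegral_closedBall_rpow_ne_top hq hδ hδε hc hN hcδ hst hR (hum _ hRΩ hcpt) (hsm _ hRΩ hcpt)
      (hu _ hRΩ hcpt) (hs _ hRΩ hcpt) fun y r hr hsub => hrev y r hr (hsub.trans hRΩ)⟩

end LocalGehring

/-! ### From the compensated bound to higher integrability. -/

section HigherIntegrability

open Module Metric Filter

variable {n : ℕ} {V : Type*} [NormedAddCommGroup V] [NormedSpace ℝ V] [FiniteDimensional ℝ V]
  {Ω : Set (EuclideanSpace ℝ (Fin n))}

/-- Cut-off functions with uniform bounds for the scaled gradient. -/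
theorem exists_cutoff (n : ℕ) : ∃ m : ℝ, 0 ≤ m ∧ ∀ (x₀ : EuclideanSpace ℝ (Fin n)) (r : ℝ), 0 < r →
    ∃ φ : EuclideanSpace ℝ (Fin n) → ℝ, ContDiff ℝ 1 φ ∧ tsupport φ ⊆ ball x₀ (2 * r) ∧
      (∀ x, 0 ≤ φ x) ∧ (∀ x, φ x ≤ 1) ∧ (∀ x ∈ closedBall x₀ r, φ x = 1) ∧
      ∀ x, ‖fderiv ℝ φ x‖ ≤ m / r := by
  -- All cut-offs are rescalings of one bump function. The outer radius `3/2` keeps the closed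
  -- support inside the open ball of radius `2r`.
  set ψ : ContDiffBump (0 : EuclideanSpace ℝ (Fin n)) := ⟨1, 3 / 2, one_pos, by norm_num⟩ with hψ
  have hψc : ContDiff ℝ 1 ψ := ψ.contDiff
  obtain ⟨m, hm⟩ := ((hψc.continuous_fderiv one_ne_zero).norm).bddAbove_range_of_hasCompactSupport
    (ψ.hasCompactSupport.fderiv (𝕜 := ℝ)).norm
  have hm' : ∀ x, ‖fderiv ℝ ψ x‖ ≤ m := fun x => hm ⟨x, rfl⟩
  refine ⟨m, (norm_nonneg _).trans (hm' 0), fun x₀ r hr => ?_⟩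
  have hL : ContDiff ℝ 1 fun x : EuclideanSpace ℝ (Fin n) => r⁻¹ • (x - x₀) := by fun_prop
  have hnorm : ∀ x : EuclideanSpace ℝ (Fin n), ‖r⁻¹ • (x - x₀)‖ = dist x x₀ / r := fun x => by
    rw [norm_smul, norm_inv, Real.norm_eq_abs, abs_of_pos hr, dist_eq_norm, div_eq_inv_mul]
  refine ⟨fun x => ψ (r⁻¹ • (x - x₀)), hψc.comp hL, ?_, fun x => ψ.nonneg, fun x => ψ.le_one, ?_, ?_⟩
  · have : tsupport (fun x => ψ (r⁻¹ • (x - x₀))) ⊆ closedBall x₀ (3 / 2 * r) := by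
      refine closure_minimal (fun x hx => ?_) isClosed_closedBall
      by_contra hcon
      rw [mem_closedBall, not_le] at hcon
      refine hx (ψ.zero_of_le_dist ?_)
      rw [dist_zero_right, hnorm, le_div_iff₀ hr]
      exact hcon.le
    exact this.trans (closedBall_subset_ball (by linarith))
  · intro x hx
    refine ψ.one_of_mem_closedBall ?_
    rw [mem_closedBall_zero_iff, hnorm, div_le_iff₀ hr]
    simpa [hψ] using hx
  · intro x
    have h1 : HasFDerivAt (fun x : EuclideanSpace ℝ (Fin n) => r⁻¹ • (x - x₀))
        (r⁻¹ • ContinuousLinearMap.id ℝ (EuclideanSpace ℝ (Fin n))) x :=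
      ((hasFDerivAt_id x).sub_const x₀).const_smul r⁻¹
    have h2 := ((hψc.differentiable one_ne_zero _).hasFDerivAt.comp x h1).fderiv
    change ‖fderiv ℝ (ψ ∘ fun x => r⁻¹ • (x - x₀)) x‖ ≤ _
    rw [h2, ContinuousLinearMap.comp_smul, ContinuousLinearMap.comp_id, norm_smul, norm_inv,
      Real.norm_eq_abs, abs_of_pos hr, div_eq_inv_mul]
    exact mul_le_mul_of_nonneg_left (hm' _) (by positivity)

theorem lintegral_rpow_enorm_ne_top {W X : Type*} [NormedAddCommGroup W] [MeasurableSpace X]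
    {ν : Measure X} {v : X → W} {a : ℝ} (ha : 0 < a) (hv : MemLp v (ENNReal.ofReal a) ν) :
    ∫⁻ x, ‖v x‖ₑ ^ a ∂ν ≠ ⊤ := by
  have := (eLpNorm_lt_top_iff_lintegral_rpow_enorm_lt_top (by simpa using ha)
    ENNReal.ofReal_ne_top).1 hv.2
  rw [ENNReal.toReal_ofReal ha.le] at this
  exact this.ne

/-- Higher integrability of the derivative from a compensated bound. -/
theorem exists_memLpLoc_of_hasCompensatedBound (hΩ : IsOpen Ω) (hn : 0 < n) {θ p m : ℝ} (hθ : 0 < θ)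
    (hp : p = n / (1 + θ))
    (hm : ∀ (x₀ : EuclideanSpace ℝ (Fin n)) (r : ℝ), 0 < r →
      ∃ φ : EuclideanSpace ℝ (Fin n) → ℝ, ContDiff ℝ 1 φ ∧ tsupport φ ⊆ ball x₀ (2 * r) ∧
      (∀ x, 0 ≤ φ x) ∧ (∀ x, φ x ≤ 1) ∧ (∀ x ∈ closedBall x₀ r, φ x = 1) ∧
      ∀ x, ‖fderiv ℝ φ x‖ ≤ m / r)
    {g : EuclideanSpace ℝ (Fin n) → EuclideanSpace ℝ (Fin n) →L[ℝ] V}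
    (hg : MemLpLoc g (ENNReal.ofReal n) Ω)
    {J S : EuclideanSpace ℝ (Fin n) → ℝ} (hJ : HasCompensatedBound Ω θ p m g J) {ε : ℝ} (hε : 0 < ε)
    (hS : MemLpLoc S (ENNReal.ofReal (1 + ε)) Ω) {c₀ : ℝ} (hc₀ : 0 < c₀)
    (h : ∀ᵐ x ∂volume.restrict Ω, c₀ * ‖g x‖ ^ n ≤ J x + S x) :
    ∃ ε' : ℝ, 0 < ε' ∧ MemLpLoc g (ENNReal.ofReal (n + ε')) Ω := by
  have hn0 : (0 : ℝ) < n := by exact_mod_cast hn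
  have h1θ : 0 < 1 + θ := by linarith
  have hp0 : 0 < p := by rw [hp]; positivity
  have hpq : p * (1 + θ) = n := by rw [hp]; field_simp
  obtain ⟨hJi, c, hc, hJb⟩ := hJ
  have hS1 : ∀ C ⊆ Ω, IsCompact C → IntegrableOn S C := fun C hCΩ hC => by
    have : IsFiniteMeasure (volume.restrict C) := ⟨by simpa using hC.measure_lt_top⟩
    refine memLp_one_iff_integrable.1 ((hS C hCΩ hC).mono_exponent ?_)
    simpa using ENNReal.ofReal_le_ofReal (by linarith : (1 : ℝ) ≤ 1 + ε)
  have hΩm := (ae_restrict_iff' hΩ.measurableSet).1 h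
  -- Gehring's lemma for `u = |g|^p` and `q = 1 + θ`, so that `u^q = |g|^n`.
  obtain ⟨δ, hδ, hδC⟩ := exists_lintegral_rpow_ne_top (μ := volume) (u := fun x => ‖g x‖ₑ ^ p)
    (s := fun x => ‖S x‖ₑ) hΩ (q := 1 + θ) (ε := ε) (by linarith) hε
    (c := (ENNReal.ofReal c₀)⁻¹ * (c + 1))
    (ENNReal.mul_ne_top (by simpa using hc₀) (by finiteness)) (by simpa using hn.ne')
    (fun x => enorm_ne_top) (fun C hCΩ hC => (hg C hCΩ hC).1.enorm.pow_const p)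
    (fun C hCΩ hC => (hS C hCΩ hC).1.enorm)
    (fun C hCΩ hC => by
      simp_rw [← ENNReal.rpow_mul, hpq]
      exact lintegral_rpow_enorm_ne_top hn0 (hg C hCΩ hC))
    (fun C hCΩ hC => lintegral_rpow_enorm_ne_top (by linarith) (hS C hCΩ hC))
    (fun x r hr hsub => by
      -- The cut-off has scale `5r`: it equals `1` on the ball of radius `5r`, and the compensated
      -- bound then needs the ball of radius `25r`, which fits into the one of radius `32r`.
      obtain ⟨φ, hφ, hφs, hφ0, hφ1, hφe, hdφ⟩ := hm x (5 * r) (by positivity)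
      have hφ1' : ∀ x, |φ x| ≤ 1 := fun x => by rw [abs_of_nonneg (hφ0 x)]; exact hφ1 x
      set C := closedBall x (32 * r) with hC
      have hCc : IsCompact C := isCompact_closedBall _ _
      have hφC : tsupport φ ⊆ C := hφs.trans (ball_subset_closedBall.trans
        (closedBall_subset_closedBall (by linarith)))
      have hb := hJb x (5 * r) φ (by positivity)
        ((closedBall_subset_closedBall (by linarith)).trans hsub) hφ hφs hφ1' hdφ
      have hi1 := integrable_mul_of_tsupport_subset hCc.measurableSet hφ.continuous hφC hφ1'
        (hJi C hsub hCc)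
      have hi2 : Integrable fun x => φ x * |S x| := integrable_mul_of_tsupport_subset hCc.measurableSet
        hφ.continuous hφC hφ1' (hS1 C hsub hCc).abs
      set X := ∫⁻ y in C, ‖g y‖ₑ ^ p with hX
      set v := volume (closedBall x r) with hv
      have hv0 : v ≠ 0 := (measure_closedBall_pos _ _ hr).ne'
      have hvt : v ≠ ⊤ := measure_closedBall_lt_top.ne
      have e1 : ‖∫ y, φ y * J y‖ₑ ≤ v ^ (-θ) * (c * X ^ (1 + θ)) := by
        have : v ^ θ * ‖∫ y, φ y * J y‖ₑ ≤ c * X ^ (1 + θ) := by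
          refine le_trans ?_ (hb.trans ?_)
          · refine mul_le_mul_left (ENNReal.rpow_le_rpow ?_ hθ.le) _
            rw [hv, Measure.addHaar_closedBall_center]
            exact measure_mono (closedBall_subset_ball (by linarith))
          · refine mul_le_mul_right (ENNReal.rpow_le_rpow (lintegral_mono_set ?_) h1θ.le) _
            exact ball_subset_closedBall.trans (closedBall_subset_closedBall (by linarith))
        calc ‖∫ y, φ y * J y‖ₑ = v ^ (-θ) * (v ^ θ * ‖∫ y, φ y * J y‖ₑ) := by
              rw [← mul_assoc, ← ENNReal.rpow_add _ _ hv0 hvt]; simp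
          _ ≤ _ := by gcongr
      have e2 : ‖∫ y, φ y * |S y|‖ₑ ≤ ∫⁻ y in C, ‖S y‖ₑ := by
        refine (enorm_integral_le_lintegral_enorm _).trans ?_
        rw [← lintegral_indicator hCc.measurableSet]
        refine lintegral_mono fun y => ?_
        by_cases hy : y ∈ C
        · rw [indicator_of_mem hy, enorm_mul]
          have h1 : ‖φ y‖ₑ ≤ 1 := by
            rw [← ofReal_norm]
            simpa using ENNReal.ofReal_le_ofReal (hφ1' y)
          calc _ ≤ 1 * ‖|S y|‖ₑ := mul_le_mul_left h1 _
            _ = _ := by simp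
        · simp [image_eq_zero_of_notMem_tsupport fun h => hy (hφC h)]
      -- Replacing `S` by `|S|` makes the majorant nonnegative almost everywhere, so that its
      -- Lebesgue integral is an ordinary integral and the signed integral of `φ J` can be used.
      have hpt : ∀ᵐ y, 0 ≤ φ y * J y + φ y * |S y| ∧
          φ y * (c₀ * ‖g y‖ ^ n) ≤ φ y * J y + φ y * |S y| := by
        filter_upwards [hΩm] with y hy
        by_cases hyC : y ∈ C
        · have h1 := hy (hsub hyC)
          have h2 : c₀ * ‖g y‖ ^ n ≤ J y + |S y| := h1.trans (by gcongr; exact le_abs_self _)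
          rw [← mul_add]
          exact ⟨mul_nonneg (hφ0 y) (le_trans (by positivity) h2), mul_le_mul_of_nonneg_left h2 (hφ0 y)⟩
        · simp [image_eq_zero_of_notMem_tsupport fun h => hyC (hφC h)]
      have e3 : ENNReal.ofReal c₀ * ∫⁻ y in closedBall x (5 * r), (‖g y‖ₑ ^ p) ^ (1 + θ) ≤
          ‖∫ y, φ y * J y‖ₑ + ‖∫ y, φ y * |S y|‖ₑ := by
        calc _ ≤ ∫⁻ y, ENNReal.ofReal (φ y * J y + φ y * |S y|) := by
              rw [← lintegral_const_mul' _ _ ENNReal.ofReal_ne_top,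
                ← lintegral_indicator measurableSet_closedBall]
              refine lintegral_mono_ae ?_
              filter_upwards [hpt] with y hy
              by_cases hyB : y ∈ closedBall x (5 * r)
              · rw [indicator_of_mem hyB, ← ENNReal.rpow_mul, hpq, ENNReal.rpow_natCast, ← ofReal_norm,
                  ← ENNReal.ofReal_pow (norm_nonneg _), ← ENNReal.ofReal_mul hc₀.le]
                refine ENNReal.ofReal_le_ofReal ?_
                simpa [hφe y hyB] using hy.2
              · simp [hyB]
          _ = ENNReal.ofReal (∫ y, (φ y * J y + φ y * |S y|)) :=
              (ofReal_integral_eq_lintegral_ofReal (hi1.add hi2) (hpt.mono fun y hy => hy.1)).symm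
          _ ≤ ‖∫ y, (φ y * J y + φ y * |S y|)‖ₑ := by
              rw [← ofReal_norm]
              exact ENNReal.ofReal_le_ofReal (le_abs_self _)
          _ ≤ _ := by
              rw [integral_add hi1 hi2]
              exact enorm_add_le _ _
      have hc0 : ENNReal.ofReal c₀ ≠ 0 := by simpa using hc₀
      calc _ = (ENNReal.ofReal c₀)⁻¹ * (ENNReal.ofReal c₀ *
            ∫⁻ y in closedBall x (5 * r), (‖g y‖ₑ ^ p) ^ (1 + θ)) := by
            rw [← mul_assoc, ENNReal.inv_mul_cancel hc0 ENNReal.ofReal_ne_top, one_mul]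
        _ ≤ (ENNReal.ofReal c₀)⁻¹ * (v ^ (-θ) * (c * X ^ (1 + θ)) + ∫⁻ y in C, ‖S y‖ₑ) :=
            mul_le_mul_right (e3.trans (add_le_add e1 e2)) _
        _ ≤ (ENNReal.ofReal c₀)⁻¹ * ((c + 1) * (v ^ (-θ) * X ^ (1 + θ)) +
              (c + 1) * ∫⁻ y in C, ‖S y‖ₑ) := by
            refine mul_le_mul_right (add_le_add ?_ ?_) _
            · rw [mul_left_comm]
              exact mul_le_mul_left le_self_add _
            · exact le_mul_of_one_le_left zero_le le_add_self
        _ = _ := by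
            rw [show 1 - (1 + θ) = -θ by ring]; ring)
  -- `|g|^p` to the power `q + δ` is `|g|^{n + pδ}`.
  refine ⟨p * δ, by positivity, fun C hCΩ hC => ⟨(hg C hCΩ hC).1, ?_⟩⟩
  have hpos : 0 < n + p * δ := by positivity
  refine (eLpNorm_lt_top_iff_lintegral_rpow_enorm_lt_top (by simpa using hpos)
    ENNReal.ofReal_ne_top).2 ?_
  rw [ENNReal.toReal_ofReal hpos.le, ← hpq, ← mul_add]
  have := hδC C hCΩ hC
  simp_rw [← ENNReal.rpow_mul] at this
  exact this.lt_top

end HigherIntegrability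

/-! ### Morrey's inequality. -/

section Morrey

open Module Metric Filter

variable {E F : Type*} [NormedAddCommGroup E] [NormedSpace ℝ E] [FiniteDimensional ℝ E]
  [MeasurableSpace E] [BorelSpace E] {μ : Measure E} [μ.IsAddHaarMeasure]
  [NormedAddCommGroup F] [NormedSpace ℝ F] [CompleteSpace F]

theorem lintegral_ofReal_rpow_neg_ne_top {a : ℝ} (ha : a < 1) :
    ∫⁻ t in Ioc (0 : ℝ) 1, ENNReal.ofReal t ^ (-a) ≠ ⊤ := by
  have h1 : ∫⁻ t in Ioc (0 : ℝ) 1, ENNReal.ofReal t ^ (-a) =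
      ∫⁻ t in Ioc (0 : ℝ) 1, ENNReal.ofReal (t ^ (-a)) :=
    setLIntegral_congr_fun measurableSet_Ioc fun t ht => ENNReal.ofReal_rpow_of_pos ht.1
  have h2 : IntervalIntegrable (fun t : ℝ => t ^ (-a)) volume 0 1 :=
    intervalIntegral.intervalIntegrable_rpow' (by linarith)
  rw [h1, ← ofReal_integral_eq_lintegral_ofReal]
  · exact ENNReal.ofReal_ne_top
  · exact (intervalIntegrable_iff_integrableOn_Ioc_of_le zero_le_one).1 h2
  · exact (ae_restrict_iff' measurableSet_Ioc).2 (Eventually.of_forall fun t ht =>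
      Real.rpow_nonneg ht.1.le _)

/-- Integrate the derivative along the segments issuing from `x`. For fixed `t` the dilation `y ↦ x
+ t y` costs `t^{-N}` in the integral of the `P`-th power, hence `t^{-N/P}` after Hölder; the
remaining integral in `t` is finite for `P > N`. -/
theorem lintegral_ball_enorm_sub_le {f : E → F} (hf : ContDiff ℝ 1 f) {P : ℝ} (hP : 1 ≤ P) (x : E)
    (ρ : ℝ) :
    ∫⁻ z in ball x ρ, ‖f z - f x‖ₑ ∂μ ≤
      ENNReal.ofReal ρ * (∫⁻ t in Ioc (0 : ℝ) 1, ENNReal.ofReal t ^ (-(finrank ℝ E / P))) *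
        (μ (ball 0 ρ) ^ (1 - 1 / P) * (∫⁻ z in ball x ρ, ‖fderiv ℝ f z‖ₑ ^ P ∂μ) ^ (1 / P)) := by
  have hP0 : 0 < P := by linarith
  have hi0 : 0 ≤ 1 / P := by positivity
  have hi1 : 0 ≤ 1 - 1 / P := by
    rw [sub_nonneg, div_le_one hP0]; exact hP
  set w : E → ℝ≥0∞ := (ball x ρ).indicator fun z => ‖fderiv ℝ f z‖ₑ with hw
  have hwm : Measurable w := (hf.continuous_fderiv one_ne_zero).enorm.measurable.indicator measurableSet_ball
  set M := ∫⁻ z in ball x ρ, ‖fderiv ℝ f z‖ₑ ^ P ∂μ with hM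
  have hwM : ∫⁻ z, w z ^ P ∂μ = M := by
    rw [hM, ← lintegral_indicator measurableSet_ball]
    refine lintegral_congr fun z => ?_
    by_cases hz : z ∈ ball x ρ <;> simp [hw, hz, hP0]
  have hshift : ∫⁻ z in ball x ρ, ‖f z - f x‖ₑ ∂μ = ∫⁻ y in ball (0 : E) ρ, ‖f (x + y) - f x‖ₑ ∂μ := by
    rw [← lintegral_indicator measurableSet_ball, ← lintegral_indicator measurableSet_ball,
      ← lintegral_add_left_eq_self _ x]
    refine lintegral_congr fun y => ?_
    by_cases hy : y ∈ ball (0 : E) ρ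
    · have : x + y ∈ ball x ρ := by simpa using hy
      rw [indicator_of_mem hy, indicator_of_mem this]
    · have : x + y ∉ ball x ρ := by simpa using hy
      rw [indicator_of_notMem hy, indicator_of_notMem this]
  have hslice : ∀ t ∈ Ioc (0 : ℝ) 1, ∫⁻ y in ball (0 : E) ρ, w (x + t • y) ∂μ ≤
      ENNReal.ofReal t ^ (-(finrank ℝ E / P)) * (μ (ball 0 ρ) ^ (1 - 1 / P) * M ^ (1 / P)) := by
    intro t ht
    have h1 := ENNReal.lintegral_mul_norm_pow_le (μ := μ.restrict (ball (0 : E) ρ))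
      (f := fun y => w (x + t • y) ^ P) (g := fun _ => 1)
      ((hwm.comp (by fun_prop)).pow_const P).aemeasurable aemeasurable_const hi0 hi1 (by ring)
    have h2 : ∀ y : E, (w (x + t • y) ^ P) ^ (1 / P) * 1 ^ (1 - 1 / P) = w (x + t • y) := fun y => by
      rw [← ENNReal.rpow_mul, mul_one_div_cancel hP0.ne', ENNReal.rpow_one, ENNReal.one_rpow, mul_one]
    simp_rw [h2] at h1
    rw [lintegral_one, Measure.restrict_apply_univ] at h1
    refine h1.trans ?_
    have h3 : ∫⁻ y in ball (0 : E) ρ, w (x + t • y) ^ P ∂μ ≤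
        ENNReal.ofReal t ^ (-(finrank ℝ E : ℝ)) * M := by
      rw [← hwM, ← lintegral_comp_add_smul (hwm.pow_const P) x ht.1]
      exact lintegral_mono' Measure.restrict_le_self le_rfl
    calc _ ≤ (ENNReal.ofReal t ^ (-(finrank ℝ E : ℝ)) * M) ^ (1 / P) * μ (ball 0 ρ) ^ (1 - 1 / P) := by
          gcongr
      _ = _ := by
          rw [ENNReal.mul_rpow_of_nonneg _ _ hi0, ← ENNReal.rpow_mul,
            show -(finrank ℝ E : ℝ) * (1 / P) = -(finrank ℝ E / P) by ring]
          ring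
  rw [hshift]
  calc _ ≤ ∫⁻ y in ball (0 : E) ρ, (ENNReal.ofReal ρ * ∫⁻ t in Ioc (0 : ℝ) 1, w (x + t • y)) ∂μ := by
        refine setLIntegral_mono' measurableSet_ball fun y hy => ?_
        refine (enorm_add_sub_le_lintegral hf x y).trans (mul_le_mul' ?_ ?_)
        · rw [← ofReal_norm]
          exact ENNReal.ofReal_le_ofReal (mem_ball_zero_iff.1 hy).le
        · refine setLIntegral_mono' measurableSet_Ioc fun t ht => ?_
          rw [hw, indicator_of_mem]
          rw [mem_ball, dist_self_add_left, norm_smul, Real.norm_eq_abs, abs_of_pos ht.1]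
          exact (mul_le_of_le_one_left (norm_nonneg _) ht.2).trans_lt (mem_ball_zero_iff.1 hy)
    _ = ENNReal.ofReal ρ * ∫⁻ y in ball (0 : E) ρ, (∫⁻ t in Ioc (0 : ℝ) 1, w (x + t • y)) ∂μ :=
        lintegral_const_mul' _ _ ENNReal.ofReal_ne_top
    _ = ENNReal.ofReal ρ * ∫⁻ t in Ioc (0 : ℝ) 1, (∫⁻ y in ball (0 : E) ρ, w (x + t • y) ∂μ) := by
        rw [lintegral_lintegral_swap]
        exact (hwm.comp (by fun_prop)).aemeasurable
    _ ≤ ENNReal.ofReal ρ * ∫⁻ t in Ioc (0 : ℝ) 1, ENNReal.ofReal t ^ (-(finrank ℝ E / P)) *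
          (μ (ball 0 ρ) ^ (1 - 1 / P) * M ^ (1 / P)) := by
        exact mul_le_mul_right (setLIntegral_mono' measurableSet_Ioc hslice) _
    _ = _ := by
        rw [lintegral_mul_const _ (by fun_prop), mul_assoc]

variable (μ) in
/-- Morrey's inequality. -/
theorem exists_morrey {P : ℝ} (hP1 : 1 ≤ P) (hP : finrank ℝ E < P) :
    ∃ c : ℝ≥0∞, c ≠ ⊤ ∧ ∀ (f : E → F), ContDiff ℝ 1 f → ∀ (A : Set E) (x x' : E),
      ball x (dist x x') ⊆ A → ball x' (2 * dist x x') ⊆ A →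
      ‖f x - f x'‖ₑ ≤ c * (∫⁻ z in A, ‖fderiv ℝ f z‖ₑ ^ P ∂μ) ^ (1 / P) *
        edist x x' ^ (1 - finrank ℝ E / P) := by
  have hP0 : 0 < P := by linarith
  have hi0 : 0 ≤ 1 / P := by positivity
  have hi1 : 0 ≤ 1 - 1 / P := by
    rw [sub_nonneg, div_le_one hP0]; exact hP1
  set N := finrank ℝ E with hN
  set κ := ∫⁻ t in Ioc (0 : ℝ) 1, ENNReal.ofReal t ^ (-(N / P)) with hκ
  have hκt : κ ≠ ⊤ := lintegral_ofReal_rpow_neg_ne_top ((div_lt_one hP0).2 hP)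
  set V := μ (ball (0 : E) 1) with hV
  have hV0 : V ≠ 0 := (measure_ball_pos μ _ one_pos).ne'
  have hVt : V ≠ ⊤ := measure_ball_lt_top.ne
  set d : ℝ≥0∞ := 2 ^ N with hd
  refine ⟨V ^ (-(1 / P)) * ((1 + 2 * d ^ (1 - 1 / P)) * κ), ENNReal.mul_ne_top
    (ENNReal.rpow_ne_top_of_ne_zero hV0 hVt) (ENNReal.mul_ne_top (ENNReal.add_ne_top.2 ⟨by simp,
      ENNReal.mul_ne_top (by simp) (ENNReal.rpow_ne_top_of_nonneg hi1 (by finiteness))⟩) hκt),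
    fun f hf A x x' hA hA' => ?_⟩
  rcases eq_or_ne x x' with rfl | hne
  · simp
  set ρ := dist x x' with hρ
  have hρ0 : 0 < ρ := dist_pos.2 hne
  set M := ∫⁻ z in A, ‖fderiv ℝ f z‖ₑ ^ P ∂μ with hM
  set v := μ (ball (0 : E) ρ) with hv
  have hv0 : v ≠ 0 := (measure_ball_pos μ _ hρ0).ne'
  have hvt : v ≠ ⊤ := measure_ball_lt_top.ne
  have hv2 : μ (ball (0 : E) (2 * ρ)) = d * v := by
    rw [Measure.addHaar_ball_mul_of_pos μ (0 : E) two_pos ρ]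
    rw [hd, ENNReal.ofReal_pow two_pos.le, ENNReal.ofReal_ofNat]
  have e1 : ∫⁻ z in ball x ρ, ‖f z - f x‖ₑ ∂μ ≤ ENNReal.ofReal ρ * κ * (v ^ (1 - 1 / P) * M ^ (1 / P)) := by
    refine (lintegral_ball_enorm_sub_le hf hP1 x ρ).trans ?_
    gcongr
    exact lintegral_mono_set hA
  -- The ball about `x` of radius `ρ` lies in the ball about `x'` of radius `2ρ`, to which the
  -- one-point estimate applies.
  have e2 : ∫⁻ z in ball x ρ, ‖f z - f x'‖ₑ ∂μ ≤
      2 * d ^ (1 - 1 / P) * (ENNReal.ofReal ρ * κ * (v ^ (1 - 1 / P) * M ^ (1 / P))) := by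
    have hsub : ball x ρ ⊆ ball x' (2 * ρ) := ball_subset_ball' (by rw [← hρ]; linarith)
    refine (lintegral_mono_set hsub).trans ((lintegral_ball_enorm_sub_le hf hP1 x' (2 * ρ)).trans ?_)
    rw [hv2, ENNReal.mul_rpow_of_nonneg _ _ hi1, ENNReal.ofReal_mul two_pos.le, ENNReal.ofReal_ofNat]
    calc _ ≤ 2 * ENNReal.ofReal ρ * κ * (d ^ (1 - 1 / P) * v ^ (1 - 1 / P) * M ^ (1 / P)) := by
          gcongr
          exact lintegral_mono_set hA'
      _ = _ := by ring
  -- The triangle inequality through an intermediate point `z`, averaged over `z` in the ball about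
  -- `x`.
  have e3 : v * ‖f x - f x'‖ₑ ≤
      v ^ (1 - 1 / P) * ((1 + 2 * d ^ (1 - 1 / P)) * κ * (ENNReal.ofReal ρ * M ^ (1 / P))) := by
    calc v * ‖f x - f x'‖ₑ = ∫⁻ _ in ball x ρ, ‖f x - f x'‖ₑ ∂μ := by
          rw [setLIntegral_const, Measure.addHaar_ball_center, mul_comm]
      _ ≤ ∫⁻ z in ball x ρ, (‖f z - f x‖ₑ + ‖f z - f x'‖ₑ) ∂μ := by
          refine lintegral_mono fun z => ?_
          have : f x - f x' = (f z - f x') - (f z - f x) := by abel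
          rw [this, add_comm]
          exact enorm_sub_le
      _ = ∫⁻ z in ball x ρ, ‖f z - f x‖ₑ ∂μ + ∫⁻ z in ball x ρ, ‖f z - f x'‖ₑ ∂μ :=
          lintegral_add_left (hf.continuous.sub continuous_const).enorm.measurable _
      _ ≤ _ := by
          refine (add_le_add e1 e2).trans (le_of_eq ?_)
          ring
  have e4 := rpow_mul_le_of_mul_le hv0 hvt e3
  have hvρ : v ^ (1 / P) = ENNReal.ofReal ρ ^ (N / P) * V ^ (1 / P) := by
    rw [hv, Measure.addHaar_ball_of_pos μ 0 hρ0, ENNReal.mul_rpow_of_nonneg _ _ hi0,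
      ENNReal.ofReal_pow hρ0.le, ← ENNReal.rpow_natCast_mul]
    congr 2
    rw [hN]; ring
  have hr0 : ENNReal.ofReal ρ ≠ 0 := by simpa using hρ0
  have hrt : ENNReal.ofReal ρ ≠ ⊤ := ENNReal.ofReal_ne_top
  rw [edist_dist, ← hρ]
  calc ‖f x - f x'‖ₑ = V ^ (-(1 / P)) * ENNReal.ofReal ρ ^ (-(N / P)) *
        (v ^ (1 / P) * ‖f x - f x'‖ₑ) := by
        rw [hvρ]
        have i1 : V ^ (-(1 / P)) * V ^ (1 / P) = 1 := by
          rw [← ENNReal.rpow_add _ _ hV0 hVt]; simp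
        have i2 : ENNReal.ofReal ρ ^ (-(N / P)) * ENNReal.ofReal ρ ^ (N / P) = 1 := by
          rw [← ENNReal.rpow_add _ _ hr0 hrt]; simp
        calc ‖f x - f x'‖ₑ = (V ^ (-(1 / P)) * V ^ (1 / P)) *
              (ENNReal.ofReal ρ ^ (-(N / P)) * ENNReal.ofReal ρ ^ (N / P)) * ‖f x - f x'‖ₑ := by
              rw [i1, i2]; simp
          _ = _ := by ring
    _ ≤ V ^ (-(1 / P)) * ENNReal.ofReal ρ ^ (-(N / P)) *
        ((1 + 2 * d ^ (1 - 1 / P)) * κ * (ENNReal.ofReal ρ * M ^ (1 / P))) := by gcongr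
    _ = _ := by
        have : ENNReal.ofReal ρ ^ (1 - N / P) = ENNReal.ofReal ρ * ENNReal.ofReal ρ ^ (-(N / P)) := by
          rw [sub_eq_add_neg, ENNReal.rpow_add _ _ hr0 hrt, ENNReal.rpow_one]
        rw [this]; ring

end Morrey

/-! ### Local Hölder representatives. -/

section LocalContinuity

open Module Metric Filter

variable {n : ℕ} {V : Type*} [NormedAddCommGroup V] [NormedSpace ℝ V] [FiniteDimensional ℝ V]
  {Ω : Set (EuclideanSpace ℝ (Fin n))}

/-- A sequence of uniformly Hölder continuous functions that converges almost everywhere has a Hölder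
continuous limit. -/
theorem exists_holderOnWith_of_tendsto_ae {X Y : Type*} [PseudoMetricSpace X] [MeasurableSpace X]
    [MetricSpace Y] [CompleteSpace Y] {ν : Measure X} [ν.IsOpenPosMeasure] {U : Set X} (hU : IsOpen U)
    {fj : ℕ → X → Y} {f : X → Y} {c γ : NNReal} (hγ : 0 < γ) (hfj : ∀ j, HolderOnWith c γ (fj j) U)
    (hlim : ∀ᵐ x ∂ν, x ∈ U → Tendsto (fun j => fj j x) atTop (𝓝 (f x))) :
    ∃ h : X → Y, HolderOnWith c γ h U ∧ ∀ᵐ x ∂ν, x ∈ U → h x = f x := by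
  -- Convergence holds on a dense set, since nonempty open sets have positive measure; the uniform
  -- Hölder bound extends the Cauchy property to every point of `U`.
  have hconv : ∀ x ∈ U, ∃ y, Tendsto (fun j => fj j x) atTop (𝓝 y) := by
    intro x hx
    refine cauchySeq_tendsto_of_complete (EMetric.cauchySeq_iff.2 fun ε hε => ?_)
    have hε3 : 0 < ε / 3 := ENNReal.div_pos hε.ne' (by simp)
    have hcont : Tendsto (fun y => (c : ℝ≥0∞) * edist x y ^ (γ : ℝ)) (𝓝 x) (𝓝 0) := by
      have h1 : Tendsto (fun y => edist x y) (𝓝 x) (𝓝 0) := by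
        have : Continuous fun y => edist x y := by fun_prop
        simpa using this.tendsto x
      have h2 := ((ENNReal.continuous_rpow_const (y := (γ : ℝ))).tendsto 0).comp h1
      have h3 := ENNReal.Tendsto.const_mul (a := (c : ℝ≥0∞)) h2 (Or.inr ENNReal.coe_ne_top)
      have h4 : (c : ℝ≥0∞) * 0 ^ (γ : ℝ) = 0 := by
        rw [ENNReal.zero_rpow_of_pos (by exact_mod_cast hγ), mul_zero]
      rw [h4] at h3
      exact h3
    have hev : ∀ᶠ y in 𝓝 x, y ∈ U ∧ (c : ℝ≥0∞) * edist x y ^ (γ : ℝ) < ε / 3 :=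
      (show ∀ᶠ y in 𝓝 x, y ∈ U from hU.mem_nhds hx).and (hcont.eventually (gt_mem_nhds hε3))
    obtain ⟨y, ⟨hyU, hyc⟩, hy⟩ : ∃ y, (y ∈ U ∧ (c : ℝ≥0∞) * edist x y ^ (γ : ℝ) < ε / 3) ∧
        (y ∈ U → Tendsto (fun j => fj j y) atTop (𝓝 (f y))) :=
      (ν.dense_of_ae hlim).inter_nhds_nonempty hev |>.imp fun y hy => ⟨hy.2, hy.1⟩
    obtain ⟨N, hN⟩ := EMetric.cauchySeq_iff.1 (hy hyU).cauchySeq (ε / 3) hε3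
    refine ⟨N, fun i hi j hj => ?_⟩
    have h1 : edist (fj i x) (fj i y) < ε / 3 := (hfj i x hx y hyU).trans_lt hyc
    have h2 : edist (fj j y) (fj j x) < ε / 3 := by
      rw [edist_comm]; exact (hfj j x hx y hyU).trans_lt hyc
    calc edist (fj i x) (fj j x) ≤ edist (fj i x) (fj i y) + edist (fj i y) (fj j y) +
          edist (fj j y) (fj j x) := edist_triangle4 _ _ _ _
      _ < ε / 3 + ε / 3 + ε / 3 := ENNReal.add_lt_add (ENNReal.add_lt_add h1 (hN i hi j hj)) h2
      _ = ε := ENNReal.add_thirds ε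
  rcases isEmpty_or_nonempty Y with hY | hY
  · exact ⟨f, fun x => hY.elim (f x), ae_of_all _ fun x => hY.elim (f x)⟩
  choose! h hh using hconv
  refine ⟨h, fun x hx y hy => ?_, ?_⟩
  · exact le_of_tendsto ((hh x hx).edist (hh y hy)) (Eventually.of_forall fun j => hfj j x hx y hy)
  · filter_upwards [hlim] with x hx hxU
    exact tendsto_nhds_unique (hh x hxU) (hx hxU)

/-- Local continuity of bounded Sobolev functions with a supercritical exponent. -/
theorem exists_continuousOn_of_memLpLoc (hΩ : IsOpen Ω) {f : EuclideanSpace ℝ (Fin n) → V}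
    {g : EuclideanSpace ℝ (Fin n) → EuclideanSpace ℝ (Fin n) →L[ℝ] V} {P R : ℝ} (hP1 : 1 ≤ P)
    (hP : n < P) (hf : MemLpLoc f (ENNReal.ofReal P) Ω) (hR : ∀ x, ‖f x‖ ≤ R)
    (hg : MemLpLoc g (ENNReal.ofReal P) Ω) (h : HasWeakDeriv Ω f g)
    {x₀ : EuclideanSpace ℝ (Fin n)} (hx₀ : x₀ ∈ Ω) :
    ∃ U, IsOpen U ∧ x₀ ∈ U ∧ U ⊆ Ω ∧ ∃ f' : EuclideanSpace ℝ (Fin n) → V, ContinuousOn f' U ∧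
      ∀ᵐ x, x ∈ U → f' x = f x := by
  have hP0 : 0 < P := by linarith
  obtain ⟨r', hr', hr'Ω⟩ := nhds_basis_closedBall.mem_iff.1 (hΩ.mem_nhds hx₀)
  -- Two points of the ball of radius `r` are less than `2r` apart, so the ball in Morrey's
  -- inequality of radius `2 dist x x' < 4r` about `x'` stays within `5r = r'` of `x₀`.
  set r := r' / 5 with hr
  have hr0 : 0 < r := by positivity
  set C := closedBall x₀ r' with hC
  have hCc : IsCompact C := isCompact_closedBall _ _
  obtain ⟨fj, hfj, -, hlim, -, H, hH, hHj⟩ := exists_contDiff_approx hΩ hP1 hf hR hg h hCc hr'Ω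
  obtain ⟨c, hc, hmor⟩ := exists_morrey (E := EuclideanSpace ℝ (Fin n)) (F := V) volume hP1
    (by simpa using hP)
  set M := ∫⁻ x in C, ‖H x‖ₑ ^ P with hM
  have hMt : M ≠ ⊤ := lintegral_rpow_enorm_ne_top hP0 (hH.restrict C)
  have hMj : ∀ j, ∫⁻ x in C, ‖fderiv ℝ (fj j) x‖ₑ ^ P ≤ M := fun j => by
    refine lintegral_mono_ae ?_
    filter_upwards [hHj] with x hx
    exact ENNReal.rpow_le_rpow (enorm_le_iff_norm_le.2 ((hx j).trans (le_abs_self _))) hP0.le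
  have hUC : ball x₀ r ⊆ C := ball_subset_closedBall.trans (closedBall_subset_closedBall (by linarith))
  have hγ : 0 < 1 - n / P := by
    rw [sub_pos, div_lt_one hP0]; exact hP
  have hcM : c * M ^ (1 / P) ≠ ⊤ := ENNReal.mul_ne_top hc (ENNReal.rpow_ne_top_of_nonneg (by positivity) hMt)
  have hhol : ∀ j, HolderOnWith (c * M ^ (1 / P)).toNNReal (1 - n / P).toNNReal (fj j) (ball x₀ r) := by
    intro j x hx x' hx'
    rw [mem_ball] at hx hx'
    have hd : dist x x' < 2 * r := by
      have := dist_triangle_right x x' x₀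
      linarith
    rw [ENNReal.coe_toNNReal hcM, Real.coe_toNNReal _ hγ.le, edist_eq_enorm_sub]
    refine (hmor (fj j) ((hfj j).of_le (by simp)) C x x' ?_ ?_).trans ?_
    · exact (ball_subset_ball' (by linarith)).trans (ball_subset_closedBall (ε := r') (x := x₀))
    · exact (ball_subset_ball' (by linarith)).trans (ball_subset_closedBall (ε := r') (x := x₀))
    · simp only [finrank_euclideanSpace, Fintype.card_fin]
      gcongr
      exact hMj j
  obtain ⟨f', hf', hae⟩ := exists_holderOnWith_of_tendsto_ae (ν := volume) isOpen_ball
    (by simpa using hγ) hhol (f := f) (by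
      filter_upwards [(ae_restrict_iff' hCc.measurableSet).1 hlim] with x hx hxU
      exact hx (hUC hxU))
  exact ⟨ball x₀ r, isOpen_ball, mem_ball_self hr0, hUC.trans hr'Ω, f',
    hf'.continuousOn (by simpa using hγ), hae⟩

end LocalContinuity

/-! ### Forms in charts and restrictions of ambient forms. -/

section Charts

open Module Metric Filter

variable {m l k : ℕ} {M : Type*} [TopologicalSpace M] [ChartedSpace (EuclideanSpace ℝ (Fin m)) M]
  [IsManifold (𝓡 m) ∞ M] {ι : M → EuclideanSpace ℝ (Fin l)}

theorem mdifferentiableAt_extChartAt_symm_of_mem {x₀ : M} {y : EuclideanSpace ℝ (Fin m)}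
    (hy : y ∈ (extChartAt (𝓡 m) x₀).target) :
    MDifferentiableAt 𝓘(ℝ, EuclideanSpace ℝ (Fin m)) (𝓡 m) (extChartAt (𝓡 m) x₀).symm y := by
  have : IsManifold (𝓡 m) 1 M := IsManifold.of_le (n := ∞) (by simp)
  have h := mdifferentiableWithinAt_extChartAt_symm hy
  rwa [ModelWithCorners.range_eq_univ, mdifferentiableWithinAt_univ] at h

theorem mdifferentiableAt_extChartAt_of_mem {x₀ x : M} (hx : x ∈ (extChartAt (𝓡 m) x₀).source) :
    MDifferentiableAt (𝓡 m) 𝓘(ℝ, EuclideanSpace ℝ (Fin m)) (extChartAt (𝓡 m) x₀) x := by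
  have : IsManifold (𝓡 m) 1 M := IsManifold.of_le (n := ∞) (by simp)
  exact mdifferentiableAt_extChartAt (by rwa [← extChartAt_source (𝓡 m)])

/-- The derivatives of a chart and of its inverse cancel, so a form is recovered from its expression
in any chart around the point. -/
theorem chartForm_comp_mfderiv (α : DForm m M k) {x₀ x : M} (hx : x ∈ (extChartAt (𝓡 m) x₀).source) :
    (chartForm α x₀ (extChartAt (𝓡 m) x₀ x)).compContinuousLinearMap
      (mfderiv (𝓡 m) 𝓘(ℝ, EuclideanSpace ℝ (Fin m)) (extChartAt (𝓡 m) x₀) x) = α x := by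
  have : IsManifold (𝓡 m) 1 M := IsManifold.of_le (n := ∞) (by simp)
  obtain ⟨y, hy, rfl⟩ : ∃ y ∈ (extChartAt (𝓡 m) x₀).target, (extChartAt (𝓡 m) x₀).symm y = x :=
    ⟨_, (extChartAt (𝓡 m) x₀).map_source hx, (extChartAt (𝓡 m) x₀).left_inv hx⟩
  rw [(extChartAt (𝓡 m) x₀).right_inv hy]
  have h := mfderivWithin_extChartAt_symm_comp_mfderiv_extChartAt hy
  rw [ModelWithCorners.range_eq_univ, mfderivWithin_univ] at h
  exact ContinuousAlternatingMap.ext fun v =>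
    congrArg (α ((extChartAt (𝓡 m) x₀).symm y)) (funext fun i => DFunLike.congr_fun h (v i))

theorem fderiv_comp_extChartAt_symm (hι : ContMDiff (𝓡 m) 𝓘(ℝ, EuclideanSpace ℝ (Fin l)) ∞ ι) {x₀ : M}
    {y : EuclideanSpace ℝ (Fin m)} (hy : y ∈ (extChartAt (𝓡 m) x₀).target) :
    fderiv ℝ (ι ∘ (extChartAt (𝓡 m) x₀).symm) y =
      (tangentMapAt m ι ((extChartAt (𝓡 m) x₀).symm y)).comp
        (mfderiv 𝓘(ℝ, EuclideanSpace ℝ (Fin m)) (𝓡 m) (extChartAt (𝓡 m) x₀).symm y) := by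
  rw [← mfderiv_eq_fderiv]
  exact mfderiv_comp y (hι.mdifferentiableAt (by simp)) (mdifferentiableAt_extChartAt_symm_of_mem hy)

theorem contDiffAt_comp_extChartAt_symm (hι : ContMDiff (𝓡 m) 𝓘(ℝ, EuclideanSpace ℝ (Fin l)) ∞ ι)
    {x₀ : M} {y : EuclideanSpace ℝ (Fin m)} (hy : y ∈ (extChartAt (𝓡 m) x₀).target) :
    ContDiffAt ℝ ∞ (ι ∘ (extChartAt (𝓡 m) x₀).symm) y := by
  rw [← contMDiffAt_iff_contDiffAt]
  exact hι.contMDiffAt.comp y ((contMDiffOn_extChartAt_symm x₀).contMDiffAt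
    ((isOpen_extChartAt_target x₀).mem_nhds hy))

theorem fderiv_comp_mfderiv_extChartAt (hι : ContMDiff (𝓡 m) 𝓘(ℝ, EuclideanSpace ℝ (Fin l)) ∞ ι)
    {x₀ x : M} (hx : x ∈ (extChartAt (𝓡 m) x₀).source) (v : TangentSpace (𝓡 m) x) :
    fderiv ℝ (ι ∘ (extChartAt (𝓡 m) x₀).symm) (extChartAt (𝓡 m) x₀ x)
      (mfderiv (𝓡 m) 𝓘(ℝ, EuclideanSpace ℝ (Fin m)) (extChartAt (𝓡 m) x₀) x v) =
        tangentMapAt m ι x v := by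
  have hy := (extChartAt (𝓡 m) x₀).map_source hx
  have h1 : mfderiv (𝓡 m) 𝓘(ℝ, EuclideanSpace ℝ (Fin l))
      ((ι ∘ (extChartAt (𝓡 m) x₀).symm) ∘ extChartAt (𝓡 m) x₀) x = tangentMapAt m ι x := by
    refine Filter.EventuallyEq.mfderiv_eq ?_
    filter_upwards [(isOpen_extChartAt_source x₀).mem_nhds hx] with z hz
    exact congrArg ι ((extChartAt (𝓡 m) x₀).left_inv hz)
  rw [← h1, mfderiv_comp x ((contDiffAt_comp_extChartAt_symm hι hy).differentiableAt (by simp)).mdifferentiableAt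
    (mdifferentiableAt_extChartAt_of_mem hx), mfderiv_eq_fderiv]
  rfl

/-- The exterior derivative of the pull-back of a form on the ambient space. -/
theorem dForm_eq_of_extension (hι : ContMDiff (𝓡 m) 𝓘(ℝ, EuclideanSpace ℝ (Fin l)) ∞ ι)
    {α : DForm m M k}
    {β : EuclideanSpace ℝ (Fin l) → EuclideanSpace ℝ (Fin l) [⋀^Fin k]→L[ℝ] ℝ} (hβ : ContDiff ℝ 1 β)
    (h : ∀ x, α x = (β (ι x)).compContinuousLinearMap (tangentMapAt m ι x)) (x : M) :
    dForm α x = (extDeriv β (ι x)).compContinuousLinearMap (tangentMapAt m ι x) := by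
  have hx := mem_extChartAt_source (I := 𝓡 m) x
  have hy := (extChartAt (𝓡 m) x).map_source hx
  -- Near the centre of the chart the coordinate expression of `α` is the pull-back of `β` by `ι`
  -- read in the chart, and `d` commutes with that pull-back.
  have h1 : chartForm α x =ᶠ[𝓝 (extChartAt (𝓡 m) x x)] fun y =>
      (β ((ι ∘ (extChartAt (𝓡 m) x).symm) y)).compContinuousLinearMap
        (fderiv ℝ (ι ∘ (extChartAt (𝓡 m) x).symm) y) := by
    filter_upwards [(isOpen_extChartAt_target x).mem_nhds hy] with y hy'
    rw [fderiv_comp_extChartAt_symm hι hy', chartForm, h]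
    rfl
  have h2 : extDeriv (chartForm α x) (extChartAt (𝓡 m) x x) =
      (extDeriv β (ι x)).compContinuousLinearMap
        (fderiv ℝ (ι ∘ (extChartAt (𝓡 m) x).symm) (extChartAt (𝓡 m) x x)) := by
    rw [h1.extDeriv_eq, extDeriv_pullback (hβ.differentiable one_ne_zero _)
      ((contDiffAt_comp_extChartAt_symm hι hy).of_le (m := 2) (by norm_cast)) (by simp),
      Function.comp_apply,
      (extChartAt (𝓡 m) x).left_inv hx]
  rw [dForm, h2]
  exact ContinuousAlternatingMap.ext fun v =>
    congrArg (extDeriv β (ι x)) (funext fun i => fderiv_comp_mfderiv_extChartAt hι hx (v i))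

end Charts

/-! ### Extension of forms from the submanifold to the ambient space. -/

section Extension

open Module Metric Filter

variable {m l k : ℕ} {M : Type*} [TopologicalSpace M] [ChartedSpace (EuclideanSpace ℝ (Fin m)) M]
  [IsManifold (𝓡 m) ∞ M] {ι : M → EuclideanSpace ℝ (Fin l)}

theorem fderiv_comp_extChartAt_symm_injective
    (hι : ContMDiff (𝓡 m) 𝓘(ℝ, EuclideanSpace ℝ (Fin l)) ∞ ι)
    (hinj : ∀ x, Function.Injective (tangentMapAt m ι x)) {x₀ : M} {y : EuclideanSpace ℝ (Fin m)}
    (hy : y ∈ (extChartAt (𝓡 m) x₀).target) :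
    Function.Injective (fderiv ℝ (ι ∘ (extChartAt (𝓡 m) x₀).symm) y) := by
  have : IsManifold (𝓡 m) 1 M := IsManifold.of_le (n := ∞) (by simp)
  rw [fderiv_comp_extChartAt_symm hι hy]
  have h := isInvertible_mfderivWithin_extChartAt_symm hy
  rw [ModelWithCorners.range_eq_univ, mfderivWithin_univ] at h
  exact (hinj _).comp h.injective

/-- An immersion has a smooth local left inverse. -/
theorem exists_local_leftInverse {f : EuclideanSpace ℝ (Fin m) → EuclideanSpace ℝ (Fin l)}
    {y₀ : EuclideanSpace ℝ (Fin m)} (hf : ContDiffAt ℝ 2 f y₀)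
    (hinj : Function.Injective (fderiv ℝ f y₀)) :
    ∃ R : EuclideanSpace ℝ (Fin l) → EuclideanSpace ℝ (Fin m), ContDiffAt ℝ 2 R (f y₀) ∧
      ∀ᶠ y in 𝓝 y₀, R (f y) = y := by
  -- With `T` a linear left inverse of the derivative, `T ∘ f` is a local diffeomorphism, and `R` is
  -- its local inverse composed with `T`.
  obtain ⟨T, hT⟩ := (fderiv ℝ f y₀ : EuclideanSpace ℝ (Fin m) →ₗ[ℝ] EuclideanSpace ℝ (Fin l)).exists_leftInverse_of_injective
    (LinearMap.ker_eq_bot.2 hinj)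
  set T' : EuclideanSpace ℝ (Fin l) →L[ℝ] EuclideanSpace ℝ (Fin m) := LinearMap.toContinuousLinearMap T
    with hT'
  have hTf : ContDiffAt ℝ 2 (fun y => T' (f y)) y₀ := T'.contDiff.contDiffAt.comp y₀ hf
  have hder : HasFDerivAt (fun y => T' (f y))
      (ContinuousLinearEquiv.refl ℝ (EuclideanSpace ℝ (Fin m)) :
        EuclideanSpace ℝ (Fin m) →L[ℝ] EuclideanSpace ℝ (Fin m)) y₀ := by
    have h1 := T'.hasFDerivAt.comp y₀ (hf.differentiableAt two_ne_zero).hasFDerivAt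
    refine h1.congr_fderiv ?_
    ext1 v
    exact DFunLike.congr_fun hT v
  refine ⟨fun z => hTf.localInverse hder two_ne_zero (T' z), ?_, ?_⟩
  · exact (hTf.to_localInverse hder two_ne_zero).comp (f y₀) T'.contDiff.contDiffAt
  · exact (hTf.hasStrictFDerivAt' hder two_ne_zero).eventually_left_inverse

/-- Every smooth form on a compact submanifold of `ℝ^l` is the restriction of a form on `ℝ^l`. -/
theorem exists_form_extension [CompactSpace M]
    (hι : ContMDiff (𝓡 m) 𝓘(ℝ, EuclideanSpace ℝ (Fin l)) ∞ ι) (hemb : IsEmbedding ι)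
    (hinj : ∀ x, Function.Injective (tangentMapAt m ι x)) {α : DForm m M k} (hα : IsSmoothForm α) :
    ∃ β : EuclideanSpace ℝ (Fin l) → EuclideanSpace ℝ (Fin l) [⋀^Fin k]→L[ℝ] ℝ, ContDiff ℝ 1 β ∧
      ∀ x, α x = (β (ι x)).compContinuousLinearMap (tangentMapAt m ι x) := by
  -- The admissible values at `z`: an affine condition at points of the image and none elsewhere.
  -- These sets are convex, so a partition of unity glues local solutions.
  set t : EuclideanSpace ℝ (Fin l) → Set (EuclideanSpace ℝ (Fin l) [⋀^Fin k]→L[ℝ] ℝ) := fun z =>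
    {b | ∀ x, ι x = z → α x = b.compContinuousLinearMap (tangentMapAt m ι x)} with ht
  have hconv : ∀ z, Convex ℝ (t z) := by
    intro z b hb b' hb' s s' _ _ hss x hx
    refine ContinuousAlternatingMap.ext fun v => ?_
    have h1 := DFunLike.congr_fun (hb x hx) v
    have h2 := DFunLike.congr_fun (hb' x hx) v
    calc α x v = s * α x v + s' * α x v := by rw [← add_mul, hss, one_mul]
      _ = s * (b.compContinuousLinearMap (tangentMapAt m ι x) v) +
          s' * (b'.compContinuousLinearMap (tangentMapAt m ι x) v) := by rw [← h1, ← h2]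
      _ = _ := rfl
  have hloc : ∀ z, ∃ U ∈ 𝓝 z, ∃ β : EuclideanSpace ℝ (Fin l) → EuclideanSpace ℝ (Fin l) [⋀^Fin k]→L[ℝ] ℝ,
      ContMDiffOn 𝓘(ℝ, EuclideanSpace ℝ (Fin l))
        𝓘(ℝ, EuclideanSpace ℝ (Fin l) [⋀^Fin k]→L[ℝ] ℝ) ((1 : ℕ∞) : WithTop ℕ∞) β U ∧
      ∀ y ∈ U, β y ∈ t y := by
    intro z
    by_cases hz : z ∈ range ι
    swap
    · refine ⟨(range ι)ᶜ, (isCompact_range hemb.continuous).isClosed.isOpen_compl.mem_nhds hz, 0,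
        contMDiffOn_const, fun y hy x hx => (hy ⟨x, hx⟩).elim⟩
    obtain ⟨x₀, rfl⟩ := hz
    set e := extChartAt (𝓡 m) x₀ with he
    set f := ι ∘ e.symm with hf
    have hx₀ : x₀ ∈ e.source := mem_extChartAt_source x₀
    have hy₀ : e x₀ ∈ e.target := e.map_source hx₀
    have hf₀ : f (e x₀) = ι x₀ := congrArg ι (e.left_inv hx₀)
    obtain ⟨R, hR, hRf⟩ := exists_local_leftInverse
      ((contDiffAt_comp_extChartAt_symm hι hy₀).of_le (m := 2) (by norm_cast))
      (fderiv_comp_extChartAt_symm_injective hι hinj hy₀)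
    change ContDiffAt ℝ 2 R (f (e x₀)) at hR
    change ∀ᶠ y in 𝓝 (e x₀), R (f y) = y at hRf
    rw [hf₀] at hR
    have hRι : ∀ᶠ x in 𝓝 x₀, x ∈ e.source ∧ ∀ᶠ x' in 𝓝 x, R (ι x') = e x' := by
      have h1 : ∀ᶠ x in 𝓝 x₀, x ∈ e.source := (isOpen_extChartAt_source x₀).mem_nhds hx₀
      have h2 : ∀ᶠ x in 𝓝 x₀, R (f (e x)) = e x := (continuousAt_extChartAt x₀).eventually hRf
      refine h1.and (eventually_eventually_nhds.2 ?_)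
      filter_upwards [h1, h2] with x hx1 hx2
      rwa [show f (e x) = ι x from congrArg ι (e.left_inv hx1)] at hx2
    -- Because `ι` is an embedding, and not only an immersion, every point of `M` whose image is
    -- close to `ι x₀` is itself close to `x₀`. No other sheet of the image interferes.
    rw [hemb.nhds_eq_comap, eventually_comap] at hRι
    have hR₀ : R (ι x₀) = e x₀ := by rw [← hf₀]; exact hRf.self_of_nhds
    have hRt : ∀ᶠ z in 𝓝 (ι x₀), R z ∈ e.target :=
      hR.continuousAt.eventually (by
        rw [hR₀]; exact (isOpen_extChartAt_target x₀).mem_nhds hy₀)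
    have hR2 : ∀ᶠ z in 𝓝 (ι x₀), ContDiffAt ℝ 2 R z := hR.eventually (by simp)
    -- The local solution is the pull-back of the coordinate expression of `α` by `R`; it restricts
    -- to `α` because `R ∘ ι` is the chart.
    refine ⟨_, hRι.and (hRt.and hR2), fun z => (chartForm α x₀ (R z)).compContinuousLinearMap (fderiv ℝ R z),
      fun z hz => ?_, fun z hz x hx => ?_⟩
    · refine ContDiffWithinAt.contMDiffWithinAt (ContDiffAt.contDiffWithinAt ?_)
      obtain ⟨-, hz1, hz2⟩ := hz
      have h1 : ContDiffAt ℝ 1 (fun z => chartForm α x₀ (R z)) z :=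
        (((hα x₀).contDiffAt ((isOpen_extChartAt_target x₀).mem_nhds hz1)).of_le (by simp)).comp z
          (hz2.of_le one_le_two)
      have h2 : ContDiffAt ℝ 1 (fderiv ℝ R) z := hz2.fderiv_right (by norm_num)
      exact contDiffWithinAt_univ.1
        (contDiffWithinAt_alternating_comp h1.contDiffWithinAt h2.contDiffWithinAt)
    · subst hx
      obtain ⟨hz0, -, hz2⟩ := hz
      obtain ⟨hxs, hxR⟩ := hz0 x rfl
      have h1 : (fderiv ℝ R (ι x)).comp (tangentMapAt m ι x) =
          mfderiv (𝓡 m) 𝓘(ℝ, EuclideanSpace ℝ (Fin m)) e x := by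
        have h2 : mfderiv (𝓡 m) 𝓘(ℝ, EuclideanSpace ℝ (Fin m)) (R ∘ ι) x =
            mfderiv (𝓡 m) 𝓘(ℝ, EuclideanSpace ℝ (Fin m)) e x := Filter.EventuallyEq.mfderiv_eq hxR
        rw [← h2, mfderiv_comp x (hz2.differentiableAt two_ne_zero).mdifferentiableAt
          (hι.mdifferentiableAt (by simp)), mfderiv_eq_fderiv]
        rfl
      have h3 := chartForm_comp_mfderiv α hxs
      have hRx : R (ι x) = e x := hxR.self_of_nhds
      refine ContinuousAlternatingMap.ext fun v => ?_
      have h4 : α x v = chartForm α x₀ (e x) fun i => fderiv ℝ R (ι x) (tangentMapAt m ι x (v i)) :=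
        (DFunLike.congr_fun h3 v).symm.trans (congrArg (chartForm α x₀ (e x))
          (funext fun i => (DFunLike.congr_fun h1 (v i)).symm))
      rw [← hRx] at h4
      exact h4
  obtain ⟨β, hβ⟩ := exists_contMDiffMap_forall_mem_convex_of_local 𝓘(ℝ, EuclideanSpace ℝ (Fin l)) hconv hloc
  exact ⟨β, β.contMDiff.contDiff, fun x => hβ (ι x) x rfl⟩

end Extension

/-! ### Isometric embeddings and a lower bound for the comass. -/

section Comass

open Module Metric Filter

variable {m l k : ℕ} {M : Type*} [TopologicalSpace M] [ChartedSpace (EuclideanSpace ℝ (Fin m)) M]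
  [IsManifold (𝓡 m) ∞ M] [RiemannianBundle (fun x : M => TangentSpace (𝓡 m) x)]
  {ι : M → EuclideanSpace ℝ (Fin l)}

theorem IsNashEmbedding.injective_tangentMapAt (hι : IsNashEmbedding m ι) (x : M) :
    Function.Injective (tangentMapAt m ι x) := by
  refine (injective_iff_map_eq_zero _).2 fun v hv => ?_
  have := hι.norm_mfderiv x v
  rw [hv, norm_zero] at this
  exact norm_eq_zero.1 this.symm

theorem IsNashEmbedding.norm_comp (hι : IsNashEmbedding m ι) (x : M) {E : Type*} [NormedAddCommGroup E]
    [NormedSpace ℝ E] (L : E →L[ℝ] TangentSpace (𝓡 m) x) : ‖(tangentMapAt m ι x).comp L‖ = ‖L‖ := by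
  refine le_antisymm ?_ ?_
  · refine ContinuousLinearMap.opNorm_le_bound _ (norm_nonneg L) fun v => ?_
    rw [ContinuousLinearMap.comp_apply, hι.norm_mfderiv]
    exact L.le_opNorm v
  · refine ContinuousLinearMap.opNorm_le_bound L (norm_nonneg _) fun v => ?_
    rw [← hι.norm_mfderiv x (L v)]
    exact ((tangentMapAt m ι x).comp L).le_opNorm v

/-- The ambient form `b` bounds the set of values from above, because `ι` preserves lengths. Without
such a bound the real supremum would carry no information. -/
theorem le_comass (hι : IsNashEmbedding m ι) {θ : DForm m M k} {x : M}
    {b : EuclideanSpace ℝ (Fin l) [⋀^Fin k]→L[ℝ] ℝ}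
    (hb : θ x = b.compContinuousLinearMap (tangentMapAt m ι x))
    (v : Fin k → TangentSpace (𝓡 m) x) (hv : ∀ i, ‖v i‖ ≤ 1) : θ x v ≤ comass θ x := by
  refine le_csSup ⟨‖b‖, ?_⟩ ⟨v, hv, rfl⟩
  rintro r ⟨u, hu, rfl⟩
  rw [hb]
  refine (le_abs_self _).trans ((b.le_opNorm _).trans ?_)
  refine mul_le_of_le_one_right (norm_nonneg _) (Finset.prod_le_one (fun _ _ => norm_nonneg _) fun i _ => ?_)
  exact (hι.norm_mfderiv x (u i)).le.trans (hu i)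

/-- The comass of a nowhere vanishing form on a compact manifold is bounded from below. -/
theorem exists_pos_le_comass [CompactSpace M] (hι : IsNashEmbedding m ι) (hk : 0 < k) {θ : DForm m M k}
    (hθ : IsSmoothForm θ) (hθ0 : ∀ x, θ x ≠ 0) : ∃ c : ℝ, 0 < c ∧ ∀ x, c ≤ comass θ x := by
  obtain ⟨β, -, hβ⟩ := exists_form_extension hι.contMDiff hι.isEmbedding hι.injective_tangentMapAt hθ
  suffices h : ∃ c : ℝ, 0 < c ∧ ∀ x ∈ (univ : Set M), c ≤ comass θ x by simpa using h
  -- By compactness a positive lower bound near each point is enough.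
  refine isCompact_univ.induction_on (p := fun s => ∃ c : ℝ, 0 < c ∧ ∀ x ∈ s, c ≤ comass θ x)
    ⟨1, one_pos, by simp⟩ (fun s s' hs ⟨c, hc, h⟩ => ⟨c, hc, fun x hx => h x (hs hx)⟩)
    (fun s s' ⟨c, hc, h⟩ ⟨c', hc', h'⟩ => ⟨min c c', lt_min hc hc', fun x hx => ?_⟩) fun x₀ _ => ?_
  · rcases hx with hx | hx
    · exact (min_le_left _ _).trans (h x hx)
    · exact (min_le_right _ _).trans (h' x hx)
  set e := extChartAt (𝓡 m) x₀ with he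
  set f := ι ∘ e.symm with hf
  have hx₀ : x₀ ∈ e.source := mem_extChartAt_source x₀
  have hy₀ : e x₀ ∈ e.target := e.map_source hx₀
  have hne : chartForm θ x₀ (e x₀) ≠ 0 := fun h0 => by
    refine hθ0 x₀ ?_
    rw [← chartForm_comp_mfderiv θ hx₀, h0]
    rfl
  obtain ⟨u, hu⟩ : ∃ u, 0 < chartForm θ x₀ (e x₀) u := by
    obtain ⟨u, hu⟩ : ∃ u, chartForm θ x₀ (e x₀) u ≠ 0 := by
      by_contra! hcon
      exact hne (ContinuousAlternatingMap.ext hcon)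
    rcases hu.lt_or_gt with hneg | hpos
    -- Reversing the first argument makes a negative value positive; this needs `k > 0`.
    · refine ⟨fun i => (if i = ⟨0, hk⟩ then (-1 : ℝ) else 1) • u i, ?_⟩
      rw [(chartForm θ x₀ (e x₀)).map_smul_univ]
      simpa using hneg
    · exact ⟨u, hpos⟩
  have hcu : ContinuousAt (fun y => chartForm θ x₀ y u) (e x₀) :=
    (ContinuousAlternatingMap.apply ℝ _ ℝ u).continuous.continuousAt.comp
      (((hθ x₀).contDiffAt ((isOpen_extChartAt_target x₀).mem_nhds hy₀)).continuousAt)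
  have hcf : ContinuousAt (fun y => fderiv ℝ f y) (e x₀) :=
    ((contDiffAt_comp_extChartAt_symm hι.contMDiff hy₀).fderiv_right (m := 0) (by simp)).continuousAt
  set a := chartForm θ x₀ (e x₀) u with ha
  obtain ⟨B, hB0, hB⟩ : ∃ B : ℝ, 0 < B ∧ ∀ i, ‖fderiv ℝ f (e x₀) (u i)‖ < B := by
    refine ⟨∑ i, ‖fderiv ℝ f (e x₀) (u i)‖ + 1, by positivity, fun i => ?_⟩
    have := Finset.single_le_sum (f := fun i => ‖fderiv ℝ f (e x₀) (u i)‖) (fun _ _ => norm_nonneg _)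
      (Finset.mem_univ i)
    linarith
  have hev : ∀ᶠ y in 𝓝 (e x₀), y ∈ e.target ∧ a / 2 < chartForm θ x₀ y u ∧
      ∀ i, ‖fderiv ℝ f y (u i)‖ < B := by
    refine ((isOpen_extChartAt_target x₀).eventually_mem hy₀).and
      ((hcu.eventually (lt_mem_nhds (half_lt_self hu))).and (eventually_all.2 fun i => ?_))
    have : ContinuousAt (fun y => ‖fderiv ℝ f y (u i)‖) (e x₀) :=
      (hcf.clm_apply continuousAt_const).norm
    exact this.eventually (gt_mem_nhds (hB i))
  -- Fixed coordinate vectors `u` are transported to nearby tangent spaces. Their Riemannian lengths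
  -- are read off in the ambient space and stay below `B`, so division by `B` gives competitors for
  -- the comass.
  have hle : ∀ y, (y ∈ e.target ∧ a / 2 < chartForm θ x₀ y u ∧ ∀ i, ‖fderiv ℝ f y (u i)‖ < B) →
      (B⁻¹) ^ k * (a / 2) ≤ comass θ (e.symm y) := by
    rintro y ⟨hyt, hya, hyB⟩
    set v : Fin k → TangentSpace (𝓡 m) (e.symm y) := fun i =>
      mfderiv 𝓘(ℝ, EuclideanSpace ℝ (Fin m)) (𝓡 m) e.symm y (u i) with hv
    have hvn : ∀ i, ‖v i‖ < B := fun i => by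
      rw [← hι.norm_mfderiv]
      have : fderiv ℝ f y (u i) = tangentMapAt m ι (e.symm y) (v i) :=
        DFunLike.congr_fun (fderiv_comp_extChartAt_symm hι.contMDiff hyt) (u i)
      exact this ▸ hyB i
    have h1 := le_comass hι (hβ (e.symm y)) (fun i => B⁻¹ • v i) fun i => by
      rw [norm_smul, norm_inv, Real.norm_eq_abs, abs_of_pos hB0, inv_mul_le_one₀ hB0]
      exact (hvn i).le
    refine le_trans ?_ h1
    rw [(θ (e.symm y)).map_smul_univ (fun _ => B⁻¹) v]
    simp only [Finset.prod_const, Finset.card_univ, Fintype.card_fin, smul_eq_mul]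
    exact mul_le_mul_of_nonneg_left hya.le (by positivity)
  refine ⟨_, mem_nhdsWithin_of_mem_nhds (((continuousAt_extChartAt x₀).eventually hev).and
    ((isOpen_extChartAt_source x₀).eventually_mem hx₀)), (B⁻¹) ^ k * (a / 2), by positivity,
      fun x hx => ?_⟩
  have := hle (e x) hx.1
  rwa [e.left_inv hx.2] at this

end Comass

/-! ### Gluing local representatives. -/

section Representative

open Module Metric Filter

/-- Neighbourhoods have positive measure, so they meet every set of full measure. Hence limits along
this filter, in which null sets are ignored, are unique in a Hausdorff space. -/
theorem neBot_nhds_inf_ae {X : Type*} [TopologicalSpace X] [MeasurableSpace X] (μ : Measure X)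
    [μ.IsOpenPosMeasure] (x : X) : (𝓝 x ⊓ ae μ).NeBot := by
  refine inf_neBot_iff.2 fun {s} hs {t} ht => ?_
  by_contra hcon
  have hsub : s ⊆ tᶜ := fun y hy hyt => hcon ⟨y, hy, hyt⟩
  exact (Measure.measure_pos_of_mem_nhds μ hs).ne' (measure_mono_null hsub ht)

/-- A map into a compact space that locally, after an embedding, has continuous representatives, has a
continuous representative. -/
theorem exists_continuousOn_of_isEmbedding {X Y M : Type*} [TopologicalSpace X]
    [SecondCountableTopology X] [MeasurableSpace X] [OpensMeasurableSpace X] {μ : Measure X}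
    [μ.IsOpenPosMeasure] [TopologicalSpace Y] [T2Space Y] [TopologicalSpace M] [CompactSpace M]
    {ι : M → Y} (hι : IsEmbedding ι) {Ω : Set X} (hΩ : IsOpen Ω) (F : X → M)
    (h : ∀ x₀ ∈ Ω, ∃ U, IsOpen U ∧ x₀ ∈ U ∧ U ⊆ Ω ∧ ∃ f' : X → Y, ContinuousOn f' U ∧
      ∀ᵐ x ∂μ, x ∈ U → f' x = (ι ∘ F) x) :
    ∃ G : X → M, ContinuousOn G Ω ∧ G =ᵐ[μ.restrict Ω] F := by
  have hnb := neBot_nhds_inf_ae μ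
  -- The value of a local continuous representative is the essential limit of `ι ∘ F`, hence
  -- independent of the representative; this is why the local ones agree on overlaps.
  have hlim : ∀ {U : Set X} {f' : X → Y}, IsOpen U → ContinuousOn f' U →
      (∀ᵐ x ∂μ, x ∈ U → f' x = (ι ∘ F) x) → ∀ z ∈ U, Tendsto (ι ∘ F) (𝓝 z ⊓ ae μ) (𝓝 (f' z)) := by
    intro U f' hU hf' hae z hz
    refine (((hf'.continuousAt (hU.mem_nhds hz)).tendsto.mono_left inf_le_left).congr' ?_)
    filter_upwards [mem_inf_of_left (hU.mem_nhds hz), mem_inf_of_right hae] with x hx hx'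
    exact hx' hx
  have hcl : IsClosed (range ι) := (isCompact_range hι.continuous).isClosed
  have hex : ∀ z, ∃ y, z ∈ Ω → Tendsto (ι ∘ F) (𝓝 z ⊓ ae μ) (𝓝 (ι y)) := by
    intro z
    by_cases hz : z ∈ Ω
    · obtain ⟨U, hU, hzU, -, f', hf', hae⟩ := h z hz
      have h1 := hlim hU hf' hae z hzU
      -- The image of the compact `M` is closed, so essential limits of `ι ∘ F` remain in it.
      have : f' z ∈ range ι := hcl.mem_of_tendsto h1 (Eventually.of_forall fun x => mem_range_self _)
      obtain ⟨y, hy⟩ := this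
      exact ⟨y, fun _ => hy ▸ h1⟩
    · exact ⟨F z, fun h => absurd h hz⟩
  choose G hG using hex
  have hloc : ∀ x₀ ∈ Ω, ∃ U, IsOpen U ∧ x₀ ∈ U ∧ U ⊆ Ω ∧ ContinuousOn G U ∧
      ∀ᵐ x ∂μ, x ∈ U → G x = F x := by
    intro x₀ hx₀
    obtain ⟨U, hU, hxU, hUΩ, f', hf', hae⟩ := h x₀ hx₀
    have heq : EqOn (ι ∘ G) f' U := fun z hz =>
      tendsto_nhds_unique (hG z (hUΩ hz)) (hlim hU hf' hae z hz)
    refine ⟨U, hU, hxU, hUΩ, hι.continuousOn_iff.2 (hf'.congr heq), ?_⟩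
    filter_upwards [hae] with x hx hxU
    exact hι.injective ((heq hxU).trans (hx hxU))
  refine ⟨G, fun x hx => ?_, ?_⟩
  · obtain ⟨U, hU, hxU, -, hGU, -⟩ := hloc x hx
    exact (hGU.continuousAt (hU.mem_nhds hxU)).continuousWithinAt
  · rw [EventuallyEq, ae_restrict_iff' hΩ.measurableSet]
    have h0 : μ {x | ¬(x ∈ Ω → G x = F x)} = 0 := by
      -- Exceptional sets are null only locally; second countability makes their union null.
      refine measure_null_of_locally_null _ fun x hx => ?_
      have hxΩ : x ∈ Ω := by
        by_contra hcon
        exact hx fun h => absurd h hcon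
      obtain ⟨U, hU, hxU, -, -, hae⟩ := hloc x hxΩ
      refine ⟨_, inter_mem_nhdsWithin _ (hU.mem_nhds hxU), measure_mono_null ?_ hae⟩
      rintro z ⟨hz, hzU⟩ hz'
      exact hz fun _ => hz' hzU
    exact h0

end Representative

/-! ### Bounded maps are locally in every Lebesgue space. -/

section Boundedness

variable {n : ℕ} {V : Type*} [NormedAddCommGroup V] {Ω : Set (EuclideanSpace ℝ (Fin n))}

theorem MemLpLoc.of_bound {f : EuclideanSpace ℝ (Fin n) → V} {p q : ℝ≥0∞} (hf : MemLpLoc f p Ω)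
    {R : ℝ} (hR : ∀ x, ‖f x‖ ≤ R) : MemLpLoc f q Ω := fun C hC hCc => by
  have : IsFiniteMeasure (volume.restrict C) :=
    ⟨by rw [Measure.restrict_apply_univ]; exact hCc.measure_lt_top⟩
  exact MemLp.of_bound (hf C hC hCc).1 R (ae_of_all _ hR)

end Boundedness

/-! ### The pull-back of a form in the Künneth ideal. -/

section Pullback

variable {m n l : ℕ} {M : Type*} [TopologicalSpace M] [ChartedSpace (EuclideanSpace ℝ (Fin m)) M]
  [IsManifold (𝓡 m) ∞ M] [RiemannianBundle (fun x : M => TangentSpace (𝓡 m) x)] [CompactSpace M]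

/-- The form `F^*w`, for `w` in the Künneth ideal, satisfies a compensated compactness estimate. -/
theorem exists_hasCompensatedBound_starPullback (hn : 2 ≤ n) {w : DForm m M n}
    (hwK : InKunnethIdeal w) {Ω : Set (EuclideanSpace ℝ (Fin n))} (hΩ : IsOpen Ω)
    {F : EuclideanSpace ℝ (Fin n) → M}
    {DF : ∀ x, EuclideanSpace ℝ (Fin n) →L[ℝ] TangentSpace (𝓡 m) (F x)}
    {ι : M → EuclideanSpace ℝ (Fin l)} (hι : IsNashEmbedding m ι)
    {g : EuclideanSpace ℝ (Fin n) → EuclideanSpace ℝ (Fin n) →L[ℝ] EuclideanSpace ℝ (Fin l)}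
    {R : ℝ} (hR : ∀ x, ‖(ι ∘ F) x‖ ≤ R)
    (hf : MemLpLoc (ι ∘ F) (ENNReal.ofReal n) Ω) (hg : MemLpLoc g (ENNReal.ofReal n) Ω)
    (hfg : HasWeakDeriv Ω (ι ∘ F) g)
    (hgD : ∀ᵐ x ∂volume.restrict Ω, g x = (tangentMapAt m ι (F x)).comp (DF x))
    {c θ p : ℝ} (hc : 0 ≤ c) (hθ : n * θ = 1 / 2) (hp : p = n / (1 + θ)) :
    ∃ J : EuclideanSpace ℝ (Fin n) → ℝ, HasCompensatedBound Ω θ p c g J ∧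
      ∀ᵐ x ∂volume.restrict Ω, starPullback w F DF x = J x := by
  obtain ⟨N, k, j, hkj, α, β, hαβ, q, hq, τ, hτ, heq⟩ := hwK
  have hext : ∀ {r : ℕ} {η : DForm m M r}, IsSmoothForm η →
      ∃ b : EuclideanSpace ℝ (Fin l) → EuclideanSpace ℝ (Fin l) [⋀^Fin r]→L[ℝ] ℝ, ContDiff ℝ 1 b ∧
      ∀ x, η x = (b (ι x)).compContinuousLinearMap (tangentMapAt m ι x) := fun h =>
    exists_form_extension hι.contMDiff hι.isEmbedding hι.injective_tangentMapAt h
  have hpull : ∀ {r : ℕ} {η : DForm m M r}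
      {b : EuclideanSpace ℝ (Fin l) → EuclideanSpace ℝ (Fin l) [⋀^Fin r]→L[ℝ] ℝ},
      (∀ x, η x = (b (ι x)).compContinuousLinearMap (tangentMapAt m ι x)) →
      ∀ {x}, g x = (tangentMapAt m ι (F x)).comp (DF x) →
      (b ((ι ∘ F) x)).compContinuousLinearMap (g x) = (η (F x)).compContinuousLinearMap (DF x) := by
    intro r η b hb x hx
    refine ContinuousAlternatingMap.ext fun v => ?_
    have h1 := DFunLike.congr_fun (hb (F x)) fun i => DF x (v i)
    refine Eq.trans ?_ h1.symm
    exact congrArg (b (ι (F x))) (funext fun i => DFunLike.congr_fun hx (v i))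
  -- The extension of a closed form is closed only along `M`: its exterior derivative restricts to
  -- `dη = 0`, and `g` factors through the tangent spaces of `M`.
  have hzero : ∀ {r : ℕ} {η : DForm m M r}
      {b : EuclideanSpace ℝ (Fin l) → EuclideanSpace ℝ (Fin l) [⋀^Fin r]→L[ℝ] ℝ},
      ContDiff ℝ 1 b → IsClosedForm η →
      (∀ x, η x = (b (ι x)).compContinuousLinearMap (tangentMapAt m ι x)) →
      ∀ᵐ x ∂volume.restrict Ω, (extDeriv b ((ι ∘ F) x)).compContinuousLinearMap (g x) = 0 := by
    intro r η b hbc hη hb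
    filter_upwards [hgD] with x hx
    rw [hpull (η := dForm η) (b := extDeriv b) (fun y => dForm_eq_of_extension hι.contMDiff hbc hb y) hx,
      hη.2]
    rfl
  choose a ha hαa using fun i => hext (hαβ i).2.2.1.1
  choose b hb hβb using fun i => hext (hαβ i).2.2.2.1
  obtain ⟨t, ht, hτt⟩ := hext hτ
  set e : Fin n → EuclideanSpace ℝ (Fin n) := fun i => EuclideanSpace.single i 1 with he
  have he1 : ∀ i, ‖e i‖ ≤ 1 := fun i => by simp [he]
  -- `J` is written entirely in terms of `ι ∘ F` and `g`, one product for each pair of closed forms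
  -- and one exact term. The form in the exact term has degree `n - 1 ≥ 1`, by `n ≥ 2`.
  refine ⟨fun x => (∑ i, wedge (hkj i) ((a i ((ι ∘ F) x)).compContinuousLinearMap (g x))
      ((b i ((ι ∘ F) x)).compContinuousLinearMap (g x)) e) +
      (extDeriv t ((ι ∘ F) x)).compContinuousLinearMap (g x) (e ∘ Fin.cast hq),
    (HasCompensatedBound.sum fun i _ => hasCompensatedBound_wedge hΩ (hkj i) (hαβ i).1 (hαβ i).2.1 hR hf
      hg hfg (ha i) (hb i) (hzero (ha i) (hαβ i).2.2.1 (hαa i)) (hzero (hb i) (hαβ i).2.2.2 (hβb i)) hc hθ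
      hp e he1).add (hasCompensatedBound_extDeriv hΩ hq (by omega) hR hf hg hfg ht hc hθ hp _
      fun i => he1 _), ?_⟩
  filter_upwards [hgD] with x hx
  have h1 := sub_eq_iff_eq_add'.1 (heq (F x) fun i => DF x (e i))
  refine h1.trans (congrArg₂ (· + ·) ?_ ?_)
  · rw [ContinuousAlternatingMap.sum_apply]
    refine Finset.sum_congr rfl fun i _ => ?_
    rw [hpull (hαa i) hx, hpull (hβb i) hx]
    exact wedge_compContinuousLinearMap (hkj i) _ _ (DF x) e
  · exact (DFunLike.congr_fun (hpull (η := dForm τ) (b := extDeriv t)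
      (fun y => dForm_eq_of_extension hι.contMDiff ht hτt y) hx) (e ∘ Fin.cast hq)).symm

end Pullback

end QRCurve

/-! ### Assembly of the theorem. -/

theorem proposition1p5 {m n : ℕ} (hn : 2 ≤ n) (hnm : n ≤ m)
    {M : Type*} [MetricSpace M] [CompactSpace M] [ConnectedSpace M]
    [ChartedSpace (EuclideanSpace ℝ (Fin m)) M] [IsManifold (𝓡 m) ∞ M]
    [RiemannianBundle (fun x : M => TangentSpace (𝓡 m) x)]
    [IsContMDiffRiemannianBundle (𝓡 m) ∞ (EuclideanSpace ℝ (Fin m))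
      (fun x : M => TangentSpace (𝓡 m) x)]
    [IsRiemannianManifold (𝓡 m) M]
    (hM : QRCurve.Orientable m M)
    (w : QRCurve.DForm m M n) (hw : QRCurve.IsClosedForm w) (hw0 : ∀ x, w x ≠ 0)
    (hwK : QRCurve.InKunnethIdeal w)
    (Ω : Set (EuclideanSpace ℝ (Fin n))) (hΩ : IsOpen Ω)
    (F : EuclideanSpace ℝ (Fin n) → M)
    (DF : ∀ x, EuclideanSpace ℝ (Fin n) →L[ℝ] TangentSpace (𝓡 m) (F x))
    (hF : QRCurve.IsSobolevMap (n : ℝ≥0∞) Ω F DF)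
    (K : ℝ) (hK : 0 ≤ K)
    (S : EuclideanSpace ℝ (Fin n) → ℝ) (ε : ℝ) (hε : 0 < ε)
    (hS : QRCurve.MemLpLoc S (ENNReal.ofReal (1 + ε)) Ω)
    (hdist :
      (∀ᵐ x ∂volume.restrict Ω,
        QRCurve.comass w (F x) * ‖DF x‖ ^ n ≤ K * QRCurve.starPullback w F DF x + S x) ∨
      (∃ y₀ : M, ∀ᵐ x ∂volume.restrict Ω,
        QRCurve.comass w (F x) * ‖DF x‖ ^ n ≤
          K * QRCurve.starPullback w F DF x + dist (F x) y₀ ^ n * S x)) :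
    ∃ ε' : ℝ, 0 < ε' ∧ QRCurve.IsSobolevMap (ENNReal.ofReal (n + ε')) Ω F DF ∧
      ∃ G : EuclideanSpace ℝ (Fin n) → M, ContinuousOn G Ω ∧ G =ᵐ[volume.restrict Ω] F := by
  obtain ⟨l, ι, g, hι, hf, hg, hfg, hgD⟩ := hF
  rw [← ENNReal.ofReal_natCast] at hf hg
  obtain ⟨R, hR⟩ : ∃ R, ∀ y, ‖ι y‖ ≤ R := by
    obtain ⟨R, hR⟩ := (isCompact_range hι.contMDiff.continuous).isBounded.exists_norm_le
    exact ⟨R, fun y => hR _ (mem_range_self y)⟩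
  have hRF : ∀ x, ‖(ι ∘ F) x‖ ≤ R := fun x => hR _
  have hn0 : (0 : ℝ) < n := by positivity
  obtain ⟨c, hc, hcut⟩ := QRCurve.exists_cutoff n
  -- The value `θ = 1 / (2n)` is the one for which the segment integrals have the singularity
  -- `t^{-1/2}`.
  obtain ⟨θ, hθ⟩ : ∃ θ : ℝ, n * θ = 1 / 2 := ⟨1 / (2 * n), by field_simp⟩
  have hθ0 : 0 < θ := pos_of_mul_pos_right (hθ.symm ▸ by norm_num) hn0.le
  obtain ⟨J, hJ, hwJ⟩ := QRCurve.exists_hasCompensatedBound_starPullback hn hwK hΩ hι hRF hf hg hfg hgD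
    hc hθ rfl
  obtain ⟨c₀, hc₀, hc₀w⟩ := QRCurve.exists_pos_le_comass hι (by omega) hw.1 hw0
  obtain ⟨S', hS', hle⟩ : ∃ S', QRCurve.MemLpLoc S' (ENNReal.ofReal (1 + ε)) Ω ∧
      ∀ᵐ x ∂volume.restrict Ω, QRCurve.comass w (F x) * ‖DF x‖ ^ n ≤
        K * QRCurve.starPullback w F DF x + S' x := by
    rcases hdist with h | ⟨y₀, h⟩
    · exact ⟨S, hS, h⟩
    -- On a compact manifold the weighted inequality reduces to the unweighted one, the distance
    -- being at most the diameter. The absolute value is needed because `S` may be negative.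
    · refine ⟨fun x => Metric.diam (univ : Set M) ^ n * ‖S x‖,
        fun C hC hCc => (hS C hC hCc).norm.const_mul _, ?_⟩
      filter_upwards [h] with x hx
      refine hx.trans (add_le_add_right ?_ _)
      have hd : dist (F x) y₀ ≤ Metric.diam (univ : Set M) :=
        Metric.dist_le_diam_of_mem isCompact_univ.isBounded (mem_univ _) (mem_univ _)
      calc dist (F x) y₀ ^ n * S x ≤ dist (F x) y₀ ^ n * ‖S x‖ := by
            gcongr; exact Real.le_norm_self _
        _ ≤ _ := by gcongr
  -- The factor `K` is put into the compensated bound. In the pointwise inequality `‖g x‖ = ‖DF x‖`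
  -- because `ι` is isometric.
  obtain ⟨ε', hε', hgε⟩ := QRCurve.exists_memLpLoc_of_hasCompensatedBound hΩ (by omega) hθ0 rfl hcut hg
    (hJ.const_mul K) hε hS' hc₀ (by
      filter_upwards [hle, hwJ, hgD] with x hx hxJ hxg
      rw [← hxJ, hxg, hι.norm_comp]
      exact (mul_le_mul_of_nonneg_right (hc₀w _) (by positivity)).trans hx)
  have hfε : QRCurve.MemLpLoc (ι ∘ F) (ENNReal.ofReal (n + ε')) Ω := hf.of_bound hRF
  have hn1 : (2 : ℝ) ≤ n := by exact_mod_cast hn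
  refine ⟨ε', hε', ⟨l, ι, g, hι, hfε, hgε, hfg, hgD⟩,
    QRCurve.exists_continuousOn_of_isEmbedding hι.isEmbedding hΩ F fun x₀ hx₀ =>
      QRCurve.exists_continuousOn_of_memLpLoc hΩ (by linarith) (by linarith) hfε hRF hgε hfg hx₀⟩
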